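/- An (a,b)-module is a free $\mathbb C[[b]]$-module of finite rank with a $\mathbb C$-linear $b$-adically continuous map $a$ such that $ab-ba=b^2$; over a reduced complex space $X$, a sheaf of $\mathcal O_X$-(a,b)-modules is a locally free sheaf of finite type of $\mathcal O_X[[b]]$-modules with such an $\mathcal O_X$-linear action of $a$. For $\mu\in\,]0,1]\cap\mathbb Q$ let $\Xi_\mu^{(N)}=\bigoplus_{j=0}^N\mathbb C[[b]]\,e_{\mu,j}$ with $a e_{\mu,0}=\mu b e_{\mu,0}$, $a e_{\mu,j}=\mu b e_{\mu,j}+b e_{\mu,j-1}$ for $j\ge 1$. A holomorphic family of rank $k$ $[\mu]$-primitive themes over $X$ is a sheaf of $\mathcal O_X$-(a,b)-modules which is locally isomorphic to the subsheaf $\mathbb E_\varphi$ generated by the $a^\nu\varphi$, where $\varphi$ is a holomorphic map to $\Xi_\mu^{(k-1)}$ such that $\mathbb E_\varphi$ is free with basis $\varphi,\dots,a^{k-1}\varphi$ and has at each point $x$ the fibre generated by the $a^\nu\varphi(x)$ in $\Xi_\mu^{(k-1)}$, of rank $k$. It has fundamental invariants $\lambda_1,p_1,\dots,p_{k-1}$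 if each fibre has a filtration by $a$-stable submodules with successive quotients $\mathbb C[[b]]e_j$, $a e_j=\lambda_j b e_j$, $\lambda_{j+1}=\lambda_j+p_j-1$. Such a family $\mathbb E$ is universal near $x_0\in X$ if, for every holomorphic family $\mathbb H$ with the same invariants over a reduced complex space $Y$ and every $y_0\in Y$ with $H(y_0)\simeq E(x_0)$, there is a holomorphic map $f$ from a neighbourhood of $y_0$ to $X$ with $f(y_0)=x_0$ and $f^*\mathbb E\simeq\mathbb H$ near $y_0$, and the germ of $f$ at $y_0$ is unique. A theme of rank $k$ is invariant if it has an $(a,b)$-linear endomorphism of rank $k-1$. Let $\lambda_1>3$ be rational, $p_1=3$, $p_2=p_3=2$. For $\sigma=(\alpha,\beta,\gamma,\delta,\varepsilon,\theta)\in\mathbb C^6$ with $\alpha\gamma\theta\ne0$ let $E(\sigma)$ be the (a,b)-module with $\mathbb C[[b]]$-basis $e_1,\dots,e_4$ and $$(a-(\lambda_1+4)b)e_4=(1+\alpha b^2)e_3,\qquad (a-(\lambda_1+3)b)e_3=(1+\beta b+\gamma b^2)e_2,$$ $$(a-(\lambda_1+2)b)e_2=(1+\delta b+\varepsilon b^2+\theta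 b^3)e_1,\qquad (a-\lambda_1 b)e_1=0.$$ These form a holomorphic family (the canonical family) of rank 4 $[\lambda_1]$-primitive themes with fundamental invariants $\lambda_1,3,2,2$, and: 1. If $3\alpha\ne5\gamma$, then $E(\sigma)$ is not invariant, and its canonical form is not unique: up to isomorphism $E(\sigma)$ does not depend on $\varepsilon$. 2. If $3\alpha=5\gamma$, then $E(\sigma)$ is invariant, but there is no holomorphic family $\mathbb E$ of themes with these invariants over a reduced complex space $X$, and no $x_0\in X$ with $E(x_0)\simeq E(\sigma)$, such that $\mathbb E$ is universal near $x_0$. 3. If $\sigma_0=(\alpha_0,\beta_0,\gamma_0,\delta_0,\varepsilon_0,\theta_0)$ satisfies $3\alpha_0\ne5\gamma_0$, then $\sigma_0$ has an open neighbourhood in the hyperplane $\{\varepsilon=\varepsilon_0\}$ such that the restriction of the canonical family to it is universal near each of its points, and such that distinct points of it give non-isomorphic themes. -/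

import Mathlib

open scoped PowerSeries Topology

noncomputable section

namespace Themes

/-! ### Reduced complex spaces -/

/-- `A ⊆ ℂⁿ` is locally analytic: near each of its points it is the common zero set of finitely
many holomorphic functions. -/
def IsLocallyAnalytic {n : ℕ} (A : Set (Fin n → ℂ)) : Prop :=
  ∀ z ∈ A, ∃ W : Set (Fin n → ℂ), IsOpen W ∧ z ∈ W ∧
    ∃ (r : ℕ) (g : Fin r → (Fin n → ℂ) → ℂ), (∀ i, DifferentiableOn ℂ (g i) W) ∧
      A ∩ W = {w | w ∈ W ∧ ∀ i, g i w = 0}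

/-- A local chart of a reduced complex space: an open set together with a homeomorphism onto a
locally analytic subset of some `ℂⁿ` (`toFun` is irrelevant outside `dom`). -/
structure LocalModel (X : Type) [TopologicalSpace X] where
  dom : Set X
  isOpen_dom : IsOpen dom
  dim : ℕ
  toFun : X → (Fin dim → ℂ)
  isEmbedding : Topology.IsEmbedding (dom.domRestrict toFun)
  analytic : IsLocallyAnalytic (toFun '' dom)

/-- A reduced complex space. Since the space is reduced, the structure sheaf is a sheaf of
functions: it is given by an atlas of local models whose changes of charts are locally induced by
holomorphic maps of the ambient affine spaces. -/
structure ReducedComplexSpace where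
  carrier : Type
  [top : TopologicalSpace carrier]
  [t2 : T2Space carrier]
  atlas : Set (LocalModel carrier)
  cover : ∀ x : carrier, ∃ c ∈ atlas, x ∈ c.dom
  compat : ∀ c ∈ atlas, ∀ c' ∈ atlas, ∀ x ∈ c.dom ∩ c'.dom,
    ∃ F : (Fin c.dim → ℂ) → (Fin c'.dim → ℂ),
      AnalyticAt ℂ F (c.toFun x) ∧ ∀ᶠ y in 𝓝 x, c'.toFun y = F (c.toFun y)

instance : CoeSort ReducedComplexSpace Type := ⟨ReducedComplexSpace.carrier⟩

instance (X : ReducedComplexSpace) : TopologicalSpace X := X.top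

instance (X : ReducedComplexSpace) : T2Space X := X.t2

/-- `f` is holomorphic near `x`: in a chart it is locally the restriction of a holomorphic
function of the ambient affine space. -/
def HolAt {X : ReducedComplexSpace} (f : X → ℂ) (x : X) : Prop :=
  ∃ c ∈ X.atlas, x ∈ c.dom ∧ ∃ F : (Fin c.dim → ℂ) → ℂ,
    AnalyticAt ℂ F (c.toFun x) ∧ ∀ᶠ y in 𝓝 x, f y = F (c.toFun y)

/-- `f` is a holomorphic function on the open set `U`. -/
def HolOn {X : ReducedComplexSpace} (f : X → ℂ) (U : Set X) : Prop :=
  ∀ x ∈ U, HolAt f x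

/-- `S` is a section of `𝒪_X[[b]]` on the open set `U`: all its coefficients are holomorphic
on `U`. The variable of the power series is `b`. -/
def SeriesHolOn {X : ReducedComplexSpace} (S : X → ℂ⟦X⟧) (U : Set X) : Prop :=
  ∀ n : ℕ, HolOn (fun x => PowerSeries.coeff n (S x)) U

/-- `f` is a holomorphic map on the open set `U` of `Y`, with values in `X`. -/
def HolMapOn {Y X : ReducedComplexSpace} (f : Y → X) (U : Set Y) : Prop :=
  ∀ y ∈ U, ContinuousAt f y ∧
    ∀ c ∈ X.atlas, f y ∈ c.dom → ∀ i, HolAt (fun y' => c.toFun (f y') i) y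

/-- The inclusion in `ℂⁿ` of a locally analytic subset, as a chart. -/
def LocalModel.inclusion {n : ℕ} (A : Set (Fin n → ℂ)) (hA : IsLocallyAnalytic A) :
    LocalModel A where
  dom := Set.univ
  isOpen_dom := isOpen_univ
  dim := n
  toFun := Subtype.val
  isEmbedding := Topology.IsEmbedding.subtypeVal.comp Topology.IsEmbedding.subtypeVal
  analytic := by simpa using hA

/-- A locally analytic subset of `ℂⁿ` with its reduced complex structure. -/
def ReducedComplexSpace.ofSet {n : ℕ} (A : Set (Fin n → ℂ)) (hA : IsLocallyAnalytic A) :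
    ReducedComplexSpace where
  carrier := A
  atlas := {LocalModel.inclusion A hA}
  cover := fun x => ⟨LocalModel.inclusion A hA, rfl, Set.mem_univ x⟩
  compat := by
    rintro c rfl c' rfl x -
    exact ⟨id, analyticAt_id, Filter.Eventually.of_forall fun _ => rfl⟩

theorem holAt_ofSet {n : ℕ} {A : Set (Fin n → ℂ)} (hA : IsLocallyAnalytic A)
    {F : (Fin n → ℂ) → ℂ} (hF : ∀ z, AnalyticAt ℂ F z) (x : ReducedComplexSpace.ofSet A hA) :
    HolAt (X := ReducedComplexSpace.ofSet A hA) (fun y : A => F y.1) x :=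
  ⟨LocalModel.inclusion A hA, rfl, Set.mem_univ _, F, hF _,
    Filter.Eventually.of_forall fun _ => rfl⟩

theorem holAt_const {X : ReducedComplexSpace} (z : ℂ) (x : X) : HolAt (fun _ : X => z) x := by
  obtain ⟨c, hc, hx⟩ := X.cover x
  exact ⟨c, hc, hx, fun _ => z, analyticAt_const, Filter.Eventually.of_forall fun _ => rfl⟩

/-! ### (a,b)-modules -/

/-- An (a,b)-module: a free `ℂ[[b]]`-module of finite rank with an additive map `a` such that
`a S = S a + b² S'` for `S ∈ ℂ[[b]]`. For constant `S` this is the `ℂ`-linearity of `a`, for `S = b`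
it is `a b - b a = b²`; for a `ℂ`-linear `a`, the latter implies the general
case, by `b`-adic continuity. -/
structure ABModule where
  carrier : Type
  [grp : AddCommGroup carrier]
  [mod : Module ℂ⟦X⟧ carrier]
  [free : Module.Free ℂ⟦X⟧ carrier]
  [fin : Module.Finite ℂ⟦X⟧ carrier]
  a : carrier →+ carrier
  a_smul : ∀ (S : ℂ⟦X⟧) (v : carrier),
    a (S • v) = S • a v + (PowerSeries.X ^ 2 * PowerSeries.derivative ℂ S) • v

instance : CoeSort ABModule Type := ⟨ABModule.carrier⟩

instance (E : ABModule) : AddCommGroup E := E.grp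

instance (E : ABModule) : Module ℂ⟦X⟧ E := E.mod

instance (E : ABModule) : Module.Free ℂ⟦X⟧ E := E.free

instance (E : ABModule) : Module.Finite ℂ⟦X⟧ E := E.fin

/-- Isomorphism of (a,b)-modules. -/
def Isomorphic (E F : ABModule) : Prop :=
  ∃ u : E ≃ₗ[ℂ⟦X⟧] F, ∀ v, u (E.a v) = F.a (u v)

/-- The (a,b)-module `⊕ ℂ[[b]] e_j` with `a e_j = ∑ i, M i j • e_i`. -/
def ABModule.ofMatrix {k : ℕ} (M : Matrix (Fin k) (Fin k) ℂ⟦X⟧) : ABModule where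
  carrier := Fin k → ℂ⟦X⟧
  a :=
    { toFun := fun v => M.mulVec v + fun i => PowerSeries.X ^ 2 * PowerSeries.derivative ℂ (v i)
      map_zero' := by ext1 i; simp
      map_add' := fun v w => by
        ext1 i
        simp only [Matrix.mulVec_add, Pi.add_apply, map_add]
        ring }
  a_smul := fun S v => by
    ext1 i
    simp only [AddMonoidHom.coe_mk, ZeroHom.coe_mk, Matrix.mulVec_smul, Pi.add_apply,
      Pi.smul_apply, smul_eq_mul, Derivation.leibniz]
    ring

/-- `Ξ_μ^{(N)} = ⊕_{j ≤ N} ℂ[[b]] e_{μ,j}`, with `a e_{μ,0} = μ b e_{μ,0}` and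
`a e_{μ,j} = μ b e_{μ,j} + b e_{μ,j-1}`; here `e_{μ,j}` stands for `s^{μ-1} (log s)^j / j!`. -/
def Xi (μ : ℚ) (N : ℕ) : ABModule :=
  ABModule.ofMatrix (k := N + 1) (Matrix.of fun i j =>
    if i = j then (PowerSeries.C (μ : ℂ)) * PowerSeries.X
    else if (i : ℕ) + 1 = j then PowerSeries.X else 0)

/-- The coefficient of `e_{μ,j}` in an element of `Ξ_μ^{(N)}`. -/
def Xi.coord (μ : ℚ) (N : ℕ) (v : Xi μ N) (j : Fin (N + 1)) : ℂ⟦X⟧ :=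
  (show Fin (N + 1) → ℂ⟦X⟧ from v) j

/-- An (a,b)-module (theme) of rank `k` is invariant when it has an endomorphism of rank `k - 1`. -/
def IsInvariant (E : ABModule) : Prop :=
  ∃ u : E →ₗ[ℂ⟦X⟧] E, (∀ v, u (E.a v) = E.a (u v)) ∧
    Module.finrank ℂ⟦X⟧ (LinearMap.range u) + 1 = Module.finrank ℂ⟦X⟧ E

/-! ### Families of (a,b)-modules -/

/-- On the open set `V`, the section `s` of a family of `ℂ[[b]]`-modules is a combination of the
`w i` with coefficients in `𝒪(V)[[b]]`. -/
def HolCombOn {Y : ReducedComplexSpace} {M : Y → Type} [∀ y, AddCommGroup (M y)]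
    [∀ y, Module ℂ⟦X⟧ (M y)] {k : ℕ} (V : Set Y) (w : ∀ y, Fin k → M y) (s : ∀ y, M y) : Prop :=
  ∃ S : Fin k → Y → ℂ⟦X⟧, (∀ i, SeriesHolOn (S i) V) ∧ ∀ y ∈ V, s y = ∑ i, S i y • w y i

/-- A frame, on an open set, of a collection of (a,b)-modules. -/
structure LocalFrame {X : ReducedComplexSpace} (E : X → ABModule) where
  dom : Set X
  isOpen_dom : IsOpen dom
  rank : ℕ
  vec : ∀ x, Fin rank → E x
  linearIndependent : ∀ x ∈ dom, LinearIndependent ℂ⟦X⟧ (vec x)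
  span_eq_top : ∀ x ∈ dom, Submodule.span ℂ⟦X⟧ (Set.range (vec x)) = ⊤

/-- A sheaf of `𝒪_X`-(a,b)-modules: a locally free sheaf of finite type of `𝒪_X[[b]]`-modules
with an action of `a`. As for vector bundles, it is given by its fibres and by an atlas of
local frames with holomorphic changes of frames; the sections are the combinations of
the frames with coefficients in `𝒪_X[[b]]`. -/
structure ABFamily (X : ReducedComplexSpace) where
  fiber : X → ABModule
  atlas : Set (LocalFrame fiber)
  cover : ∀ x, ∃ e ∈ atlas, x ∈ e.dom
  compat : ∀ e ∈ atlas, ∀ e' ∈ atlas, ∀ j,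
    HolCombOn (M := fun x => fiber x) (e.dom ∩ e'.dom) e.vec (fun x => e'.vec x j)
  a_hol : ∀ e ∈ atlas, ∀ j,
    HolCombOn (M := fun x => fiber x) e.dom e.vec (fun x => (fiber x).a (e.vec x j))

/-- `f^* E` and `H` are isomorphic, as sheaves of `𝒪_U`-(a,b)-modules, on the open set `U`. The fibre
of `f^* E` at `y` is `E (f y)` and the frames of `f^* E` are the pull-backs of those of `E`. -/
def PullbackIsoOn {Y X : ReducedComplexSpace} (f : Y → X) (U : Set Y) (E : ABFamily X)
    (H : ABFamily Y) : Prop :=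
  ∃ θ : ∀ y, E.fiber (f y) →ₗ[ℂ⟦X⟧] H.fiber y,
    (∀ y ∈ U, Function.Bijective (θ y) ∧
      ∀ v, θ y ((E.fiber (f y)).a v) = (H.fiber y).a (θ y v)) ∧
    ∀ e ∈ E.atlas, ∀ h ∈ H.atlas, ∀ j,
      HolCombOn (M := fun y => H.fiber y) (U ∩ f ⁻¹' e.dom ∩ h.dom) h.vec
        (fun y => θ y (e.vec (f y) j))

/-! ### Holomorphic families of primitive themes -/

/-- The sections `φ, a φ, …, a^{k-1} φ`. -/
def iterates {Y : ReducedComplexSpace} {μ : ℚ} {N : ℕ} (k : ℕ) (φ : Y → Xi μ N) (y : Y)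
    (i : Fin k) : Xi μ N :=
  (Xi μ N).a^[i] (φ y)

/-- `φ : U → Ξ_μ^{(N)}` is a `k`-thematic holomorphic map: `𝔼_φ`, generated by the `a^ν φ`, is free
with basis `φ, a φ, …, a^{k-1} φ`, and its fibre at `y` is the submodule of rank `k` of
`Ξ_μ^{(N)}` generated by the `a^ν φ(y)`. -/
def IsThematicOn {Y : ReducedComplexSpace} {μ : ℚ} {N : ℕ} (k : ℕ) (U : Set Y)
    (φ : Y → Xi μ N) : Prop :=
  (∀ j, SeriesHolOn (fun y => Xi.coord μ N (φ y) j) U) ∧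
  (∀ y ∈ U, LinearIndependent ℂ⟦X⟧ (iterates k φ y)) ∧
  HolCombOn (M := fun _ => Xi μ N) U (iterates k φ) (fun y => (Xi μ N).a^[k] (φ y))

/-- `H` is isomorphic on `U` to the sheaf `𝔼_φ` of a `k`-thematic map `φ`. -/
def IsoThematicOn {Y : ReducedComplexSpace} {μ : ℚ} {N : ℕ} (k : ℕ) (U : Set Y) (H : ABFamily Y)
    (φ : Y → Xi μ N) : Prop :=
  ∃ θ : ∀ y, H.fiber y →ₗ[ℂ⟦X⟧] Xi μ N,
    (∀ y ∈ U, Function.Injective (θ y) ∧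
      (∀ v, θ y ((H.fiber y).a v) = (Xi μ N).a (θ y v)) ∧
      LinearMap.range (θ y) = Submodule.span ℂ⟦X⟧ (Set.range (iterates k φ y))) ∧
    ∀ h ∈ H.atlas, ∀ j,
      HolCombOn (M := fun _ => Xi μ N) (U ∩ h.dom) (iterates k φ) (fun y => θ y (h.vec y j))

/-- `λ_{j+1} = λ_1 + (p_1 - 1) + … + (p_j - 1)`, the index `j` starting at `0`. -/
def exponent {r : ℕ} (lam1 : ℚ) (p : Fin r → ℕ) (j : Fin (r + 1)) : ℚ :=
  lam1 + ∑ i : Fin r, if (i : ℕ) < j then (p i : ℚ) - 1 else 0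

/-- The theme `E` has rank `r + 1` and fundamental invariants `λ_1, p_1, …, p_r`: for some basis
`e_1, …, e_{r+1}` and `F_j` spanned by `e_1, …, e_j`, the `F_j` are stable by `a`, and `F_j / F_{j-1}`
is generated by `e_j` with `a e_j = λ_j b e_j`. -/
def HasInvariants {r : ℕ} (lam1 : ℚ) (p : Fin r → ℕ) (E : ABModule) : Prop :=
  ∃ e : Module.Basis (Fin (r + 1)) ℂ⟦X⟧ E, ∀ j,
    E.a (e j) - (PowerSeries.C (exponent lam1 p j : ℂ) * PowerSeries.X) • e j ∈
      Submodule.span ℂ⟦X⟧ (e '' {i | i < j})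

/-- The representative in `]0, 1]` of a rational number modulo `ℤ`. -/
def residue (q : ℚ) : ℚ := q - ⌈q⌉ + 1

/-- `H` is a holomorphic family of `[λ_1]`-primitive themes of rank `r + 1` with fundamental
invariants `λ_1, p_1, …, p_r`. -/
def IsThemeFamily {r : ℕ} {Y : ReducedComplexSpace} (lam1 : ℚ) (p : Fin r → ℕ) (H : ABFamily Y) :
    Prop :=
  (∀ y, HasInvariants lam1 p (H.fiber y)) ∧
  ∀ y, ∃ U : Set Y, IsOpen U ∧ y ∈ U ∧ ∃ φ : Y → Xi (residue lam1) r,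
    IsThematicOn (r + 1) U φ ∧ IsoThematicOn (r + 1) U H φ

/-- The germ at `y₀` of `f` is a holomorphic map to `(X, x₀)` with `f^* E ≅ H` near `y₀`. -/
def Classifies {X Y : ReducedComplexSpace} (E : ABFamily X) (x₀ : X) (H : ABFamily Y) (y₀ : Y)
    (f : Y → X) : Prop :=
  f y₀ = x₀ ∧ ∃ U : Set Y, IsOpen U ∧ y₀ ∈ U ∧ HolMapOn f U ∧ PullbackIsoOn f U E H

/-- `E` is a holomorphic family of `[λ_1]`-primitive themes with fundamental invariants
`λ_1, p_1, …, p_r` which is universal near `x₀`: every such family `H`, over any reduced complex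
space, with `H(y₀) ≅ E(x₀)`, is near `y₀` the pull-back of `E` by a holomorphic map, whose germ
at `y₀` is unique. -/
def IsUniversalNear {r : ℕ} {X : ReducedComplexSpace} (lam1 : ℚ) (p : Fin r → ℕ) (E : ABFamily X)
    (x₀ : X) : Prop :=
  IsThemeFamily lam1 p E ∧
  ∀ (Y : ReducedComplexSpace) (H : ABFamily Y) (y₀ : Y), IsThemeFamily lam1 p H →
    Isomorphic (H.fiber y₀) (E.fiber x₀) →
      (∃ f : Y → X, Classifies E x₀ H y₀ f) ∧
      ∀ f f' : Y → X, Classifies E x₀ H y₀ f → Classifies E x₀ H y₀ f' → f =ᶠ[𝓝 y₀] f'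

/-! ### The canonical family with `p_1 = 3`, `p_2 = p_3 = 2` -/

theorem ABModule.ofMatrix_a_basisFun {k : ℕ} (M : Matrix (Fin k) (Fin k) ℂ⟦X⟧) (j : Fin k) :
    (ABModule.ofMatrix M).a (Pi.basisFun ℂ⟦X⟧ (Fin k) j) =
      ∑ i, M i j • Pi.basisFun ℂ⟦X⟧ (Fin k) i := by
  change M.mulVec (Pi.basisFun ℂ⟦X⟧ (Fin k) j) +
    (fun i => PowerSeries.X ^ 2 * PowerSeries.derivative ℂ (Pi.basisFun ℂ⟦X⟧ (Fin k) j i)) = _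
  ext1 i
  by_cases h : i = j
  · subst h; simp [Finset.sum_apply, Pi.single_apply]
  · simp [Finset.sum_apply, Pi.single_apply, h]

/-- The standard frame of the family of the `ABModule.ofMatrix (M x)`. -/
def LocalFrame.standard {X : ReducedComplexSpace} {k : ℕ}
    (M : X → Matrix (Fin k) (Fin k) ℂ⟦X⟧) : LocalFrame fun x => ABModule.ofMatrix (M x) where
  dom := Set.univ
  isOpen_dom := isOpen_univ
  rank := k
  vec := fun _ j => Pi.basisFun ℂ⟦X⟧ (Fin k) j
  linearIndependent := fun _ _ => (Pi.basisFun ℂ⟦X⟧ (Fin k)).linearIndependent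
  span_eq_top := fun _ _ => (Pi.basisFun ℂ⟦X⟧ (Fin k)).span_eq

/-- The family of the `ABModule.ofMatrix (M x)`, for `M` holomorphic, with its global frame. -/
def ABFamily.ofMatrix (X : ReducedComplexSpace) {k : ℕ} (M : X → Matrix (Fin k) (Fin k) ℂ⟦X⟧)
    (hM : ∀ i j, SeriesHolOn (fun x => M x i j) Set.univ) : ABFamily X where
  fiber := fun x => ABModule.ofMatrix (M x)
  atlas := {LocalFrame.standard M}
  cover := fun x => ⟨LocalFrame.standard M, rfl, Set.mem_univ x⟩
  compat := by
    rintro e rfl e' rfl (j : Fin k)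
    refine ⟨fun (i : Fin k) _ => if i = j then 1 else 0, fun i n x _ => holAt_const _ x,
      fun x _ => ?_⟩
    change (Pi.basisFun ℂ⟦X⟧ (Fin k) j : Fin k → ℂ⟦X⟧) =
      ∑ i : Fin k, (if i = j then (1 : ℂ⟦X⟧) else 0) • Pi.basisFun ℂ⟦X⟧ (Fin k) i
    simp
  a_hol := by
    rintro e rfl (j : Fin k)
    exact ⟨fun (i : Fin k) x => M x i j, fun i => hM i j,
      fun x _ => ABModule.ofMatrix_a_basisFun (M x) j⟩

/-- The matrix of `a` in the basis `e_1, e_2, e_3, e_4`: with `σ = (α, β, γ, δ, ε, θ)`,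
`a e_1 = λ_1 b e_1`, `(a - (λ_1 + 2) b) e_2 = (1 + δ b + ε b² + θ b³) e_1`,
`(a - (λ_1 + 3) b) e_3 = (1 + β b + γ b²) e_2` and `(a - (λ_1 + 4) b) e_4 = (1 + α b²) e_3`. -/
def canonicalMatrix (lam1 : ℚ) (σ : Fin 6 → ℂ) : Matrix (Fin 4) (Fin 4) ℂ⟦X⟧ :=
  let b : ℂ⟦X⟧ := PowerSeries.X
  let c : ℂ → ℂ⟦X⟧ := fun z => PowerSeries.C z
  !![c lam1 * b, 1 + c (σ 3) * b + c (σ 4) * b ^ 2 + c (σ 5) * b ^ 3, 0, 0;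
     0, c (lam1 + 2) * b, 1 + c (σ 1) * b + c (σ 2) * b ^ 2, 0;
     0, 0, c (lam1 + 3) * b, 1 + c (σ 0) * b ^ 2;
     0, 0, 0, c (lam1 + 4) * b]

/-- The theme `E(σ)`. -/
def canonicalTheme (lam1 : ℚ) (σ : Fin 6 → ℂ) : ABModule :=
  ABModule.ofMatrix (canonicalMatrix lam1 σ)

theorem seriesHolOn_canonicalMatrix (lam1 : ℚ) (A : Set (Fin 6 → ℂ)) (hA : IsLocallyAnalytic A)
    (i j : Fin 4) : SeriesHolOn (X := ReducedComplexSpace.ofSet A hA)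
      (fun σ : A => canonicalMatrix lam1 σ.1 i j) Set.univ := by
  intro n x _
  refine holAt_ofSet hA (F := fun σ => PowerSeries.coeff n (canonicalMatrix lam1 σ i j))
    (fun z => ?_) x
  have key : ∀ (l m : ℕ) (i : Fin 6),
      AnalyticAt ℂ (fun σ : Fin 6 → ℂ => PowerSeries.coeff l
        (PowerSeries.C (σ i) * PowerSeries.X ^ m)) z := fun l m i => by
    simp only [PowerSeries.coeff_C_mul]
    exact (ContinuousLinearMap.proj (R := ℂ) (φ := fun _ : Fin 6 => ℂ) i).analyticAt z
      |>.mul analyticAt_const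
  have key' := fun i => key n 1 i
  simp only [pow_one] at key'
  fin_cases i <;> fin_cases j <;> first
    | exact analyticAt_const
    | exact analyticAt_const.add (key n 2 0)
    | (simp only [canonicalMatrix, map_add]
       exact (analyticAt_const.add (key' 1)).add (key n 2 2))
    | (simp only [canonicalMatrix, map_add]
       exact ((analyticAt_const.add (key' 3)).add (key n 2 4)).add (key n 3 5))

/-- The canonical family, restricted to a locally analytic set `A` of parameters. -/
def canonicalFamily (lam1 : ℚ) (A : Set (Fin 6 → ℂ)) (hA : IsLocallyAnalytic A) :
    ABFamily (ReducedComplexSpace.ofSet A hA) :=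
  ABFamily.ofMatrix _ (fun σ : A => canonicalMatrix lam1 σ.1)
    (seriesHolOn_canonicalMatrix lam1 A hA)

/-- The parameter space of the canonical family: `α γ θ ≠ 0`. -/
def paramSpace : Set (Fin 6 → ℂ) := {σ | σ 0 * σ 2 * σ 5 ≠ 0}

theorem isLocallyAnalytic_of_isOpen {n : ℕ} {W : Set (Fin n → ℂ)} (hW : IsOpen W) :
    IsLocallyAnalytic W :=
  fun _ hz => ⟨W, hW, hz, 0, fun i => i.elim0, fun i => i.elim0, by ext w; simp⟩

theorem isOpen_paramSpace : IsOpen paramSpace :=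
  isOpen_ne_fun (by fun_prop) continuous_const

/-- The part of the hyperplane `ε = ε₀` which lies in `W`. -/
def slice (W : Set (Fin 6 → ℂ)) (ε₀ : ℂ) : Set (Fin 6 → ℂ) := {σ | σ ∈ W ∧ σ 4 = ε₀}

theorem isLocallyAnalytic_slice {W : Set (Fin 6 → ℂ)} (hW : IsOpen W) (ε₀ : ℂ) :
    IsLocallyAnalytic (slice W ε₀) :=
  fun z hz => ⟨W, hW, hz.1, 1, fun _ σ => σ 4 - ε₀, fun _ => by fun_prop, by
    ext w
    simp only [slice, Set.mem_inter_iff, Set.mem_ofPred_eq, sub_eq_zero, forall_const]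
    tauto⟩

end Themes

end

/-!
Write a theme as `a e₁ = λ₁ b e₁`, `(a - (λ₁ + n_i) b) e_{i+1} = S_i e_i` with `S_i(0) = 1`. A
matrix commuting with two such actions is upper triangular with constant diagonal `g`, and its other
entries `f` solve equations `T + b (b d/db - d) f = 0` with `d ∈ {1, 2, 3, 4}`. Such an equation is
solvable exactly when the coefficients of `b⁰` and `b^{d+1}` in `T` vanish, and then determines `f`
up to a multiple of `b^d`. For canonical forms which differ only in `ε`, the entries `(2, 3)` and
`(3, 4)` are `y b` and `x b`, and the solvability conditions reduce to
`3 x - 5 y + 2 g (ε - ε') = 0` and `γ x = α y`, a linear system of determinant `5 γ - 3 α` in `x`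
and `y`. When it does not vanish, `ε` can be moved at will and the remaining parameters are read
off from the coefficients of the `S_i`. When it vanishes, `g = 0` gives an endomorphism of rank
`3`, and themes which differ in `ε` only are not isomorphic.

The same computation over the ring of holomorphic functions on a base treats families: every family
of themes locally has a matrix of the above form, hence off the hyperplane `3 α = 5 γ` it is locally
induced from the canonical family over a slice `ε = ε₀`.

Suppose a universal family existed at a point `σ` of this hyperplane, and let `f` classify the
canonical family near `σ`. Over the base with coordinates `(α, ε, s)` the maps to `(α, ε)` and to
`(α, ε + s (3 α - 5 γ))` induce isomorphic families, so composing them with `f` gives the same germ.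
Hence `f` is locally independent of `ε` where `3 α ≠ 5 γ`, and then at `3 α = 5 γ` by continuity,
although the themes there are not isomorphic.
-/

noncomputable section

namespace Themes

open PowerSeries

/-! ### Matrices commuting with `a` -/

section EulerOp

variable {R : Type*} [CommRing R]

/-- The operator `b (b d/db - d)`, where `b` is the variable of the power series. It governs the
entries of the matrices intertwining two actions of `a`. -/
def eulerOp (d : ℤ) (g : R⟦X⟧) : R⟦X⟧ :=
  X ^ 2 * derivative R g - (d : R⟦X⟧) * X * g

theorem constantCoeff_eulerOp (d : ℤ) (g : R⟦X⟧) : constantCoeff (eulerOp d g) = 0 := by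
  simp [eulerOp]

theorem coeff_succ_eulerOp (d : ℤ) (n : ℕ) (g : R⟦X⟧) :
    coeff (n + 1) (eulerOp d g) = ((n : R) - d) * coeff n g := by
  have hd : (d : R⟦X⟧) * X * g = X * (C (d : R) * g) := by rw [map_intCast]; ring
  rw [eulerOp, hd, pow_two, mul_assoc, map_sub, coeff_succ_X_mul, coeff_succ_X_mul, coeff_C_mul]
  cases n with
  | zero => simp
  | succ n =>
    rw [coeff_succ_X_mul, coeff_derivative]
    push_cast
    ring

theorem eulerOp_add (d : ℤ) (f g : R⟦X⟧) : eulerOp d (f + g) = eulerOp d f + eulerOp d g := by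
  simp only [eulerOp, map_add]
  ring

theorem eulerOp_C_mul_X_pow (d : ℕ) (c : R) : eulerOp d (C c * X ^ d) = 0 := by
  ext n
  cases n with
  | zero => simpa using constantCoeff_eulerOp d _
  | succ n =>
    rw [coeff_succ_eulerOp, coeff_C_mul, coeff_X_pow]
    split_ifs with h <;> simp [h]

theorem eulerOp_one_C_mul_X (c : R) : eulerOp 1 (C c * X) = 0 := by
  simpa using eulerOp_C_mul_X_pow 1 c

theorem constantCoeff_eq_zero_of_add_eulerOp {T g : R⟦X⟧} {d : ℤ} (h : T + eulerOp d g = 0) :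
    constantCoeff T = 0 := by
  simpa [constantCoeff_eulerOp] using congrArg constantCoeff h

theorem coeff_succ_add_of_add_eulerOp {T g : R⟦X⟧} {d : ℤ} (h : T + eulerOp d g = 0) (n : ℕ) :
    coeff (n + 1) T + ((n : R) - d) * coeff n g = 0 := by
  rw [← coeff_succ_eulerOp, ← map_add, h, map_zero]

theorem coeff_eq_zero_of_eulerOp_eq_zero [IsAddTorsionFree R] {g : R⟦X⟧} {d : ℤ}
    (h : eulerOp d g = 0) {n : ℕ} (hn : (n : ℤ) ≠ d) : coeff n g = 0 := by
  have key : ((n : ℤ) - d) • coeff n g = 0 := by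
    rw [zsmul_eq_mul, Int.cast_sub, Int.cast_natCast, ← coeff_succ_eulerOp, h, map_zero]
  exact (IsAddTorsionFree.zsmul_eq_zero_iff_right (sub_ne_zero.2 hn)).1 key

theorem eq_zero_of_eulerOp_eq_zero [IsAddTorsionFree R] {g : R⟦X⟧} {d : ℤ} (hd : d < 0)
    (h : eulerOp d g = 0) : g = 0 := by
  ext n
  exact coeff_eq_zero_of_eulerOp_eq_zero h (by omega)

theorem eq_C_mul_X_pow_of_eulerOp_eq_zero [IsAddTorsionFree R] {g : R⟦X⟧} {d : ℕ}
    (h : eulerOp d g = 0) : g = C (coeff d g) * X ^ d := by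
  ext n
  rw [coeff_C_mul, coeff_X_pow]
  split_ifs with hn
  · rw [hn, mul_one]
  · rw [mul_zero, coeff_eq_zero_of_eulerOp_eq_zero h (mod_cast hn)]

theorem exists_add_eulerOp_eq_zero [Algebra ℚ R] {d : ℕ} {T : R⟦X⟧} (h₀ : constantCoeff T = 0)
    (hd : coeff (d + 1) T = 0) (c : R) : ∃ g, T + eulerOp d g = 0 ∧ coeff d g = c := by
  refine ⟨mk fun n => if n = d then c else ((d : ℚ) - n)⁻¹ • coeff (n + 1) T, ?_, by simp⟩
  ext n
  cases n with
  | zero => simp [h₀, constantCoeff_eulerOp]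
  | succ n =>
    rw [map_add, coeff_succ_eulerOp, coeff_mk]
    split_ifs with h
    · simp [h, hd]
    · have hne : (d : ℚ) - n ≠ 0 := sub_ne_zero.2 (mod_cast Ne.symm h)
      have hcast : (n : R) - (d : ℤ) = algebraMap ℚ R (n - d) := by simp
      rw [hcast, ← Algebra.smul_def, smul_smul, ← neg_sub, neg_mul, mul_inv_cancel₀ hne, neg_smul,
        one_smul, add_neg_cancel, map_zero]

/-- The kernel of `eulerOp d` provides the free parameter with which the next obstruction, of
order `d + m`, is removed. -/
theorem exists_add_eulerOp_eq_zero_of_isUnit [Algebra ℚ R] {d m : ℕ} {T V : R⟦X⟧}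
    (h₀ : constantCoeff T = 0) (hd : coeff (d + 1) T = 0) (hV : IsUnit (coeff m V)) (c : R) :
    ∃ g, T + eulerOp d g = 0 ∧ coeff (m + d) (g * V) = c := by
  obtain ⟨f, hf, -⟩ := exists_add_eulerOp_eq_zero h₀ hd 0
  obtain ⟨w, hw⟩ := hV.dvd (a := c - coeff (m + d) (f * V))
  refine ⟨f + C w * X ^ d, ?_, ?_⟩
  · rw [eulerOp_add, eulerOp_C_mul_X_pow, add_zero, hf]
  · rw [add_mul, mul_assoc, map_add, coeff_C_mul, coeff_X_pow_mul, mul_comm w, ← hw,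
      add_sub_cancel]

theorem coeff_one_mul_eq (S T : R⟦X⟧) :
    coeff 1 (S * T) = constantCoeff S * coeff 1 T + coeff 1 S * constantCoeff T := by
  simp [coeff_mul, Finset.Nat.antidiagonal_succ]

theorem coeff_succ_mul_C_mul_X (n : ℕ) (S : R⟦X⟧) (x : R) :
    coeff (n + 1) (S * (C x * X)) = x * coeff n S := by
  rw [← mul_assoc, coeff_succ_mul_X, mul_comm, coeff_C_mul]

end EulerOp

section Gauge

variable {R ι : Type*} [CommRing R] [Fintype ι]

/-- The action `v ↦ M v + b² v'` of `a` on column vectors, for the matrix `M` of `a` in a basis. -/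
def abAct (M : Matrix ι ι R⟦X⟧) (v : ι → R⟦X⟧) : ι → R⟦X⟧ :=
  M.mulVec v + fun i => X ^ 2 * derivative R (v i)

/-- The matrix `G` commutes with the actions of `a` which have matrix `N` on the source and
matrix `M` on the target. -/
def Intertwines (M N G : Matrix ι ι R⟦X⟧) : Prop :=
  M * G + G.map (fun S => X ^ 2 * derivative R S) = G * N

theorem Intertwines.abAct_mulVec {M N G : Matrix ι ι R⟦X⟧} (h : Intertwines M N G)
    (v : ι → R⟦X⟧) : abAct M (G.mulVec v) = G.mulVec (abAct N v) := by
  unfold abAct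
  rw [Matrix.mulVec_add, Matrix.mulVec_mulVec, Matrix.mulVec_mulVec, ← h, Matrix.add_mulVec,
    add_assoc]
  congr 1
  ext1 i
  simp only [Matrix.mulVec, dotProduct, Pi.add_apply, Matrix.map_apply, map_sum,
    Derivation.leibniz, Finset.mul_sum, ← Finset.sum_add_distrib, smul_eq_mul]
  exact Finset.sum_congr rfl fun j _ => by ring

theorem intertwines_iff {M N G : Matrix ι ι R⟦X⟧} :
    Intertwines M N G ↔ ∀ v, abAct M (G.mulVec v) = G.mulVec (abAct N v) := by
  classical
  refine ⟨Intertwines.abAct_mulVec, fun h => ?_⟩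
  ext1 i j
  have hder : (fun i => X ^ 2 * derivative R ((Pi.single j 1 : ι → R⟦X⟧) i)) = 0 := by
    ext1 i
    obtain rfl | hij := eq_or_ne i j <;> simp [*]
  have hij := congrFun (h (Pi.single j 1)) i
  simp only [abAct, hder, Matrix.mulVec_single_one, add_zero] at hij
  exact hij

theorem map_derivative {A : Type*} [CommRing A] (f : R →+* A) (S : R⟦X⟧) :
    PowerSeries.map f (derivative R S) = derivative A (PowerSeries.map f S) := by
  ext n
  simp [coeff_derivative]

theorem map_abAct {A : Type*} [CommRing A] (f : R →+* A) (M : Matrix ι ι R⟦X⟧) (v : ι → R⟦X⟧)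
    (i : ι) : PowerSeries.map f (abAct M v i) =
      abAct (M.map (PowerSeries.map f)) (fun j => PowerSeries.map f (v j)) i := by
  simp only [abAct, Pi.add_apply, map_add, RingHom.map_mulVec, map_mul, map_pow, map_X,
    map_derivative]
  rfl

theorem Intertwines.map {A : Type*} [CommRing A] (f : R →+* A) {M N G : Matrix ι ι R⟦X⟧}
    (h : Intertwines M N G) :
    Intertwines (M.map (PowerSeries.map f)) (N.map (PowerSeries.map f))
      (G.map (PowerSeries.map f)) := by
  ext1 i j
  refine (map_abAct f M (fun k => G k j) i).symm.trans ?_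
  rw [show abAct M (fun k => G k j) i = (G * N) i j from congrFun (congrFun h i) j,
    ← Matrix.map_mul, Matrix.map_apply]

section Triangular

variable [LinearOrder ι] {M N G : Matrix ι ι R⟦X⟧} {l : R} {n : ι → ℤ}

theorem Intertwines.eulerOp_apply_eq_zero (h : Intertwines M N G)
    (hM : M.IsUpperTriangular) (hN : N.IsUpperTriangular)
    (hMd : ∀ i, M i i = C (l + n i) * X) (hNd : ∀ i, N i i = C (l + n i) * X) {i j : ι}
    (hcol : ∀ k, i < k → G k j = 0) (hrow : ∀ k, k < j → G i k = 0) :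
    eulerOp (n j - n i) (G i j) = 0 := by
  have hij := congrFun (congrFun h i) j
  rw [Matrix.add_apply, Matrix.mul_apply, Matrix.mul_apply, Matrix.map_apply,
    Finset.sum_eq_single i, Finset.sum_eq_single j, hMd, hNd] at hij
  · simp only [eulerOp, map_add, map_intCast] at hij ⊢
    push_cast
    linear_combination hij
  · intro k _ hk
    obtain hk | hk := hk.lt_or_gt
    · rw [hrow k hk, zero_mul]
    · rw [hN hk, mul_zero]
  · simp
  · intro k _ hk
    obtain hk | hk := hk.lt_or_gt
    · rw [hM hk, zero_mul]
    · rw [hcol k hk, mul_zero]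
  · simp

theorem Intertwines.isUpperTriangular [IsAddTorsionFree R] (h : Intertwines M N G)
    (hM : M.IsUpperTriangular) (hN : N.IsUpperTriangular)
    (hMd : ∀ i, M i i = C (l + n i) * X) (hNd : ∀ i, N i i = C (l + n i) * X)
    (hn : StrictMono n) : G.IsUpperTriangular := by
  intro i j hji
  induction j using WellFoundedLT.induction generalizing i with
  | ind j hrow =>
    induction i using WellFoundedGT.induction with
    | ind i hcol =>
      refine eq_zero_of_eulerOp_eq_zero (sub_neg.2 (hn hji))
        (h.eulerOp_apply_eq_zero hM hN hMd hNd (fun k hk => ?_) fun k hk => ?_)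
      · exact hcol k hk (lt_trans hji hk)
      · exact hrow k hk (lt_trans hk hji)

theorem Intertwines.diag_eq_C [IsAddTorsionFree R] (h : Intertwines M N G)
    (hM : M.IsUpperTriangular) (hN : N.IsUpperTriangular)
    (hMd : ∀ i, M i i = C (l + n i) * X) (hNd : ∀ i, N i i = C (l + n i) * X)
    (hG : G.IsUpperTriangular) (i : ι) : G i i = C (constantCoeff (G i i)) := by
  have hEuler : eulerOp (0 : ℕ) (G i i) = 0 := by
    simpa using h.eulerOp_apply_eq_zero hM hN hMd hNd (i := i) (j := i) (fun k hk => hG hk)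
      fun k hk => hG hk
  simpa using eq_C_mul_X_pow_of_eulerOp_eq_zero hEuler

end Triangular

end Gauge

section ThemeMatrix

variable {R : Type*} [CommRing R]

/-- The matrix of `a` in a basis `e₁, …, e₄` with `a e₁ = l b e₁`, `(a - (l + 2) b) e₂ = S₁ e₁`,
`(a - (l + 3) b) e₃ = S₂ e₂` and `(a - (l + 4) b) e₄ = S₃ e₃`; the index of `S` starts at `0`. -/
def themeMatrix (l : R) (S : Fin 3 → R⟦X⟧) : Matrix (Fin 4) (Fin 4) R⟦X⟧ :=
  !![C l * X, S 0, 0, 0;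
     0, C (l + 2) * X, S 1, 0;
     0, 0, C (l + 3) * X, S 2;
     0, 0, 0, C (l + 4) * X]

/-- The upper triangular matrix with constant diagonal entries `g`: the shape of the intertwiners
of theme matrices. -/
def upperMatrix (g : R) (g₁₂ g₁₃ g₁₄ g₂₃ g₂₄ g₃₄ : R⟦X⟧) : Matrix (Fin 4) (Fin 4) R⟦X⟧ :=
  !![C g, g₁₂, g₁₃, g₁₄;
     0, C g, g₂₃, g₂₄;
     0, 0, C g, g₃₄;
     0, 0, 0, C g]

theorem themeMatrix_map {A : Type*} [CommRing A] (f : R →+* A) (l : R) (S : Fin 3 → R⟦X⟧) :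
    (themeMatrix l S).map (PowerSeries.map f) =
      themeMatrix (f l) (fun i => PowerSeries.map f (S i)) := by
  ext1 i j
  fin_cases i <;> fin_cases j <;> simp [themeMatrix, map_ofNat]

theorem isUpperTriangular_themeMatrix (l : R) (S : Fin 3 → R⟦X⟧) :
    (themeMatrix l S).IsUpperTriangular := by
  intro i j hij
  fin_cases i <;> fin_cases j <;> first | rfl | exact absurd hij (by decide)

theorem themeMatrix_apply_self (l : R) (S : Fin 3 → R⟦X⟧) (i : Fin 4) :
    themeMatrix l S i i = C (l + (![0, 2, 3, 4] i : ℤ)) * X := by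
  fin_cases i <;> simp [themeMatrix]

theorem intertwines_themeMatrix_of {l : R} {S : Fin 3 → R⟦X⟧} {M : Matrix (Fin 4) (Fin 4) R⟦X⟧}
    {w : Fin 4 → Fin 4 → R⟦X⟧} (h₀ : abAct M (w 0) = (C l * X) • w 0)
    (h₁ : abAct M (w 1) = (C (l + 2) * X) • w 1 + S 0 • w 0)
    (h₂ : abAct M (w 2) = (C (l + 3) * X) • w 2 + S 1 • w 1)
    (h₃ : abAct M (w 3) = (C (l + 4) * X) • w 3 + S 2 • w 2) :
    Intertwines M (themeMatrix l S) (Matrix.of fun i j => w j i) := by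
  ext1 i j
  change abAct M (w j) i = _
  fin_cases j
  · simp [h₀, Matrix.mul_apply, Fin.sum_univ_four, themeMatrix, mul_comm]
  · simp [h₁, Matrix.mul_apply, Fin.sum_univ_four, themeMatrix, map_ofNat]; ring
  · simp [h₂, Matrix.mul_apply, Fin.sum_univ_four, themeMatrix, map_ofNat]; ring
  · simp [h₃, Matrix.mul_apply, Fin.sum_univ_four, themeMatrix, map_ofNat]; ring

theorem isUpperTriangular_upperMatrix (g : R) (g₁₂ g₁₃ g₁₄ g₂₃ g₂₄ g₃₄ : R⟦X⟧) :
    (upperMatrix g g₁₂ g₁₃ g₁₄ g₂₃ g₂₄ g₃₄).IsUpperTriangular := by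
  intro i j hij
  fin_cases i <;> fin_cases j <;> first | rfl | exact absurd hij (by decide)

theorem isUnit_upperMatrix_iff {g : R} {g₁₂ g₁₃ g₁₄ g₂₃ g₂₄ g₃₄ : R⟦X⟧} :
    IsUnit (upperMatrix g g₁₂ g₁₃ g₁₄ g₂₃ g₂₄ g₃₄) ↔ IsUnit g := by
  rw [Matrix.isUnit_iff_isUnit_det,
    Matrix.det_of_isUpperTriangular (isUpperTriangular_upperMatrix ..)]
  have hdiag (i : Fin 4) : upperMatrix g g₁₂ g₁₃ g₁₄ g₂₃ g₂₄ g₃₄ i i = C g := by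
    fin_cases i <;> rfl
  simp only [hdiag, IsUnit.prod_univ_iff, forall_const, isUnit_iff_constantCoeff,
    constantCoeff_C]

theorem intertwines_upperMatrix_iff {l g : R} {S T : Fin 3 → R⟦X⟧}
    {g₁₂ g₁₃ g₁₄ g₂₃ g₂₄ g₃₄ : R⟦X⟧} :
    Intertwines (themeMatrix l S) (themeMatrix l T) (upperMatrix g g₁₂ g₁₃ g₁₄ g₂₃ g₂₄ g₃₄) ↔
      C g * (S 0 - T 0) + eulerOp 2 g₁₂ = 0 ∧
      C g * (S 1 - T 1) + eulerOp 1 g₂₃ = 0 ∧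
      C g * (S 2 - T 2) + eulerOp 1 g₃₄ = 0 ∧
      S 0 * g₂₃ - g₁₂ * T 1 + eulerOp 3 g₁₃ = 0 ∧
      S 1 * g₃₄ - g₂₃ * T 2 + eulerOp 2 g₂₄ = 0 ∧
      S 0 * g₂₄ - g₁₃ * T 2 + eulerOp 4 g₁₄ = 0 := by
  simp only [eulerOp, Int.cast_ofNat, Int.cast_one]
  constructor
  · intro h
    have entry := fun i j => congrFun (congrFun h i) j
    have e₁₂ := entry 0 1
    have e₂₃ := entry 1 2
    have e₃₄ := entry 2 3
    have e₁₃ := entry 0 2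
    have e₂₄ := entry 1 3
    have e₁₄ := entry 0 3
    simp only [themeMatrix, upperMatrix, Matrix.mul_apply, Fin.sum_univ_four, map_ofNat, map_add,
      Matrix.add_apply, Matrix.map_apply, Matrix.of_apply, Matrix.cons_val', Matrix.cons_val_zero,
      Matrix.cons_val_one, Matrix.cons_val_fin_one, Matrix.cons_val, mul_zero, zero_mul, add_zero,
      zero_add] at e₁₂ e₂₃ e₃₄ e₁₃ e₂₄ e₁₄
    refine ⟨?_, ?_, ?_, ?_, ?_, ?_⟩
    · linear_combination e₁₂
    · linear_combination e₂₃
    · linear_combination e₃₄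
    · linear_combination e₁₃
    · linear_combination e₂₄
    · linear_combination e₁₄
  · rintro ⟨e₁₂, e₂₃, e₃₄, e₁₃, e₂₄, e₁₄⟩
    ext1 i j
    fin_cases i <;> fin_cases j <;>
      simp only [themeMatrix, upperMatrix, Matrix.mul_apply, Fin.sum_univ_four, map_ofNat, map_add,
        Matrix.add_apply, Matrix.map_apply, Matrix.of_apply, Matrix.cons_val', Matrix.cons_val_zero,
        Matrix.cons_val_one, Matrix.cons_val_fin_one, Matrix.cons_val, Fin.zero_eta, Fin.mk_one,
        Fin.reduceFinMk, derivative_C, map_zero, mul_zero, zero_mul, add_zero, zero_add] <;>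
      first
      | ring1
      | linear_combination e₁₂
      | linear_combination e₂₃
      | linear_combination e₃₄
      | linear_combination e₁₃
      | linear_combination e₂₄
      | linear_combination e₁₄

theorem Intertwines.exists_eq_upperMatrix [IsAddTorsionFree R] {l : R} {S T : Fin 3 → R⟦X⟧}
    (hS : ∀ i, constantCoeff (S i) = 1) (hT : ∀ i, constantCoeff (T i) = 1)
    {G : Matrix (Fin 4) (Fin 4) R⟦X⟧} (h : Intertwines (themeMatrix l S) (themeMatrix l T) G) :
    ∃ g g₁₂ g₁₃ g₁₄ g₂₃ g₂₄ g₃₄, G = upperMatrix g g₁₂ g₁₃ g₁₄ g₂₃ g₂₄ g₃₄ := by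
  have hM := isUpperTriangular_themeMatrix l S
  have hN := isUpperTriangular_themeMatrix l T
  have hMd := themeMatrix_apply_self l S
  have hNd := themeMatrix_apply_self l T
  have hG := h.isUpperTriangular hM hN hMd hNd (by decide)
  have diag := h.diag_eq_C hM hN hMd hNd hG
  have entry := fun i j => congrArg constantCoeff (congrFun (congrFun h i) j)
  simp only [Matrix.add_apply, Matrix.mul_apply, Matrix.map_apply, Fin.sum_univ_four] at entry
  have c₁₂ := entry 0 1
  have c₂₃ := entry 1 2
  have c₃₄ := entry 2 3
  simp only [themeMatrix, Matrix.of_apply, Matrix.cons_val', Matrix.cons_val_zero,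
    Matrix.cons_val_one, Matrix.cons_val_fin_one, Matrix.cons_val, map_add, map_mul, map_pow,
    constantCoeff_C, constantCoeff_X, hS, hT, mul_zero, zero_mul, mul_one, one_mul, add_zero,
    zero_add, zero_pow two_ne_zero] at c₁₂ c₂₃ c₃₄
  refine ⟨constantCoeff (G 0 0), G 0 1, G 0 2, G 0 3, G 1 2, G 1 3, G 2 3, ?_⟩
  have d₁ := diag 1
  have d₂ := diag 2
  have d₃ := diag 3
  rw [c₁₂] at d₁
  rw [c₂₃, c₁₂] at d₂
  rw [c₃₄, c₂₃, c₁₂] at d₃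
  ext1 i j
  fin_cases i <;> fin_cases j <;>
    first | rfl | exact diag 0 | exact d₁ | exact d₂ | exact d₃ | exact hG (by decide)

theorem exists_intertwines_upperMatrix [Algebra ℚ R] {l g : R} {S T : Fin 3 → R⟦X⟧}
    {g₂₃ g₃₄ : R⟦X⟧} (hS : ∀ i, constantCoeff (S i) = 1) (hT : ∀ i, constantCoeff (T i) = 1)
    (u₁ : IsUnit (coeff 2 (T 1))) (u₂ : IsUnit (coeff 2 (T 2)))
    (e₂₃ : C g * (S 1 - T 1) + eulerOp 1 g₂₃ = 0) (e₃₄ : C g * (S 2 - T 2) + eulerOp 1 g₃₄ = 0)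
    (h₀ : constantCoeff g₃₄ = constantCoeff g₂₃)
    (h₁ : g * (coeff 1 (S 0) - coeff 1 (T 0)) = 2 * constantCoeff g₂₃)
    (h₂ : 3 * coeff 1 (S 1 * g₃₄ - g₂₃ * T 2) =
      2 * ((coeff 1 (S 0) - coeff 1 (T 1)) * constantCoeff g₂₃ + coeff 1 g₂₃ -
        g * (coeff 2 (S 0) - coeff 2 (T 0))))
    (h₃ : g * (coeff 3 (S 0) - coeff 3 (T 0)) = 0)
    (h₄ : coeff 3 (S 1 * g₃₄ - g₂₃ * T 2) = 0) :
    ∃ g₁₂ g₁₃ g₁₄ g₂₄, Intertwines (themeMatrix l S) (themeMatrix l T)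
      (upperMatrix g g₁₂ g₁₃ g₁₄ g₂₃ g₂₄ g₃₄) := by
  have : IsAddTorsionFree R := IsAddTorsionFree.of_module_rat R
  obtain ⟨g₂₄, e₂₄, -⟩ := exists_add_eulerOp_eq_zero (d := 2) (T := S 1 * g₃₄ - g₂₃ * T 2)
    (by simp [hS, hT, h₀]) h₄ 0
  obtain ⟨g₁₂, e₁₂, r₁₂⟩ := exists_add_eulerOp_eq_zero_of_isUnit (d := 2)
    (T := C g * (S 0 - T 0)) (by simp [hS, hT]) (by simpa [coeff_C_mul] using h₃) u₁
    (coeff 4 (S 0 * g₂₃))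
  have p₀ := coeff_succ_add_of_add_eulerOp e₁₂ 0
  have p₁ := coeff_succ_add_of_add_eulerOp e₁₂ 1
  simp only [zero_add, coeff_C_mul, map_sub, coeff_zero_eq_constantCoeff] at p₀ p₁
  push_cast at p₀ p₁
  have c₁₂ : constantCoeff g₁₂ = constantCoeff g₂₃ := by
    refine nsmul_right_injective two_ne_zero ?_
    simp only [nsmul_eq_mul]
    push_cast
    linear_combination h₁ - p₀
  obtain ⟨g₁₃, e₁₃, r₁₃⟩ := exists_add_eulerOp_eq_zero_of_isUnit (d := 3)
    (T := S 0 * g₂₃ - g₁₂ * T 1) (by simp [hS, hT, c₁₂]) (by rw [map_sub, r₁₂, sub_self]) u₂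
    (coeff 5 (S 0 * g₂₄))
  have q₁₃ := coeff_succ_add_of_add_eulerOp e₁₃ 0
  have q₂₄ := coeff_succ_add_of_add_eulerOp e₂₄ 0
  simp only [zero_add, map_sub, coeff_one_mul_eq, hS, hT, coeff_zero_eq_constantCoeff]
    at q₁₃ q₂₄ h₂
  push_cast at q₁₃ q₂₄
  have c₂₄ : constantCoeff g₂₄ = constantCoeff g₁₃ := by
    refine nsmul_right_injective (n := 6) (by norm_num) ?_
    simp only [nsmul_eq_mul]
    push_cast
    linear_combination 2 * q₁₃ - 3 * q₂₄ + h₂ - 2 * p₁ + 2 * coeff 1 (T 1) * c₁₂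
  obtain ⟨g₁₄, e₁₄, -⟩ := exists_add_eulerOp_eq_zero (d := 4) (T := S 0 * g₂₄ - g₁₃ * T 2)
    (by simp [hS, hT, c₂₄]) (by rw [map_sub, r₁₃, sub_self]) 0
  exact ⟨g₁₂, g₁₃, g₁₄, g₂₄, intertwines_upperMatrix_iff.2 ⟨e₁₂, e₂₃, e₃₄, e₁₃, e₂₄, e₁₄⟩⟩

end ThemeMatrix

/-! ### Canonical forms -/

section Canonical

variable {R : Type*} [CommRing R]

/-- The polynomial `1 + δ b + ε b² + θ b³`, as a power series in `b`. -/
def cubicSeries (δ ε θ : R) : R⟦X⟧ :=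
  1 + C δ * X + C ε * X ^ 2 + C θ * X ^ 3

@[simp]
theorem constantCoeff_cubicSeries (δ ε θ : R) : constantCoeff (cubicSeries δ ε θ) = 1 := by
  simp [cubicSeries]

@[simp]
theorem coeff_one_cubicSeries (δ ε θ : R) : coeff 1 (cubicSeries δ ε θ) = δ := by
  simp [cubicSeries, coeff_X_pow, coeff_one, coeff_C_mul]

@[simp]
theorem coeff_two_cubicSeries (δ ε θ : R) : coeff 2 (cubicSeries δ ε θ) = ε := by
  simp [cubicSeries, coeff_X_pow, coeff_one, coeff_C_mul]

@[simp]
theorem coeff_three_cubicSeries (δ ε θ : R) : coeff 3 (cubicSeries δ ε θ) = θ := by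
  simp [cubicSeries, coeff_X_pow, coeff_one, coeff_C_mul]

/-- The superdiagonal of the canonical matrix with parameters `σ = (α, β, γ, δ, ε, θ)`. -/
def canonicalEntries (σ : Fin 6 → R) : Fin 3 → R⟦X⟧ :=
  ![cubicSeries (σ 3) (σ 4) (σ 5), cubicSeries (σ 1) (σ 2) 0, cubicSeries 0 (σ 0) 0]

/-- The parameters of a canonical form of the theme with superdiagonal `S`. The parameter `ε` can
be chosen freely when `3 α ≠ 5 γ`, and takes the value `e`. -/
def canonicalParams (S : Fin 3 → R⟦X⟧) (e : R) : Fin 6 → R :=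
  ![coeff 2 (S 2), coeff 1 (S 1) - coeff 1 (S 2), coeff 2 (S 1),
    coeff 1 (S 0) - 2 * coeff 1 (S 2), e, coeff 3 (S 0)]

@[simp]
theorem constantCoeff_canonicalEntries (σ : Fin 6 → R) (i : Fin 3) :
    constantCoeff (canonicalEntries σ i) = 1 := by
  fin_cases i <;> exact constantCoeff_cubicSeries ..

theorem canonicalEntries_map {A : Type*} [CommRing A] (f : R →+* A) (σ : Fin 6 → R) (i : Fin 3) :
    PowerSeries.map f (canonicalEntries σ i) = canonicalEntries (fun k => f (σ k)) i := by
  fin_cases i <;> simp [canonicalEntries, cubicSeries]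

theorem canonicalParams_map {A : Type*} [CommRing A] (f : R →+* A) (S : Fin 3 → R⟦X⟧) (e : R)
    (i : Fin 6) :
    canonicalParams (fun j => PowerSeries.map f (S j)) (f e) i = f (canonicalParams S e i) := by
  fin_cases i <;> simp [canonicalParams, map_ofNat]

theorem canonicalMatrix_eq (lam1 : ℚ) (σ : Fin 6 → ℂ) :
    canonicalMatrix lam1 σ = themeMatrix (lam1 : ℂ) (canonicalEntries σ) := by
  simp [canonicalMatrix, themeMatrix, canonicalEntries, cubicSeries]

theorem canonicalParams_canonicalEntries (σ : Fin 6 → R) (e : R) :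
    canonicalParams (canonicalEntries σ) e = Function.update σ 4 e := by
  ext i
  fin_cases i <;> simp [canonicalParams, canonicalEntries, Function.update]

theorem Intertwines.canonicalParams_eq {l g : R} (hg : IsLeftRegular g) {S T : Fin 3 → R⟦X⟧}
    (hS : ∀ i, constantCoeff (S i) = 1) (hT : ∀ i, constantCoeff (T i) = 1)
    {g₁₂ g₁₃ g₁₄ g₂₃ g₂₄ g₃₄ : R⟦X⟧}
    (h : Intertwines (themeMatrix l S) (themeMatrix l T)
      (upperMatrix g g₁₂ g₁₃ g₁₄ g₂₃ g₂₄ g₃₄)) (e : R) :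
    canonicalParams S e = canonicalParams T e := by
  obtain ⟨e₁₂, e₂₃, e₃₄, e₁₃, e₂₄, -⟩ := intertwines_upperMatrix_iff.1 h
  have z₁₃ := constantCoeff_eq_zero_of_add_eulerOp e₁₃
  have z₂₄ := constantCoeff_eq_zero_of_add_eulerOp e₂₄
  simp only [map_sub, map_mul, hS, hT, one_mul, mul_one] at z₁₃ z₂₄
  have α_eq := coeff_succ_add_of_add_eulerOp e₃₄ 1
  have γ_eq := coeff_succ_add_of_add_eulerOp e₂₃ 1
  have θ_eq := coeff_succ_add_of_add_eulerOp e₁₂ 2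
  have p₁₂ := coeff_succ_add_of_add_eulerOp e₁₂ 0
  have p₂₃ := coeff_succ_add_of_add_eulerOp e₂₃ 0
  have p₃₄ := coeff_succ_add_of_add_eulerOp e₃₄ 0
  simp only [coeff_C_mul, map_sub, zero_add, coeff_zero_eq_constantCoeff]
    at α_eq γ_eq θ_eq p₁₂ p₂₃ p₃₄
  push_cast at α_eq γ_eq θ_eq p₁₂ p₂₃ p₃₄
  ext i
  apply hg
  fin_cases i <;> simp only [canonicalParams]
  · exact (by linear_combination α_eq : g * coeff 2 (S 2) = g * coeff 2 (T 2))
  · exact (by linear_combination p₂₃ - p₃₄ - z₂₄ : g * (coeff 1 (S 1) - coeff 1 (S 2)) =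
      g * (coeff 1 (T 1) - coeff 1 (T 2)))
  · exact (by linear_combination γ_eq : g * coeff 2 (S 1) = g * coeff 2 (T 1))
  · exact (by linear_combination p₁₂ - 2 * p₃₄ - 2 * z₂₄ - 2 * z₁₃ :
      g * (coeff 1 (S 0) - 2 * coeff 1 (S 2)) = g * (coeff 1 (T 0) - 2 * coeff 1 (T 2)))
  · rfl
  · exact (by linear_combination θ_eq : g * coeff 3 (S 0) = g * coeff 3 (T 0))

theorem exists_mul_add_mul_eq_of_isUnit {a b c d : R} (h : IsUnit (a * d - b * c)) (p q : R) :
    ∃ x y, a * x + b * y = p ∧ c * x + d * y = q := by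
  obtain ⟨u, hu⟩ := h.exists_right_inv
  refine ⟨u * (d * p - b * q), u * (a * q - c * p), ?_, ?_⟩
  · linear_combination p * hu
  · linear_combination q * hu

/-- Of the six conditions for an intertwiner with diagonal `1`, two determine the entries `(2, 3)`
and `(3, 4)` up to multiples `y b` and `x b`, and two are a linear system for `x` and `y`, of
determinant `5 γ - 3 α`. -/
theorem exists_intertwines_of_canonicalParams_eq [Algebra ℚ R] (l : R) {e : R} {S T : Fin 3 → R⟦X⟧}
    (hS : ∀ i, constantCoeff (S i) = 1) (hT : ∀ i, constantCoeff (T i) = 1)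
    (hγ : IsUnit (coeff 2 (T 1))) (hα : IsUnit (coeff 2 (T 2)))
    (hαγ : IsUnit (3 * coeff 2 (T 2) - 5 * coeff 2 (T 1)))
    (h : canonicalParams S e = canonicalParams T e) :
    ∃ G, IsUnit G ∧ Intertwines (themeMatrix l S) (themeMatrix l T) G := by
  have α_eq : coeff 2 (S 2) = coeff 2 (T 2) := congrFun h 0
  have β_eq : coeff 1 (S 1) - coeff 1 (S 2) = coeff 1 (T 1) - coeff 1 (T 2) := congrFun h 1
  have γ_eq : coeff 2 (S 1) = coeff 2 (T 1) := congrFun h 2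
  have δ_eq : coeff 1 (S 0) - 2 * coeff 1 (S 2) = coeff 1 (T 0) - 2 * coeff 1 (T 2) := congrFun h 3
  have θ_eq : coeff 3 (S 0) = coeff 3 (T 0) := congrFun h 5
  obtain ⟨p, hp, -⟩ := exists_add_eulerOp_eq_zero (d := 1) (T := S 2 - T 2)
    (by simp [hS, hT]) (by simp [α_eq]) 0
  obtain ⟨q, hq, hq₁⟩ := exists_add_eulerOp_eq_zero (d := 1) (T := S 1 - T 1)
    (by simp [hS, hT]) (by simp [γ_eq]) 0
  have hp₀ := coeff_succ_add_of_add_eulerOp hp 0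
  have hq₀ := coeff_succ_add_of_add_eulerOp hq 0
  simp only [zero_add, map_sub, coeff_zero_eq_constantCoeff] at hp₀ hq₀
  push_cast at hp₀ hq₀
  obtain ⟨x, y, h₂, h₄⟩ := exists_mul_add_mul_eq_of_isUnit
    (a := 3) (b := -5) (c := coeff 2 (T 1)) (d := -coeff 2 (T 2))
    (by convert hαγ.neg using 1; ring)
    (2 * ((coeff 1 (S 0) - coeff 1 (T 1)) * constantCoeff q - (coeff 2 (S 0) - coeff 2 (T 0))) -
      3 * coeff 1 (S 1 * p - T 2 * q))
    (-coeff 3 (S 1 * p - T 2 * q))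
  have hcoeff (n : ℕ) : coeff (n + 1) (S 1 * (p + C x * X) - (q + C y * X) * T 2) =
      coeff (n + 1) (S 1 * p - T 2 * q) + (x * coeff n (S 1) - y * coeff n (T 2)) := by
    rw [mul_comm (q + _), mul_add, mul_add, add_sub_add_comm, map_add,
      map_sub _ (S 1 * (C x * X)), coeff_succ_mul_C_mul_X, coeff_succ_mul_C_mul_X]
  have hcoeff₁ := hcoeff 0
  have hcoeff₃ := hcoeff 2
  simp only [zero_add, coeff_zero_eq_constantCoeff, hS, hT, γ_eq, mul_one, Nat.reduceAdd]
    at hcoeff₁ hcoeff₃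
  have hcc : constantCoeff (q + C y * X) = constantCoeff q := by simp
  have hc₁ : coeff 1 (q + C y * X) = y := by simp [hq₁]
  obtain ⟨g₁₂, g₁₃, g₁₄, g₂₄, hG⟩ := exists_intertwines_upperMatrix (l := l) (g := 1)
    (g₂₃ := q + C y * X) (g₃₄ := p + C x * X) hS hT hγ hα
    (by rwa [eulerOp_add, eulerOp_one_C_mul_X, map_one, one_mul, add_zero])
    (by rwa [eulerOp_add, eulerOp_one_C_mul_X, map_one, one_mul, add_zero])
    (by simpa using by linear_combination hq₀ - hp₀ - β_eq)
    (by rw [hcc]; linear_combination δ_eq + 2 * hq₀ - 2 * β_eq)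
    (by rw [hcoeff₁, hcc, hc₁]; linear_combination h₂)
    (by rw [θ_eq]; ring) (by rw [hcoeff₃]; linear_combination h₄)
  exact ⟨_, isUnit_upperMatrix_iff.2 isUnit_one, hG⟩

theorem exists_intertwines_canonicalParams [Algebra ℚ R] (l e : R) {S : Fin 3 → R⟦X⟧}
    (hS : ∀ i, constantCoeff (S i) = 1) (hγ : IsUnit (coeff 2 (S 1)))
    (hα : IsUnit (coeff 2 (S 2))) (hαγ : IsUnit (3 * coeff 2 (S 2) - 5 * coeff 2 (S 1))) :
    ∃ G, IsUnit G ∧ Intertwines (themeMatrix l S)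
      (themeMatrix l (canonicalEntries (canonicalParams S e))) G := by
  refine exists_intertwines_of_canonicalParams_eq l hS (constantCoeff_canonicalEntries _)
    (by simpa [canonicalEntries, canonicalParams] using hγ)
    (by simpa [canonicalEntries, canonicalParams] using hα)
    (by simpa [canonicalEntries, canonicalParams] using hαγ) (e := e) ?_
  rw [canonicalParams_canonicalEntries]
  exact (Function.update_eq_self 4 _).symm

/-- The entries `2 s γ b` and `2 s α b` solve the homogeneous part of the linear system for the
coefficients of an intertwiner, up to `2 s (3 α - 5 γ)`. -/
theorem exists_intertwines_canonicalEntries_update [Algebra ℚ R] (l s : R) {σ : Fin 6 → R}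
    (hα : IsUnit (σ 0)) (hγ : IsUnit (σ 2)) :
    ∃ G, IsUnit G ∧ Intertwines (themeMatrix l (canonicalEntries σ))
      (themeMatrix l (canonicalEntries
        (Function.update σ 4 (σ 4 + s * (3 * σ 0 - 5 * σ 2))))) G := by
  obtain ⟨x, hx⟩ : ∃ x, x = 2 * s * σ 0 := ⟨_, rfl⟩
  obtain ⟨y, hy⟩ : ∃ y, y = 2 * s * σ 2 := ⟨_, rfl⟩
  have hcoeff (n : ℕ) : coeff (n + 1) (cubicSeries (σ 1) (σ 2) 0 * (C x * X) -
      (C y * X) * cubicSeries 0 (σ 0) 0) =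
      x * coeff n (cubicSeries (σ 1) (σ 2) 0) - y * coeff n (cubicSeries 0 (σ 0) 0) := by
    rw [mul_comm (C y * X), map_sub, coeff_succ_mul_C_mul_X, coeff_succ_mul_C_mul_X]
  obtain ⟨g₁₂, g₁₃, g₁₄, g₂₄, hG⟩ := exists_intertwines_upperMatrix (l := l) (g := 1)
    (S := canonicalEntries σ)
    (T := canonicalEntries (Function.update σ 4 (σ 4 + s * (3 * σ 0 - 5 * σ 2))))
    (g₂₃ := C y * X) (g₃₄ := C x * X)
    (constantCoeff_canonicalEntries σ) (constantCoeff_canonicalEntries _)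
    (by simpa [canonicalEntries] using hγ) (by simpa [canonicalEntries] using hα)
    (by simpa [canonicalEntries] using eulerOp_one_C_mul_X y)
    (by simpa [canonicalEntries] using eulerOp_one_C_mul_X x)
    (by simp) (by simp [canonicalEntries])
    ((congrArg (3 * ·) (hcoeff 0)).trans (by
      simp [canonicalEntries]
      linear_combination 3 * hx - 5 * hy))
    (by simp [canonicalEntries])
    ((hcoeff 2).trans (by
      rw [coeff_two_cubicSeries, coeff_two_cubicSeries]
      linear_combination σ 2 * hx - σ 0 * hy))
  exact ⟨_, isUnit_upperMatrix_iff.2 isUnit_one, hG⟩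

theorem Intertwines.exists_canonicalEntries_relations [IsAddTorsionFree R] {l g ε : R}
    {σ : Fin 6 → R} {g₁₂ g₁₃ g₁₄ g₂₃ g₂₄ g₃₄ : R⟦X⟧}
    (h : Intertwines (themeMatrix l (canonicalEntries σ))
      (themeMatrix l (canonicalEntries (Function.update σ 4 ε)))
      (upperMatrix g g₁₂ g₁₃ g₁₄ g₂₃ g₂₄ g₃₄)) :
    ∃ x y, g₃₄ = C x * X ∧ g₂₃ = C y * X ∧ 3 * x - 5 * y + 2 * g * (σ 4 - ε) = 0 ∧
      σ 2 * x = σ 0 * y := by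
  obtain ⟨e₁₂, e₂₃, e₃₄, e₁₃, e₂₄, e₁₄⟩ := intertwines_upperMatrix_iff.1 h
  simp only [canonicalEntries, Matrix.cons_val_zero, Matrix.cons_val_one, Matrix.cons_val,
    Function.update_self, Function.update_of_ne, ne_eq, Fin.reduceEq, not_false_eq_true, sub_self,
    mul_zero, zero_add] at e₁₂ e₂₃ e₃₄ e₁₃ e₂₄ e₁₄
  have h₂₃ := eq_C_mul_X_pow_of_eulerOp_eq_zero (d := 1) e₂₃
  have h₃₄ := eq_C_mul_X_pow_of_eulerOp_eq_zero (d := 1) e₃₄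
  rw [pow_one] at h₂₃ h₃₄
  refine ⟨_, _, h₃₄, h₂₃, ?_, ?_⟩
  · have p₁₂ := coeff_succ_add_of_add_eulerOp e₁₂ 0
    have q₁₂ := coeff_succ_add_of_add_eulerOp e₁₂ 1
    have p₁₃ := coeff_succ_add_of_add_eulerOp e₁₃ 0
    have p₂₄ := coeff_succ_add_of_add_eulerOp e₂₄ 0
    have z₁₄ := constantCoeff_eq_zero_of_add_eulerOp e₁₄
    have z₂₃ : constantCoeff g₂₃ = 0 := by rw [h₂₃]; simp
    have z₃₄ : constantCoeff g₃₄ = 0 := by rw [h₃₄]; simp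
    simp only [zero_add, Nat.reduceAdd, map_sub, map_mul, coeff_C_mul, coeff_one_mul_eq,
      coeff_zero_eq_constantCoeff, constantCoeff_cubicSeries, coeff_one_cubicSeries,
      coeff_two_cubicSeries, z₂₃, z₃₄, Nat.cast_zero, Nat.cast_one, Int.cast_ofNat, sub_self,
      zero_sub, mul_zero, mul_one, one_mul, add_zero, neg_mul, neg_eq_zero]
      at p₁₂ q₁₂ p₁₃ p₂₄ z₁₄
    linear_combination 3 * p₂₄ - 2 * p₁₃ - σ 1 * p₁₂ + 2 * q₁₂ + 6 * z₁₄
  · have r₂₄ := coeff_succ_add_of_add_eulerOp e₂₄ 2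
    rw [h₂₃, h₃₄, mul_comm (C _ * X)] at r₂₄
    simp only [map_sub, coeff_succ_mul_C_mul_X] at r₂₄
    simp only [coeff_two_cubicSeries, Nat.cast_ofNat, Int.cast_ofNat, sub_self, zero_mul,
      add_zero] at r₂₄
    linear_combination r₂₄

theorem Intertwines.exists_canonicalEntries_relation_of_diag_eq_zero [IsAddTorsionFree R]
    {l y : R} {σ : Fin 6 → R} {g₁₂ g₁₃ g₁₄ g₂₄ g₃₄ : R⟦X⟧}
    (h : Intertwines (themeMatrix l (canonicalEntries σ)) (themeMatrix l (canonicalEntries σ))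
      (upperMatrix 0 g₁₂ g₁₃ g₁₄ (C y * X) g₂₄ g₃₄)) :
    ∃ w, g₁₂ = C w * X ^ 2 ∧ σ 5 * y = σ 2 * w := by
  obtain ⟨e₁₂, -, -, e₁₃, -, -⟩ := intertwines_upperMatrix_iff.1 h
  rw [map_zero, zero_mul, zero_add] at e₁₂
  have h₁₂ := eq_C_mul_X_pow_of_eulerOp_eq_zero (d := 2) e₁₂
  refine ⟨_, h₁₂, ?_⟩
  have r₁₃ := coeff_succ_add_of_add_eulerOp e₁₃ 3
  rw [h₁₂, mul_assoc (C _), map_sub, coeff_succ_mul_C_mul_X, coeff_C_mul,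
    coeff_X_pow_mul _ 2 2] at r₁₃
  simp only [canonicalEntries, Matrix.cons_val_zero, Matrix.cons_val_one, coeff_two_cubicSeries,
    coeff_three_cubicSeries, Nat.cast_ofNat, Int.cast_ofNat, sub_self, zero_mul, add_zero] at r₁₃
  linear_combination r₁₃

end Canonical

/-! ### Rank and invariance -/

section Modules

theorem Isomorphic.symm {E F : ABModule} (h : Isomorphic E F) : Isomorphic F E := by
  obtain ⟨u, hu⟩ := h
  refine ⟨u.symm, fun v => u.injective ?_⟩
  rw [hu, u.apply_symm_apply, u.apply_symm_apply]

theorem Isomorphic.trans {E F G : ABModule} (h : Isomorphic E F) (h' : Isomorphic F G) :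
    Isomorphic E G := by
  obtain ⟨u, hu⟩ := h
  obtain ⟨w, hw⟩ := h'
  exact ⟨u.trans w, fun v => by simp [hu, hw]⟩

variable {k : ℕ} {M N : Matrix (Fin k) (Fin k) ℂ⟦X⟧}

theorem exists_intertwines_of_linearMap (u : ABModule.ofMatrix N →ₗ[ℂ⟦X⟧] ABModule.ofMatrix M)
    (hu : ∀ v, u ((ABModule.ofMatrix N).a v) = (ABModule.ofMatrix M).a (u v)) :
    ∃ G, Intertwines M N G ∧ G.mulVecLin = u := by
  let u' : (Fin k → ℂ⟦X⟧) →ₗ[ℂ⟦X⟧] (Fin k → ℂ⟦X⟧) := u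
  have hG : (LinearMap.toMatrix' u').mulVecLin = u' := Matrix.toLin'_toMatrix' u'
  refine ⟨LinearMap.toMatrix' u', intertwines_iff.2 fun v => ?_, hG⟩
  rw [← Matrix.mulVecLin_apply, ← Matrix.mulVecLin_apply, hG]
  exact (hu v).symm

theorem isomorphic_ofMatrix_iff :
    Isomorphic (ABModule.ofMatrix M) (ABModule.ofMatrix N) ↔
      ∃ G, IsUnit G ∧ Intertwines M N G := by
  constructor
  · intro h
    obtain ⟨u, hu⟩ := h.symm
    obtain ⟨G, hG, hGu⟩ := exists_intertwines_of_linearMap u.toLinearMap hu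
    refine ⟨G, Matrix.mulVec_surjective_iff_isUnit.1 fun v => ?_, hG⟩
    obtain ⟨w, rfl⟩ := u.surjective v
    exact ⟨w, LinearMap.congr_fun hGu w⟩
  · rintro ⟨G, hG, h⟩
    have hbij : Function.Bijective G.mulVecLin :=
      ⟨Matrix.mulVec_injective_of_isUnit hG, Matrix.mulVec_surjective_iff_isUnit.2 hG⟩
    exact Isomorphic.symm
      ⟨LinearEquiv.ofBijective G.mulVecLin hbij, fun v => (h.abAct_mulVec v).symm⟩

theorem isInvariant_ofMatrix_iff :
    IsInvariant (ABModule.ofMatrix M) ↔ ∃ G, Intertwines M M G ∧ G.rank + 1 = k := by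
  have hk : Module.finrank ℂ⟦X⟧ (ABModule.ofMatrix M) = k := Module.finrank_fin_fun (n := k) ℂ⟦X⟧
  rw [IsInvariant, hk]
  constructor
  · rintro ⟨u, hu, hr⟩
    obtain ⟨G, hG, rfl⟩ := exists_intertwines_of_linearMap u hu
    exact ⟨G, hG, hr⟩
  · rintro ⟨G, hG, hr⟩
    exact ⟨G.mulVecLin, fun v => (hG.abAct_mulVec v).symm, hr⟩

end Modules

section Rank

variable {R : Type*} [CommRing R]

theorem rank_upperMatrix_zero_le [Nontrivial R] (g₁₂ g₁₃ g₁₄ g₂₃ g₂₄ : R⟦X⟧) :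
    (upperMatrix 0 g₁₂ g₁₃ g₁₄ g₂₃ g₂₄ 0).rank ≤ 2 := by
  have hfactor : upperMatrix 0 g₁₂ g₁₃ g₁₄ g₂₃ g₂₄ 0 =
      (!![1, 0; 0, 1; 0, 0; 0, 0] : Matrix (Fin 4) (Fin 2) R⟦X⟧) *
        !![0, g₁₂, g₁₃, g₁₄; 0, 0, g₂₃, g₂₄] := by
    ext1 i j
    fin_cases i <;> fin_cases j <;> simp [upperMatrix, Matrix.mul_apply]
  rw [hfactor]
  exact (Matrix.rank_mul_le_left _ _).trans (Matrix.rank_le_card_width _)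

theorem rank_upperMatrix_zero [IsDomain R] {g₁₂ g₁₃ g₁₄ g₂₃ g₂₄ g₃₄ : R⟦X⟧} (h₁₂ : g₁₂ ≠ 0)
    (h₂₃ : g₂₃ ≠ 0) (h₃₄ : g₃₄ ≠ 0) : (upperMatrix 0 g₁₂ g₁₃ g₁₄ g₂₃ g₂₄ g₃₄).rank = 3 := by
  have hker : LinearMap.ker (upperMatrix 0 g₁₂ g₁₃ g₁₄ g₂₃ g₂₄ g₃₄).mulVecLin =
      LinearMap.range (LinearMap.single R⟦X⟧ (fun _ : Fin 4 => R⟦X⟧) 0) := by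
    ext v
    rw [LinearMap.mem_ker, Matrix.mulVecLin_apply]
    constructor
    · intro hv
      have row := congrFun hv
      simp only [Fin.forall_fin_succ, upperMatrix, Matrix.mulVec, dotProduct, Fin.sum_univ_four,
        Pi.zero_apply, Matrix.of_apply, Matrix.cons_val, map_zero, zero_mul, zero_add] at row
      obtain ⟨row₀, row₁, row₂, -⟩ := row
      have v₃ : v 3 = 0 := by simpa [h₃₄] using row₂
      have v₂ : v 2 = 0 := by simpa [v₃, h₂₃] using row₁
      have v₁ : v 1 = 0 := by simpa [v₃, v₂, h₁₂] using row₀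
      refine ⟨v 0, ?_⟩
      ext1 i
      fin_cases i <;> simp [v₁, v₂, v₃]
    · rintro ⟨s, rfl⟩
      ext1 i
      fin_cases i <;> simp [upperMatrix, Matrix.mulVec, dotProduct, Fin.sum_univ_four]
  have hnullity : Module.finrank R⟦X⟧
      (LinearMap.ker (upperMatrix 0 g₁₂ g₁₃ g₁₄ g₂₃ g₂₄ g₃₄).mulVecLin) = 1 := by
    rw [hker, LinearMap.finrank_range_of_inj
      (Pi.single_injective (M := fun _ : Fin 4 => R⟦X⟧) 0), Module.finrank_self]
  have hrank := Submodule.finrank_quotient_add_finrank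
    (LinearMap.ker (upperMatrix 0 g₁₂ g₁₃ g₁₄ g₂₃ g₂₄ g₃₄).mulVecLin)
  rw [LinearEquiv.finrank_eq (LinearMap.quotKerEquivRange _), hnullity,
    Module.finrank_fin_fun] at hrank
  exact Nat.succ.inj hrank

end Rank

section CanonicalTheme

variable {lam1 : ℚ} {σ τ : Fin 6 → ℂ} {l : ℂ} {S T : Fin 3 → ℂ⟦X⟧}

theorem canonicalTheme_eq (lam1 : ℚ) (σ : Fin 6 → ℂ) :
    canonicalTheme lam1 σ = ABModule.ofMatrix (themeMatrix (lam1 : ℂ) (canonicalEntries σ)) := by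
  rw [canonicalTheme, canonicalMatrix_eq]

theorem exists_intertwines_upperMatrix_of_isomorphic (hS : ∀ i, constantCoeff (S i) = 1)
    (hT : ∀ i, constantCoeff (T i) = 1)
    (h : Isomorphic (ABModule.ofMatrix (themeMatrix l S)) (ABModule.ofMatrix (themeMatrix l T))) :
    ∃ g g₁₂ g₁₃ g₁₄ g₂₃ g₂₄ g₃₄, g ≠ 0 ∧ Intertwines (themeMatrix l S) (themeMatrix l T)
      (upperMatrix g g₁₂ g₁₃ g₁₄ g₂₃ g₂₄ g₃₄) := by
  obtain ⟨G, hunit, hG⟩ := isomorphic_ofMatrix_iff.1 h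
  obtain ⟨g, g₁₂, g₁₃, g₁₄, g₂₃, g₂₄, g₃₄, rfl⟩ := hG.exists_eq_upperMatrix hS hT
  exact ⟨g, g₁₂, g₁₃, g₁₄, g₂₃, g₂₄, g₃₄, (isUnit_upperMatrix_iff.1 hunit).ne_zero, hG⟩

theorem canonicalParams_eq_of_isomorphic (hS : ∀ i, constantCoeff (S i) = 1)
    (hT : ∀ i, constantCoeff (T i) = 1)
    (h : Isomorphic (ABModule.ofMatrix (themeMatrix l S)) (ABModule.ofMatrix (themeMatrix l T)))
    (ε : ℂ) : canonicalParams S ε = canonicalParams T ε := by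
  obtain ⟨g, g₁₂, g₁₃, g₁₄, g₂₃, g₂₄, g₃₄, hg, hG⟩ :=
    exists_intertwines_upperMatrix_of_isomorphic hS hT h
  exact hG.canonicalParams_eq (mul_right_injective₀ hg) hS hT ε

theorem update_eq_of_isomorphic_canonicalTheme
    (h : Isomorphic (canonicalTheme lam1 σ) (canonicalTheme lam1 τ)) (ε : ℂ) :
    Function.update σ 4 ε = Function.update τ 4 ε := by
  rw [canonicalTheme_eq, canonicalTheme_eq] at h
  simpa only [canonicalParams_canonicalEntries] using
    canonicalParams_eq_of_isomorphic (constantCoeff_canonicalEntries σ)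
      (constantCoeff_canonicalEntries τ) h ε

theorem eq_of_isomorphic_canonicalTheme (hγ : σ 2 ≠ 0) (hαγ : 3 * σ 0 = 5 * σ 2)
    (h : Isomorphic (canonicalTheme lam1 σ) (canonicalTheme lam1 τ)) : σ = τ := by
  obtain ⟨ε, rfl⟩ : ∃ ε, τ = Function.update σ 4 ε :=
    ⟨τ 4, by rw [update_eq_of_isomorphic_canonicalTheme h, Function.update_eq_self]⟩
  rw [canonicalTheme_eq, canonicalTheme_eq] at h
  obtain ⟨g, g₁₂, g₁₃, g₁₄, g₂₃, g₂₄, g₃₄, hg, hG⟩ :=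
    exists_intertwines_upperMatrix_of_isomorphic (constantCoeff_canonicalEntries σ)
      (constantCoeff_canonicalEntries _) h
  obtain ⟨x, y, -, -, hε, hxy⟩ := hG.exists_canonicalEntries_relations
  have hlin : 3 * x - 5 * y = 0 :=
    mul_left_cancel₀ hγ (by linear_combination 3 * hxy + y * hαγ)
  have hσ : σ 4 = ε := mul_left_cancel₀ hg (by linear_combination (hε - hlin) / 2)
  rw [← hσ, Function.update_eq_self]

theorem isomorphic_canonicalTheme_update (lam1 : ℚ) (hσ : σ ∈ paramSpace)
    (hαγ : 3 * σ 0 ≠ 5 * σ 2) (ε : ℂ) :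
    Isomorphic (canonicalTheme lam1 σ) (canonicalTheme lam1 (Function.update σ 4 ε)) := by
  simp only [paramSpace, Set.mem_ofPred_eq, mul_ne_zero_iff] at hσ
  have hG := exists_intertwines_canonicalEntries_update (lam1 : ℂ)
    ((ε - σ 4) / (3 * σ 0 - 5 * σ 2)) hσ.1.1.isUnit hσ.1.2.isUnit
  rw [div_mul_cancel₀ _ (sub_ne_zero.2 hαγ), add_sub_cancel] at hG
  rwa [canonicalTheme_eq, canonicalTheme_eq, isomorphic_ofMatrix_iff]

theorem not_isInvariant_canonicalTheme (hαγ : 3 * σ 0 ≠ 5 * σ 2) :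
    ¬ IsInvariant (canonicalTheme lam1 σ) := by
  rw [canonicalTheme_eq, isInvariant_ofMatrix_iff]
  rintro ⟨G, hG, hr⟩
  obtain ⟨g, g₁₂, g₁₃, g₁₄, g₂₃, g₂₄, g₃₄, rfl⟩ := hG.exists_eq_upperMatrix
    (constantCoeff_canonicalEntries σ) (constantCoeff_canonicalEntries σ)
  obtain rfl | hg := eq_or_ne g 0
  · have hG' : Intertwines (themeMatrix (lam1 : ℂ) (canonicalEntries σ))
        (themeMatrix lam1 (canonicalEntries (Function.update σ 4 (σ 4))))
        (upperMatrix 0 g₁₂ g₁₃ g₁₄ g₂₃ g₂₄ g₃₄) := by rwa [Function.update_eq_self]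
    obtain ⟨x, y, rfl, rfl, hε, hxy⟩ := hG'.exists_canonicalEntries_relations
    have hy : y = 0 :=
      mul_left_cancel₀ (sub_ne_zero.2 hαγ) (by linear_combination σ 2 * hε - 3 * hxy)
    have hx : x = 0 := by linear_combination (hε + 5 * hy) / 3
    have hrank := rank_upperMatrix_zero_le g₁₂ g₁₃ g₁₄ (C y * X) g₂₄
    rw [hx, map_zero, zero_mul] at hr
    omega
  · have hrank : (upperMatrix g g₁₂ g₁₃ g₁₄ g₂₃ g₂₄ g₃₄).rank = 4 :=
      Matrix.rank_of_isUnit _ (isUnit_upperMatrix_iff.2 hg.isUnit)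
    omega

theorem isInvariant_canonicalTheme (hσ : σ ∈ paramSpace) (hαγ : 3 * σ 0 = 5 * σ 2) :
    IsInvariant (canonicalTheme lam1 σ) := by
  simp only [paramSpace, Set.mem_ofPred_eq, mul_ne_zero_iff] at hσ
  obtain ⟨⟨hα, hγ⟩, hθ⟩ := hσ
  have hcoeff (n : ℕ) : coeff (n + 1) (canonicalEntries σ 1 * (C 5 * X) -
      (C 3 * X) * canonicalEntries σ 2) =
      5 * coeff n (canonicalEntries σ 1) - 3 * coeff n (canonicalEntries σ 2) := by
    rw [mul_comm (C 3 * X), map_sub, coeff_succ_mul_C_mul_X, coeff_succ_mul_C_mul_X]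
  obtain ⟨g₁₂, g₁₃, g₁₄, g₂₄, hG⟩ := exists_intertwines_upperMatrix (l := (lam1 : ℂ)) (g := 0)
    (S := canonicalEntries σ) (T := canonicalEntries σ) (g₂₃ := C 3 * X) (g₃₄ := C 5 * X)
    (constantCoeff_canonicalEntries σ) (constantCoeff_canonicalEntries σ)
    (by simpa [canonicalEntries] using hγ) (by simpa [canonicalEntries] using hα)
    (by rw [eulerOp_one_C_mul_X, sub_self, mul_zero, add_zero])
    (by rw [eulerOp_one_C_mul_X, sub_self, mul_zero, add_zero])
    (by simp) (by simp)
    ((congrArg (3 * ·) (hcoeff 0)).trans (by simp; norm_num))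
    (zero_mul _)
    ((hcoeff 2).trans (by simp [canonicalEntries]; linear_combination -hαγ))
  obtain ⟨w, rfl, hw⟩ := hG.exists_canonicalEntries_relation_of_diag_eq_zero
  have hw₀ : w ≠ 0 := by
    rintro rfl
    exact hθ (by linear_combination hw / 3)
  have C_mul_X_pow_ne_zero {c : ℂ} (hc : c ≠ 0) (n : ℕ) : (C c * X ^ n : ℂ⟦X⟧) ≠ 0 :=
    mul_ne_zero ((map_ne_zero_iff C C_injective).2 hc) (pow_ne_zero n X_ne_zero)
  have C_mul_X_ne_zero {c : ℂ} (hc : c ≠ 0) : (C c * X : ℂ⟦X⟧) ≠ 0 := by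
    simpa using C_mul_X_pow_ne_zero hc 1
  rw [canonicalTheme_eq, isInvariant_ofMatrix_iff]
  refine ⟨_, hG, ?_⟩
  rw [rank_upperMatrix_zero (C_mul_X_pow_ne_zero hw₀ 2) (C_mul_X_ne_zero three_ne_zero)
    (C_mul_X_ne_zero (by norm_num))]

end CanonicalTheme

/-! ### Power series with holomorphic coefficients -/

section Frames

variable {R M ι κ : Type*} [CommRing R] [AddCommGroup M] [Module R M] [Fintype ι] [Fintype κ]

theorem sum_smul_eq_sum_mulVec_smul {w : ι → M} {w' : κ → M} {A : Matrix ι κ R}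
    (hA : ∀ j, w' j = ∑ i, A i j • w i) (v : κ → R) :
    ∑ j, v j • w' j = ∑ i, A.mulVec v i • w i := by
  simp only [hA, Finset.smul_sum, Matrix.mulVec, dotProduct, Finset.sum_smul, smul_smul,
    mul_comm (v _)]
  exact Finset.sum_comm

theorem span_range_eq_iff_isUnit [DecidableEq ι] {w w' : ι → M} (hw : LinearIndependent R w)
    {A : Matrix ι ι R} (hA : ∀ j, w' j = ∑ i, A i j • w i) :
    Submodule.span R (Set.range w') = Submodule.span R (Set.range w) ↔ IsUnit A := by
  constructor
  · intro hspan
    choose B hB using fun i => (Submodule.mem_span_range_iff_exists_fun R).1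
      (hspan ▸ Submodule.subset_span ⟨i, rfl⟩ : w i ∈ Submodule.span R (Set.range w'))
    have hAB (j : ι) : A.mulVec (B j) = Pi.single j 1 := by
      refine hw.fintypeLinearCombination_injective ?_
      rw [Fintype.linearCombination_apply, ← sum_smul_eq_sum_mulVec_smul hA, hB,
        Fintype.linearCombination_apply_single, one_smul]
    refine (Matrix.isUnit_iff_isUnit_det A).2
      (Matrix.isUnit_det_of_right_inverse (B := (Matrix.of B).transpose) ?_)
    ext1 i j
    rw [Matrix.one_apply, ← Pi.single_apply, ← hAB]
    rfl
  · intro hAunit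
    obtain ⟨B, hAB⟩ := hAunit.exists_right_inv
    refine le_antisymm (Submodule.span_le.2 ?_) (Submodule.span_le.2 ?_)
    · rintro _ ⟨j, rfl⟩
      exact (Submodule.mem_span_range_iff_exists_fun R).2 ⟨A.col j, (hA j).symm⟩
    · rintro _ ⟨i, rfl⟩
      refine (Submodule.mem_span_range_iff_exists_fun R).2 ⟨B.col i, ?_⟩
      rw [sum_smul_eq_sum_mulVec_smul hA, ← Matrix.mulVec_single_one, Matrix.mulVec_mulVec, hAB,
        Matrix.one_mulVec, ← Fintype.linearCombination_apply,
        Fintype.linearCombination_apply_single, one_smul]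

end Frames

section Holomorphic

variable {Y : ReducedComplexSpace}

theorem continuousAt_toFun {X : Type} [TopologicalSpace X] (c : LocalModel X) {x : X}
    (hx : x ∈ c.dom) : ContinuousAt c.toFun x :=
  (continuousOn_iff_continuous_domRestrict.2 c.isEmbedding.continuous).continuousAt
    (c.isOpen_dom.mem_nhds hx)

theorem HolAt.exists_chart {f : Y → ℂ} {x : Y} (h : HolAt f x) {c : LocalModel Y}
    (hc : c ∈ Y.atlas) (hx : x ∈ c.dom) : ∃ F : (Fin c.dim → ℂ) → ℂ,
      AnalyticAt ℂ F (c.toFun x) ∧ ∀ᶠ y in 𝓝 x, f y = F (c.toFun y) := by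
  obtain ⟨c₀, hc₀, hx₀, F, hF, hfF⟩ := h
  obtain ⟨T, hT, hcT⟩ := Y.compat c hc c₀ hc₀ x ⟨hx, hx₀⟩
  refine ⟨F ∘ T, AnalyticAt.comp (by rwa [← hcT.self_of_nhds]) hT, ?_⟩
  filter_upwards [hfF, hcT] with y hf hc
  rw [hf, hc, Function.comp_apply]

theorem HolAt.congr {f g : Y → ℂ} {x : Y} (h : HolAt f x) (hg : ∀ᶠ y in 𝓝 x, g y = f y) :
    HolAt g x := by
  obtain ⟨c, hc, hx, F, hF, hfF⟩ := h
  exact ⟨c, hc, hx, F, hF, Filter.EventuallyEq.trans hg hfF⟩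

theorem HolAt.comp_analyticAt {ι : Type*} [Fintype ι] {f : ι → Y → ℂ} {x : Y}
    (h : ∀ i, HolAt (f i) x) {G : (ι → ℂ) → ℂ} (hG : AnalyticAt ℂ G fun i => f i x) :
    HolAt (fun y => G fun i => f i y) x := by
  obtain ⟨c, hc, hx⟩ := Y.cover x
  choose F hF hfF using fun i => (h i).exists_chart hc hx
  have hFx : (fun i => f i x) = fun i => F i (c.toFun x) := funext fun i => (hfF i).self_of_nhds
  rw [hFx] at hG
  refine ⟨c, hc, hx, fun z => G fun i => F i z, hG.comp (f := fun z i => F i z) (.pi hF), ?_⟩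
  filter_upwards [Filter.eventually_all.2 hfF] with y hy
  simp only [hy]

theorem HolAt.add {f g : Y → ℂ} {x : Y} (hf : HolAt f x) (hg : HolAt g x) :
    HolAt (fun y => f y + g y) x := by
  obtain ⟨c, hc, hx, F, hF, hfF⟩ := hf
  obtain ⟨G, hG, hgG⟩ := hg.exists_chart hc hx
  exact ⟨c, hc, hx, _, hF.add hG, Filter.EventuallyEq.add hfF hgG⟩

theorem HolAt.mul {f g : Y → ℂ} {x : Y} (hf : HolAt f x) (hg : HolAt g x) :
    HolAt (fun y => f y * g y) x := by
  obtain ⟨c, hc, hx, F, hF, hfF⟩ := hf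
  obtain ⟨G, hG, hgG⟩ := hg.exists_chart hc hx
  exact ⟨c, hc, hx, _, hF.mul hG, Filter.EventuallyEq.mul hfF hgG⟩

theorem HolAt.inv {f : Y → ℂ} {x : Y} (hf : HolAt f x) (h₀ : f x ≠ 0) :
    HolAt (fun y => (f y)⁻¹) x := by
  obtain ⟨c, hc, hx, F, hF, hfF⟩ := hf
  exact ⟨c, hc, hx, _, hF.inv (by rwa [← hfF.self_of_nhds]), Filter.EventuallyEq.inv hfF⟩

theorem HolAt.continuousAt {f : Y → ℂ} {x : Y} (hf : HolAt f x) : ContinuousAt f x := by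
  obtain ⟨c, -, hx, F, hF, hfF⟩ := hf
  exact (hF.continuousAt.comp (continuousAt_toFun c hx)).congr (hfF.mono fun y hy => hy.symm)

/-- The algebra of holomorphic functions on `U`. Its elements are functions on `U` only, so that
those without zeros are invertible. -/
def holRing (Y : ReducedComplexSpace) (U : Set Y) : Subalgebra ℂ (U → ℂ) where
  carrier := {f | ∃ F : Y → ℂ, HolOn F U ∧ ∀ u : U, f u = F u}
  mul_mem' := by
    rintro f g ⟨F, hF, hf⟩ ⟨G, hG, hg⟩
    exact ⟨fun y => F y * G y, fun x hx => (hF x hx).mul (hG x hx), fun u => by simp [hf, hg]⟩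
  add_mem' := by
    rintro f g ⟨F, hF, hf⟩ ⟨G, hG, hg⟩
    exact ⟨fun y => F y + G y, fun x hx => (hF x hx).add (hG x hx), fun u => by simp [hf, hg]⟩
  algebraMap_mem' := fun z => ⟨fun _ => z, fun x _ => holAt_const z x, fun _ => rfl⟩

namespace holRing

variable {U : Set Y}

/-- The value at `u` of a holomorphic function on `U`. -/
def eval (u : U) : holRing Y U →ₐ[ℂ] ℂ :=
  (Pi.evalAlgHom ℂ (fun _ : U => ℂ) u).comp (holRing Y U).val

/-- The restriction to `U` of a function which is holomorphic on `U`. -/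
def ofHolOn (F : Y → ℂ) (hF : HolOn F U) : holRing Y U := ⟨fun u => F u, F, hF, fun _ => rfl⟩

@[simp]
theorem eval_ofHolOn (F : Y → ℂ) (hF : HolOn F U) (u : U) : eval u (ofHolOn F hF) = F u := rfl

theorem exists_holOn_eval_eq (f : holRing Y U) : ∃ F, HolOn F U ∧ ∀ u : U, eval u f = F u := f.2

theorem holOn_of_eval_eq (hU : IsOpen U) {F : Y → ℂ} (f : holRing Y U)
    (h : ∀ u : U, eval u f = F u) : HolOn F U := by
  obtain ⟨F', hF', hf⟩ := exists_holOn_eval_eq f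
  refine fun x hx => (hF' x hx).congr ?_
  filter_upwards [hU.mem_nhds hx] with y hy
  exact (h ⟨y, hy⟩).symm.trans (hf ⟨y, hy⟩)

theorem ext_eval {f g : holRing Y U} (h : ∀ u, eval u f = eval u g) : f = g :=
  Subtype.ext (funext h)

theorem isUnit_iff {f : holRing Y U} : IsUnit f ↔ ∀ u, eval u f ≠ 0 := by
  refine ⟨fun h u => (h.map (eval u)).ne_zero, fun h => ?_⟩
  obtain ⟨F, hF, hf⟩ := exists_holOn_eval_eq f
  have hF₀ (u : U) : F u ≠ 0 := by simpa only [hf] using h u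
  have hF' : HolOn (fun y => (F y)⁻¹) U := fun x hx => (hF x hx).inv (hF₀ ⟨x, hx⟩)
  refine IsUnit.of_mul_eq_one (ofHolOn _ hF') (ext_eval fun u => ?_)
  rw [map_mul, eval_ofHolOn, map_one, hf, mul_inv_cancel₀ (hF₀ u)]

/-- The value at `u` of a power series with holomorphic coefficients. -/
def evalSeries (u : U) : (holRing Y U)⟦X⟧ →+* ℂ⟦X⟧ := PowerSeries.map (eval u : holRing Y U →+* ℂ)

theorem coeff_evalSeries (u : U) (T : (holRing Y U)⟦X⟧) (n : ℕ) :
    coeff n (evalSeries u T) = eval u (coeff n T) := coeff_map _ n T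

theorem isUnit_iff_evalSeries {T : (holRing Y U)⟦X⟧} :
    IsUnit T ↔ ∀ u, IsUnit (evalSeries u T) := by
  simp only [isUnit_iff_constantCoeff, isUnit_iff, isUnit_iff_ne_zero,
    ← coeff_zero_eq_constantCoeff_apply, coeff_evalSeries]

/-- A section of `𝒪[[b]]` on `U`, as a power series with holomorphic coefficients. -/
def seriesOfHolOn (S : Y → ℂ⟦X⟧) (hS : SeriesHolOn S U) : (holRing Y U)⟦X⟧ :=
  PowerSeries.mk fun n => ofHolOn _ (hS n)

@[simp]
theorem evalSeries_seriesOfHolOn (S : Y → ℂ⟦X⟧) (hS : SeriesHolOn S U) (u : U) :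
    evalSeries u (seriesOfHolOn S hS) = S u := by
  ext n
  rw [coeff_evalSeries, seriesOfHolOn, coeff_mk, eval_ofHolOn]

theorem exists_seriesHolOn_evalSeries_eq (T : (holRing Y U)⟦X⟧) :
    ∃ S, SeriesHolOn S U ∧ ∀ u : U, evalSeries u T = S u := by
  choose F hF hT using fun n => exists_holOn_eval_eq (coeff n T)
  refine ⟨fun y => PowerSeries.mk fun n => F n y, fun n x hx => ?_, fun u => ?_⟩
  · simpa only [coeff_mk] using hF n x hx
  · ext n
    rw [coeff_evalSeries, coeff_mk, hT]

end holRing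

open holRing

variable {M : Y → Type} [∀ y, AddCommGroup (M y)] [∀ y, Module ℂ⟦X⟧ (M y)] {k k' : ℕ}
  {V V' : Set Y} {w : ∀ y, Fin k → M y} {w' : ∀ y, Fin k' → M y} {s : ∀ y, M y}

theorem holCombOn_iff : HolCombOn V w s ↔ ∃ T : Fin k → (holRing Y V)⟦X⟧,
    ∀ u : V, s u = ∑ i, evalSeries u (T i) • w u i := by
  constructor
  · rintro ⟨S, hS, h⟩
    exact ⟨fun i => seriesOfHolOn (S i) (hS i), fun u => by simp [h u u.2]⟩
  · rintro ⟨T, h⟩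
    choose S hS hTS using fun i => exists_seriesHolOn_evalSeries_eq (T i)
    refine ⟨S, hS, fun y hy => ?_⟩
    simpa only [hTS] using h ⟨y, hy⟩

theorem HolCombOn.mono (h : HolCombOn V w s) (hV : V' ⊆ V) : HolCombOn V' w s := by
  obtain ⟨S, hS, h⟩ := h
  exact ⟨S, fun i n x hx => hS i n x (hV hx), fun y hy => h y (hV hy)⟩

theorem holCombOn_self (V : Set Y) (w : ∀ y, Fin k → M y) (j : Fin k) :
    HolCombOn V w fun y => w y j :=
  holCombOn_iff.2 ⟨Pi.single j 1, fun u => by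
    simp [Pi.single_apply, apply_ite (evalSeries u), ite_smul]⟩

theorem HolCombOn.trans (h : HolCombOn V w s) (h' : ∀ i, HolCombOn V w' fun y => w y i) :
    HolCombOn V w' s := by
  rw [holCombOn_iff] at h ⊢
  obtain ⟨T, hT⟩ := h
  choose T' hT' using fun i => holCombOn_iff.1 (h' i)
  refine ⟨(Matrix.of fun j i => T' i j).mulVec T, fun u => ?_⟩
  simp only [hT u, RingHom.map_mulVec]
  exact sum_smul_eq_sum_mulVec_smul (fun i => hT' i u) _

theorem HolCombOn.symm (hw : ∀ y ∈ V, LinearIndependent ℂ⟦X⟧ (w y))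
    (hw' : ∀ y ∈ V, LinearIndependent ℂ⟦X⟧ (w' y))
    (hspan : ∀ y ∈ V, Submodule.span ℂ⟦X⟧ (Set.range (w y)) =
      Submodule.span ℂ⟦X⟧ (Set.range (w' y)))
    (h : ∀ j, HolCombOn V w fun y => w' y j) (j : Fin k) : HolCombOn V w' fun y => w y j := by
  obtain rfl | ⟨y₀, hy₀⟩ := V.eq_empty_or_nonempty
  · exact ⟨fun _ _ => 0, fun _ _ _ hx => hx.elim, fun _ hx => hx.elim⟩
  obtain rfl : k = k' := by
    have hcard := finrank_span_eq_card (hw y₀ hy₀)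
    rw [hspan y₀ hy₀, finrank_span_eq_card (hw' y₀ hy₀)] at hcard
    simpa using hcard.symm
  choose T hT using fun i => holCombOn_iff.1 (h i)
  obtain ⟨A, hA⟩ : ∃ A : Matrix (Fin k) (Fin k) (holRing Y V)⟦X⟧, A = Matrix.of fun i j => T j i :=
    ⟨_, rfl⟩
  have hAu (u : V) (j : Fin k) : w' u j = ∑ i, A.map (evalSeries u) i j • w u i := by
    rw [hT, hA]
    rfl
  have hdet : IsUnit A.det := isUnit_iff_evalSeries.2 fun u => by
    rw [RingHom.map_det, ← Matrix.isUnit_iff_isUnit_det]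
    exact (span_range_eq_iff_isUnit (hw u u.2) (hAu u)).1 (hspan u u.2).symm
  refine holCombOn_iff.2 ⟨A⁻¹.mulVec (Pi.single j 1), fun u => ?_⟩
  have hAA (i : Fin k) : (A.map (evalSeries u)).mulVec
      (fun l => evalSeries u (A⁻¹.mulVec (Pi.single j 1) l)) i = if i = j then 1 else 0 := by
    refine (RingHom.map_mulVec (evalSeries u) A _ i).symm.trans ?_
    rw [Matrix.mulVec_mulVec, Matrix.mul_nonsing_inv _ hdet, Matrix.one_mulVec, Pi.single_apply,
      apply_ite (evalSeries u), map_one, map_zero]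
  simp only [sum_smul_eq_sum_mulVec_smul (hAu u), hAA, ite_smul, one_smul, zero_smul,
    Finset.sum_ite_eq', Finset.mem_univ, if_true]

end Holomorphic

/-! ### Embeddings into `Ξ` -/

section Xi

variable {R : Type*} [CommRing R]

/-- The matrix of `a` in the basis `e_{μ,0}, …, e_{μ,N}` of `Ξ_μ^{(N)}`, over any ring. -/
def xiMatrix (μ : R) (N : ℕ) : Matrix (Fin (N + 1)) (Fin (N + 1)) R⟦X⟧ :=
  Matrix.of fun i j => if i = j then C μ * X else if (i : ℕ) + 1 = j then X else 0

theorem xiMatrix_map {A : Type*} [CommRing A] (f : R →+* A) (μ : R) (N : ℕ) :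
    (xiMatrix μ N).map (PowerSeries.map f) = xiMatrix (f μ) N := by
  ext1 i j
  simp only [xiMatrix, Matrix.map_apply, Matrix.of_apply]
  split_ifs <;> simp

/-- `a - (μ + n) b` on `Ξ_μ^{(N)}`, elements being written as sequences which vanish from the
index `N + 1` on. -/
theorem abAct_xiMatrix (μ : R) (N n : ℕ) {v : ℕ → R⟦X⟧} (hv : v (N + 1) = 0)
    (i : Fin (N + 1)) :
    abAct (xiMatrix μ N) (fun i => v i) i =
      C (μ + n) * X * v i + (X * v (i + 1) + eulerOp n (v i)) := by
  have hrow : (xiMatrix μ N).mulVec (fun i => v i) i = C μ * X * v i + X * v (i + 1) := by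
    have hsplit (j : Fin (N + 1)) : xiMatrix μ N i j * v j =
        (if i = j then C μ * X * v i else 0) + if (i : ℕ) + 1 = j then X * v (i + 1) else 0 := by
      simp only [xiMatrix, Matrix.of_apply]
      split_ifs with h h' h' <;> simp_all
    simp only [Matrix.mulVec, dotProduct, hsplit, Finset.sum_add_distrib, Finset.sum_ite_eq,
      Finset.mem_univ, if_true]
    congr 1
    obtain hi | hi := (Nat.le_of_lt_succ i.2).eq_or_lt
    · rw [hi, hv, mul_zero]
      simp
    · rw [Finset.sum_eq_single ⟨i + 1, by omega⟩] <;> simp +contextual [Fin.ext_iff, eq_comm]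
  rw [abAct, Pi.add_apply, hrow, eulerOp, map_add, map_natCast]
  push_cast
  ring

variable {n : ℕ} {v w : ℕ → R⟦X⟧}

theorem exists_mul_add_eulerOp_eq [Algebra ℚ R] {j : ℕ} (hw : ∀ i, constantCoeff (w i) = 0)
    (hwj : ∀ i, j ≤ i → w i = 0) (c : R) :
    ∃ v : ℕ → R⟦X⟧, (∀ i, X * v (i + 1) + eulerOp n (v i) = w i) ∧ coeff n (v 0) = c ∧
      ∀ i, j < i → v i = 0 := by
  induction j generalizing w c with
  | zero =>
    refine ⟨Pi.single 0 (C c * X ^ n), fun i => ?_, by simp [coeff_X_pow], fun i hi => by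
      simp [hi.ne']⟩
    obtain rfl | hi := eq_or_ne i 0
    · simp [hwj, eulerOp_C_mul_X_pow]
    · simp [hwj, hi, eulerOp]
  | succ j ih =>
    obtain ⟨v, hv, hv₀, hvj⟩ := ih (w := fun i => w (i + 1)) (fun i => hw _)
      (fun i hi => hwj _ (by omega)) (coeff (n + 1) (w 0))
    obtain ⟨v₀, hsol, hc⟩ := exists_add_eulerOp_eq_zero (d := n) (T := X * v 0 - w 0)
      (by simp [hw]) (by rw [map_sub, coeff_succ_X_mul, hv₀, sub_self]) c
    refine ⟨fun | 0 => v₀ | i + 1 => v i, fun i => ?_, hc, fun i hi => ?_⟩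
    · cases i with
      | zero => exact (by linear_combination hsol : X * v 0 + eulerOp n v₀ = w 0)
      | succ i => exact hv i
    · cases i with
      | zero => omega
      | succ i => exact hvj i (by omega)

theorem coeff_eq_coeff_succ_of_mul_add_eulerOp_eq {v₀ v₁ w₀ : R⟦X⟧}
    (h : X * v₁ + eulerOp n v₀ = w₀) : coeff n v₁ = coeff (n + 1) w₀ := by
  simpa [coeff_succ_X_mul, coeff_succ_eulerOp] using congrArg (coeff (n + 1)) h

variable [IsAddTorsionFree R]

theorem eq_zero_of_mul_add_eulerOp_eq {j r : ℕ}
    (h : ∀ i, j ≤ i → X * v (i + 1) + eulerOp n (v i) = 0) (hv : ∀ i, r < i → v i = 0) :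
    ∀ i, j < i → v i = 0 := by
  suffices H : ∀ d i, j < i → r < i + d → v i = 0 from fun i hi => H (r + 1) i hi (by omega)
  intro d
  induction d with
  | zero => exact fun i _ => hv i
  | succ d ih =>
    intro i hij hir
    have hsucc := ih (i + 1) (by omega) (by omega)
    have hker : eulerOp n (v i) = 0 := by simpa [hsucc] using h i hij.le
    have hcoeff : coeff n (v i) = 0 := by
      obtain ⟨i, rfl⟩ := Nat.exists_eq_add_of_lt hij
      simpa using coeff_eq_coeff_succ_of_mul_add_eulerOp_eq (h (j + i) (by omega))
    rw [eq_C_mul_X_pow_of_eulerOp_eq_zero hker, hcoeff, map_zero, zero_mul]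

theorem X_pow_dvd_of_mul_add_eulerOp_eq {N j : ℕ} (hN : N ≤ n) (hw : ∀ i, X ^ (N + 1) ∣ w i)
    (h : ∀ i, X * v (i + 1) + eulerOp n (v i) = w i) (hv : ∀ i, j < i → v i = 0) (i : ℕ) :
    X ^ N ∣ v i := by
  suffices H : ∀ d i, j < i + d → X ^ N ∣ v i from H (j + 1) i (by omega)
  intro d
  induction d with
  | zero => exact fun i hi => by simp [hv i hi]
  | succ d ih =>
    intro i hi
    have hsucc := X_pow_dvd_iff.1 (ih (i + 1) (by omega))
    refine X_pow_dvd_iff.2 fun m hm => ?_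
    have hm' : X * v (i + 1) - w i + eulerOp n (v i) = 0 := by linear_combination h i
    have key := coeff_succ_add_of_add_eulerOp hm' m
    rw [map_sub, coeff_succ_X_mul, hsucc m hm, X_pow_dvd_iff.1 (hw i) _ (by omega), sub_zero,
      zero_add] at key
    have hzsmul : ((m : ℤ) - n) • coeff m (v i) = 0 := by simpa using key
    exact (IsAddTorsionFree.zsmul_eq_zero_iff_right (by omega)).1 hzsmul

end Xi

section Embedding

variable {R : Type*} [CommRing R] [Algebra ℚ R]

theorem exists_mul_add_eulerOp_eq_mul {n n' m N j : ℕ} {p : ℕ → R⟦X⟧} {c : R} (S : R⟦X⟧)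
    (hn : n' + 1 = m + n) (hN : N ≤ n') (hp : ∀ i, X ^ (N + 1) ∣ p i)
    (hpj : ∀ i, j < i → p i = 0) (hj : p j = C c * X ^ n) :
    ∃ q : ℕ → R⟦X⟧, (∀ i, X * q (i + 1) + eulerOp n' (q i) = S * p i) ∧ (∀ i, X ^ N ∣ q i) ∧
      (∀ i, j + 1 < i → q i = 0) ∧ q (j + 1) = C (c * coeff m S) * X ^ n' := by
  have := IsAddTorsionFree.of_module_rat R
  have hdvd (i : ℕ) : X ^ (N + 1) ∣ S * p i := (hp i).mul_left _
  obtain ⟨q, hq, -, hqj⟩ := exists_mul_add_eulerOp_eq (n := n') (j := j + 1)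
    (w := fun i => S * p i) (c := 0)
    (fun i => by simpa using X_pow_dvd_iff.1 (hdvd i) 0 (by omega))
    (fun i hi => by rw [hpj i (by omega), mul_zero])
  refine ⟨q, hq, X_pow_dvd_of_mul_add_eulerOp_eq hN hdvd hq hqj, hqj, ?_⟩
  have hker : eulerOp n' (q (j + 1)) = 0 := by
    simpa [hqj (j + 2) (by omega), hpj (j + 1) (by omega)] using hq (j + 1)
  rw [eq_C_mul_X_pow_of_eulerOp_eq_zero hker, coeff_eq_coeff_succ_of_mul_add_eulerOp_eq (hq j), hj,
    hn, mul_left_comm, coeff_C_mul, coeff_mul_X_pow]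

theorem exists_intertwines_xiMatrix (μ : R) (N : ℕ) (S : Fin 3 → R⟦X⟧) :
    ∃ P, Intertwines (xiMatrix μ 3) (themeMatrix (μ + (N + 3 : ℕ)) S) P ∧
      P.det = C (coeff 3 (S 0) ^ 3 * coeff 2 (S 1) ^ 2 * coeff 2 (S 2)) * X ^ (4 * N + 21) := by
  have := IsAddTorsionFree.of_module_rat R
  obtain ⟨p₁, hp₁, hp₁_coeff, hp₁_vanish⟩ := exists_mul_add_eulerOp_eq (n := N + 3) (j := 0)
    (w := (0 : ℕ → R⟦X⟧)) (by simp) (by simp) 1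
  have hp₁_dvd := X_pow_dvd_of_mul_add_eulerOp_eq le_rfl (by simp) hp₁ hp₁_vanish
  have hp₁_zero : p₁ 0 = C 1 * X ^ (N + 3) := by
    rw [← hp₁_coeff]
    exact eq_C_mul_X_pow_of_eulerOp_eq_zero (by simpa [hp₁_vanish] using hp₁ 0)
  obtain ⟨p₂, hp₂, hp₂_dvd, hp₂_vanish, hp₂_one⟩ := exists_mul_add_eulerOp_eq_mul (S 0)
    (n' := N + 5) (m := 3) (by omega) (by omega) hp₁_dvd hp₁_vanish hp₁_zero
  obtain ⟨p₃, hp₃, hp₃_dvd, hp₃_vanish, hp₃_two⟩ := exists_mul_add_eulerOp_eq_mul (S 1)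
    (n' := N + 6) (m := 2) (by omega) (by omega) hp₂_dvd hp₂_vanish hp₂_one
  obtain ⟨p₄, hp₄, -, hp₄_vanish, hp₄_three⟩ := exists_mul_add_eulerOp_eq_mul (S 2)
    (n' := N + 7) (m := 2) (by omega) (by omega) hp₃_dvd hp₃_vanish hp₃_two
  refine ⟨Matrix.of fun i j => ![p₁, p₂, p₃, p₄] j i, ?_, ?_⟩
  · have act {n : ℕ} {p w : ℕ → R⟦X⟧} {l : R} (hl : μ + n = l) (hvanish : ∀ i, 3 < i → p i = 0)
        (hp : ∀ i, X * p (i + 1) + eulerOp n (p i) = w i) :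
        abAct (xiMatrix μ 3) (fun i => p i) =
          (C l * X) • (fun i : Fin 4 => p i) + fun i : Fin 4 => w i := by
      ext1 i
      rw [abAct_xiMatrix μ 3 n (hvanish 4 (by omega)), hp, hl]
      rfl
    refine intertwines_themeMatrix_of (w := fun j i => ![p₁, p₂, p₃, p₄] j i)
      ((act rfl (fun i hi => hp₁_vanish i (by omega)) hp₁).trans (add_zero _))
      (act ?_ (fun i hi => hp₂_vanish i (by omega)) hp₂)
      (act ?_ (fun i hi => hp₃_vanish i (by omega)) hp₃) (act ?_ hp₄_vanish hp₄)
    all_goals push_cast; ring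
  · rw [Matrix.det_of_isUpperTriangular]
    · rw [Fin.prod_univ_four]
      change p₁ 0 * p₂ 1 * p₃ 2 * p₄ 3 = _
      rw [hp₁_zero, hp₂_one, hp₃_two, hp₄_three]
      simp only [map_mul, map_pow, map_one]
      ring
    · intro i j hij
      fin_cases j
      · exact hp₁_vanish _ hij
      · exact hp₂_vanish _ hij
      · exact hp₃_vanish _ hij
      · exact absurd hij (by simpa using i.le_last)

end Embedding

section HasMatrix

variable {k : ℕ} {E : ABModule} {w : Fin k → E} {M : Matrix (Fin k) (Fin k) ℂ⟦X⟧}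

/-- The action of `a` on the vectors `w j` of an (a,b)-module is given by the matrix `M`. The
vectors need not form a basis. -/
def HasMatrix (E : ABModule) (w : Fin k → E) (M : Matrix (Fin k) (Fin k) ℂ⟦X⟧) : Prop :=
  ∀ j, E.a (w j) = ∑ i, M i j • w i

theorem HasMatrix.a_sum_smul (h : HasMatrix E w M) (v : Fin k → ℂ⟦X⟧) :
    E.a (∑ j, v j • w j) = ∑ i, abAct M v i • w i := by
  simp only [map_sum, E.a_smul, Finset.sum_add_distrib, abAct, Pi.add_apply, add_smul]
  rw [sum_smul_eq_sum_mulVec_smul h]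

theorem HasMatrix.iterate_a_sum_smul (h : HasMatrix E w M) (v : Fin k → ℂ⟦X⟧) (n : ℕ) :
    E.a^[n] (∑ j, v j • w j) = ∑ i, (abAct M)^[n] v i • w i := by
  induction n with
  | zero => rfl
  | succ n ih => rw [Function.iterate_succ_apply', ih, h.a_sum_smul, Function.iterate_succ_apply']

theorem hasMatrix_col_iff {N G : Matrix (Fin k) (Fin k) ℂ⟦X⟧} :
    HasMatrix (ABModule.ofMatrix M) G.col N ↔ Intertwines M N G := by
  have hmul (i j : Fin k) : (G * N) i j = (∑ q, N q j • G.col q) i := by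
    simp [Matrix.mul_apply, mul_comm]
  rw [Intertwines, ← Matrix.ext_iff, forall_comm]
  simp only [hmul]
  exact forall_congr' fun j => funext_iff

theorem HasMatrix.a_sub_smul_mem_span (h : HasMatrix E w M) (hM : M.IsUpperTriangular)
    (j : Fin k) : E.a (w j) - M j j • w j ∈ Submodule.span ℂ⟦X⟧ (w '' {i | i < j}) := by
  rw [h j, ← Finset.sum_erase_eq_sub (Finset.mem_univ j)]
  refine Submodule.sum_mem _ fun i hi => ?_
  obtain hij | hij := (Finset.ne_of_mem_erase hi).lt_or_gt
  · exact Submodule.smul_mem _ _ (Submodule.subset_span ⟨i, hij, rfl⟩)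
  · rw [hM hij, zero_smul]
    exact zero_mem _

end HasMatrix

section Generator

theorem constantCoeff_abAct {R ι : Type*} [CommRing R] [Fintype ι] (M : Matrix ι ι R⟦X⟧)
    (v : ι → R⟦X⟧) (i : ι) : constantCoeff (abAct M v i) =
      (M.map constantCoeff).mulVec (fun j => constantCoeff (v j)) i := by
  simp [abAct, RingHom.map_mulVec, Function.comp_def]

theorem isUnit_iterate_abAct_iff {R : Type*} [CommRing R] {T : Matrix (Fin 4) (Fin 4) R⟦X⟧}
    (hT : T.IsUpperTriangular) (hdiag : ∀ i, constantCoeff (T i i) = 0) (c : Fin 4 → R⟦X⟧) :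
    IsUnit (Matrix.of fun i j : Fin 4 => (abAct T)^[j] c i) ↔
      IsUnit (T 0 1) ∧ IsUnit (T 1 2) ∧ IsUnit (T 2 3) ∧ IsUnit (c 3) := by
  have hlower (i j : Fin 4) (hij : j < i) : constantCoeff (T i j) = 0 := by
    rw [hT hij, map_zero]
  have hdet : (constantCoeff (Matrix.of fun i j : Fin 4 => (abAct T)^[j] c i).det : R) =
      constantCoeff (T 0 1) * constantCoeff (T 1 2) ^ 2 * constantCoeff (T 2 3) ^ 3 *
        constantCoeff (c 3) ^ 4 := by
    rw [RingHom.map_det, Matrix.det_succ_row_zero]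
    simp [Fin.sum_univ_succ, Matrix.det_fin_three, Function.iterate_succ_apply',
      constantCoeff_abAct, Matrix.mulVec, dotProduct, hdiag, hlower, Fin.succAbove]
    ring
  rw [Matrix.isUnit_iff_isUnit_det, isUnit_iff_constantCoeff, hdet]
  simp only [isUnit_iff_constantCoeff, IsUnit.mul_iff, isUnit_pow_iff (n := 2) (by decide),
    isUnit_pow_iff (n := 3) (by decide), isUnit_pow_iff (n := 4) (by decide), and_assoc]

theorem HasMatrix.span_iterates_eq_iff {E : ABModule} {w : Fin 4 → E}
    {T : Matrix (Fin 4) (Fin 4) ℂ⟦X⟧} (h : HasMatrix E w T) (hw : LinearIndependent ℂ⟦X⟧ w)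
    (hT : T.IsUpperTriangular) (hdiag : ∀ i, constantCoeff (T i i) = 0) (c : Fin 4 → ℂ⟦X⟧) :
    Submodule.span ℂ⟦X⟧ (Set.range fun i : Fin 4 => E.a^[i] (∑ j, c j • w j)) =
        Submodule.span ℂ⟦X⟧ (Set.range w) ↔
      IsUnit (T 0 1) ∧ IsUnit (T 1 2) ∧ IsUnit (T 2 3) ∧ IsUnit (c 3) := by
  rw [← isUnit_iterate_abAct_iff hT hdiag c, span_range_eq_iff_isUnit hw]
  exact fun j => h.iterate_a_sum_smul c j

theorem HasMatrix.span_iterates_smul_eq {E : ABModule} {w : Fin 4 → E} {l : ℂ}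
    {S : Fin 3 → ℂ⟦X⟧} {s : ℂ⟦X⟧} (h : HasMatrix E w (themeMatrix l S))
    (hw : LinearIndependent ℂ⟦X⟧ w) (hS : ∀ i, IsUnit (S i)) (hs : IsUnit s) :
    Submodule.span ℂ⟦X⟧ (Set.range fun i : Fin 4 => E.a^[i] (s • w 3)) =
      Submodule.span ℂ⟦X⟧ (Set.range w) := by
  have hspan := (h.span_iterates_eq_iff hw (isUpperTriangular_themeMatrix l S)
    (fun i => by rw [themeMatrix_apply_self, map_mul, constantCoeff_X, mul_zero])
    (Pi.single 3 s)).2 ⟨hS 0, hS 1, hS 2, by rwa [Pi.single_eq_same]⟩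
  rwa [← Fintype.linearCombination_apply, Fintype.linearCombination_apply_single] at hspan

end Generator

section Holomorphic

open holRing

variable {Y : ReducedComplexSpace} {k : ℕ} {V : Set Y}

theorem holRing.evalSeries_abAct (u : V) (M : Matrix (Fin k) (Fin k) (holRing Y V)⟦X⟧)
    (v : Fin k → (holRing Y V)⟦X⟧) (i : Fin k) : evalSeries u (abAct M v i) =
      abAct (M.map (evalSeries u)) (fun j => evalSeries u (v j)) i :=
  map_abAct _ M v i

variable {E : Y → ABModule} {w : ∀ y, Fin k → E y} {s : ∀ y, E y}

theorem HolCombOn.a (hw : ∀ j, HolCombOn (M := fun y => E y) V w fun y => (E y).a (w y j))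
    (hs : HolCombOn (M := fun y => E y) V w s) :
    HolCombOn (M := fun y => E y) V w fun y => (E y).a (s y) := by
  choose M hM using fun j => holCombOn_iff.1 (hw j)
  obtain ⟨T, hT⟩ := holCombOn_iff.1 hs
  refine holCombOn_iff.2 ⟨abAct (Matrix.of fun i j => M j i) T, fun u => ?_⟩
  simp only [evalSeries_abAct, hT]
  exact HasMatrix.a_sum_smul (fun j => hM j u) _

theorem HolCombOn.iterate_a
    (hw : ∀ j, HolCombOn (M := fun y => E y) V w fun y => (E y).a (w y j))
    (hs : HolCombOn (M := fun y => E y) V w s) (n : ℕ) :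
    HolCombOn (M := fun y => E y) V w fun y => (E y).a^[n] (s y) := by
  induction n with
  | zero => exact hs
  | succ n ih => simpa only [Function.iterate_succ_apply'] using ih.a hw

theorem linearIndependent_of_span_range_eq {R M ι : Type*} [CommRing R] [IsDomain R]
    [AddCommGroup M] [Module R M] [Finite ι] {w w' : ι → M} (hw : LinearIndependent R w)
    (h : Submodule.span R (Set.range w') = Submodule.span R (Set.range w)) :
    LinearIndependent R w' := by
  cases nonempty_fintype ι
  rw [linearIndependent_iff_card_eq_finrank_span, Set.finrank, h, finrank_span_eq_card hw]

variable {μ : ℚ} {N : ℕ} {φ : Y → Xi μ N} {v : Y → Fin k → Xi μ N}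

theorem HolCombOn.iterates_of_span_eq (hv : ∀ y ∈ V, LinearIndependent ℂ⟦X⟧ (v y))
    (hva : ∀ j, HolCombOn (M := fun _ => Xi μ N) V v fun y => (Xi μ N).a (v y j))
    (hφ : HolCombOn (M := fun _ => Xi μ N) V v φ)
    (hspan : ∀ y ∈ V, Submodule.span ℂ⟦X⟧ (Set.range (iterates k φ y)) =
      Submodule.span ℂ⟦X⟧ (Set.range (v y))) (j : Fin k) :
    HolCombOn (M := fun _ => Xi μ N) V (iterates k φ) fun y => v y j :=
  HolCombOn.symm hv (fun y hy => linearIndependent_of_span_range_eq (hv y hy) (hspan y hy))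
    (fun y hy => (hspan y hy).symm) (fun i => hφ.iterate_a hva i) j

theorem isThematicOn_of_span_eq (hv : ∀ y ∈ V, LinearIndependent ℂ⟦X⟧ (v y))
    (hva : ∀ j, HolCombOn (M := fun _ => Xi μ N) V v fun y => (Xi μ N).a (v y j))
    (hφ : HolCombOn (M := fun _ => Xi μ N) V v φ)
    (hspan : ∀ y ∈ V, Submodule.span ℂ⟦X⟧ (Set.range (iterates k φ y)) =
      Submodule.span ℂ⟦X⟧ (Set.range (v y)))
    (hcoord : ∀ i, SeriesHolOn (fun y => Xi.coord μ N (φ y) i) V) : IsThematicOn k V φ :=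
  ⟨hcoord, fun y hy => linearIndependent_of_span_range_eq (hv y hy) (hspan y hy),
    (hφ.iterate_a hva k).trans (hφ.iterates_of_span_eq hv hva hspan)⟩

end Holomorphic

section Families

open holRing

theorem exists_residue_add {lam1 : ℚ} (h : 3 < lam1) :
    ∃ N : ℕ, lam1 = residue lam1 + (N + 3 : ℕ) := by
  have hceil : 3 < ⌈lam1⌉ := Int.lt_ceil.2 (by exact_mod_cast h)
  obtain ⟨N, hN⟩ := Int.eq_ofNat_of_zero_le (show 0 ≤ ⌈lam1⌉ - 4 by omega)
  refine ⟨N, ?_⟩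
  have hNq : (⌈lam1⌉ : ℚ) = N + 4 := by exact_mod_cast sub_eq_iff_eq_add.1 hN
  rw [residue, hNq]
  push_cast
  ring

theorem exponent_eq (lam1 : ℚ) (j : Fin 4) :
    exponent (r := 3) lam1 ![3, 2, 2] j = lam1 + (![0, 2, 3, 4] j : ℤ) := by
  fin_cases j <;> simp [exponent, Fin.sum_univ_three] <;> norm_num

theorem hasInvariants_themeMatrix (lam1 : ℚ) (S : Fin 3 → ℂ⟦X⟧) :
    HasInvariants (r := 3) lam1 ![3, 2, 2] (ABModule.ofMatrix (themeMatrix (lam1 : ℂ) S)) := by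
  refine ⟨Pi.basisFun ℂ⟦X⟧ (Fin 4), fun j => ?_⟩
  have hmem := HasMatrix.a_sub_smul_mem_span (E := ABModule.ofMatrix (themeMatrix (lam1 : ℂ) S))
    (ABModule.ofMatrix_a_basisFun _) (isUpperTriangular_themeMatrix (lam1 : ℂ) S) j
  rw [themeMatrix_apply_self] at hmem
  rw [exponent_eq]
  exact_mod_cast hmem

variable {Y : ReducedComplexSpace} {lam1 : ℚ}

theorem exists_holomorphic_intertwines_canonicalMatrix (hlam1 : 3 < lam1) {g : Y → Fin 6 → ℂ}
    (hg : ∀ i, HolOn (fun y => g y i) Set.univ) (hp : ∀ y, g y ∈ paramSpace) :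
    ∃ P : Y → Matrix (Fin 4) (Fin 4) ℂ⟦X⟧, (∀ i j, SeriesHolOn (fun y => P y i j) Set.univ) ∧
      ∀ y, Intertwines (xiMatrix (residue lam1 : ℂ) 3) (canonicalMatrix lam1 (g y)) (P y) ∧
        (P y).det ≠ 0 := by
  obtain ⟨N, hN⟩ := exists_residue_add hlam1
  obtain ⟨P, hP, hdet⟩ := exists_intertwines_xiMatrix
    (algebraMap ℂ (holRing Y Set.univ) (residue lam1)) N
    (canonicalEntries fun i => ofHolOn _ (hg i))
  refine ⟨fun y => P.map (evalSeries ⟨y, Set.mem_univ y⟩), fun i j => ?_, fun y => ⟨?_, ?_⟩⟩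
  · obtain ⟨S, hS, hPS⟩ := exists_seriesHolOn_evalSeries_eq (P i j)
    exact (funext fun y => hPS ⟨y, Set.mem_univ y⟩ : (fun y => evalSeries _ (P i j)) = S) ▸ hS
  · have hPy := hP.map (eval (⟨y, Set.mem_univ y⟩ : (Set.univ : Set Y)) : holRing Y Set.univ →+* ℂ)
    have hlam : (lam1 : ℂ) = (residue lam1 : ℂ) + (N + 3 : ℕ) := by
      exact_mod_cast congrArg (Rat.cast : ℚ → ℂ) hN
    rw [canonicalMatrix_eq, hlam]
    have hxi := xiMatrix_map (eval (⟨y, Set.mem_univ y⟩ : (Set.univ : Set Y)) : _ →+* ℂ)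
      (algebraMap ℂ (holRing Y Set.univ) (residue lam1)) 3
    have htheme := themeMatrix_map (eval (⟨y, Set.mem_univ y⟩ : (Set.univ : Set Y)) : _ →+* ℂ)
      (algebraMap ℂ (holRing Y Set.univ) (residue lam1) + (N + 3 : ℕ))
      (canonicalEntries fun i => ofHolOn _ (hg i))
    simp only [canonicalEntries_map, map_add, map_natCast, RingHom.coe_coe, AlgHom.commutes,
      eval_ofHolOn] at hxi htheme
    refine Eq.mp ?_ hPy
    exact congrArg₂ (Intertwines · · _) hxi htheme
  · obtain ⟨⟨hα, hγ⟩, hθ⟩ : (g y 0 ≠ 0 ∧ g y 2 ≠ 0) ∧ g y 5 ≠ 0 := by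
      simpa only [paramSpace, Set.mem_ofPred_eq, mul_ne_zero_iff] using hp y
    change (RingHom.mapMatrix (evalSeries _) P).det ≠ 0
    rw [← RingHom.map_det, hdet, map_mul, map_pow, evalSeries, map_C,
      map_X]
    refine mul_ne_zero ((map_ne_zero_iff _ C_injective).2 ?_) (pow_ne_zero _ X_ne_zero)
    simp [canonicalEntries, hα, hγ, hθ]

theorem isThemeFamily_ofMatrix (hlam1 : 3 < lam1) {g : Y → Fin 6 → ℂ}
    (hg : ∀ i, HolOn (fun y => g y i) Set.univ) (hp : ∀ y, g y ∈ paramSpace)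
    (hM : ∀ i j, SeriesHolOn (fun y => canonicalMatrix lam1 (g y) i j) Set.univ) :
    IsThemeFamily (r := 3) lam1 ![3, 2, 2]
      (ABFamily.ofMatrix Y (fun y => canonicalMatrix lam1 (g y)) hM) := by
  refine ⟨fun y => ?_, fun y₀ => ?_⟩
  · change HasInvariants (r := 3) lam1 ![3, 2, 2] (ABModule.ofMatrix (canonicalMatrix lam1 (g y)))
    rw [canonicalMatrix_eq]
    exact hasInvariants_themeMatrix lam1 _
  obtain ⟨P, hPhol, hP⟩ := exists_holomorphic_intertwines_canonicalMatrix hlam1 hg hp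
  obtain ⟨v, hv⟩ : ∃ v : Y → Fin 4 → Xi (residue lam1) 3, v = fun y => (P y).col := ⟨_, rfl⟩
  have hmat (y : Y) : HasMatrix _ (v y) (canonicalMatrix lam1 (g y)) :=
    hv ▸ hasMatrix_col_iff.2 (hP y).1
  have hli : ∀ y ∈ Set.univ, LinearIndependent ℂ⟦X⟧ (v y) := fun y _ =>
    hv ▸ Matrix.linearIndependent_cols_of_det_ne_zero (hP y).2
  have hva (j : Fin 4) : HolCombOn (M := fun _ => Xi (residue lam1) 3) Set.univ v
      fun y => (Xi (residue lam1) 3).a (v y j) := ⟨_, fun i => hM i j, fun y _ => hmat y j⟩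
  have hself (j : Fin 4) : HolCombOn (M := fun _ => Xi (residue lam1) 3) Set.univ v
      fun y => v y j := holCombOn_self _ _ _
  have hspan : ∀ y ∈ Set.univ, Submodule.span ℂ⟦X⟧ (Set.range (iterates 4 (v · 3) y)) =
      Submodule.span ℂ⟦X⟧ (Set.range (v y)) := fun y hy => by
    have hspan_smul := (canonicalMatrix_eq lam1 (g y) ▸ hmat y).span_iterates_smul_eq (hli y hy)
      (s := 1) (fun i => by simp [isUnit_iff_constantCoeff]) isUnit_one
    rwa [one_smul] at hspan_smul
  refine ⟨Set.univ, isOpen_univ, Set.mem_univ _, fun y => v y 3,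
    isThematicOn_of_span_eq hli hva (hself 3) hspan fun i => hv ▸ hPhol i 3,
    fun y => (P y).mulVecLin, fun y hy => ⟨?_, ?_, ?_⟩, ?_⟩
  · exact Matrix.mulVec_injective_of_det_ne_zero (hP y).2
  · exact fun v => ((hP y).1.abAct_mulVec v).symm
  · exact (Matrix.range_mulVecLin _).trans (hv ▸ (hspan y hy).symm)
  · rintro h rfl (j : Fin 4)
    have hcol (y : Y) : (P y).mulVec (Pi.basisFun ℂ⟦X⟧ (Fin 4) j) = v y j := by
      rw [hv, Pi.basisFun_apply, Matrix.mulVec_single_one]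
    refine HolCombOn.mono ?_ Set.inter_subset_left
    exact (funext hcol ▸ HolCombOn.iterates_of_span_eq hli hva (hself 3) hspan j :)

end Families

/-! ### Holomorphic normal forms -/

section Leading

variable {R : Type*} [CommRing R] {k : ℕ} {i j : Fin (k + 1)} {c : Fin (k + 1) → R⟦X⟧}

/-- The coordinates `c` are those of a vector of the `j`-th step of a flag which generates it
modulo the preceding step. -/
def LeadsAt (j : Fin (k + 1)) (c : Fin (k + 1) → R⟦X⟧) : Prop :=
  (∀ i, j < i → c i = 0) ∧ IsUnit (c j)

theorem LeadsAt.smul (h : LeadsAt j c) {s : R⟦X⟧} (hs : IsUnit s) : LeadsAt j (s • c) :=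
  ⟨fun i hi => by rw [Pi.smul_apply, h.1 i hi, smul_zero], hs.mul h.2⟩

theorem mulVec_apply_of_isUpperTriangular {S ι : Type*} [CommRing S] [Fintype ι] [LinearOrder ι]
    {P : Matrix ι ι S} (hP : P.IsUpperTriangular) {i : ι} {v : ι → S}
    (hv : ∀ k, i < k → v k = 0) : P.mulVec v i = P i i * v i := by
  refine Finset.sum_eq_single i (fun q _ hq => ?_) (by simp)
  obtain hq | hq := hq.lt_or_gt
  · exact mul_eq_zero_of_left (hP hq) _
  · exact mul_eq_zero_of_right _ (hv q hq)

variable {T : Matrix (Fin (k + 1)) (Fin (k + 1)) R⟦X⟧}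

theorem abAct_sub_smul_apply_eq_zero (hT : T.IsUpperTriangular) (hc : ∀ i, j < i → c i = 0)
    {κ : R} (hcj : c j = C κ) (hij : j ≤ i) : (abAct T c - T j j • c) i = 0 := by
  rw [Pi.sub_apply, abAct, Pi.add_apply, mulVec_apply_of_isUpperTriangular hT
    fun q hq => hc q (hij.trans_lt hq)]
  obtain rfl | hij := hij.eq_or_lt
  · simp [hcj]
  · simp [hc i hij]

theorem LeadsAt.abAct_sub_smul {j : Fin k} (hT : T.IsUpperTriangular)
    (hdiag : ∀ i, constantCoeff (T i i) = 0) (hTj : IsUnit (T j.castSucc j.succ))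
    (hc : LeadsAt j.succ c) {κ : R} (hcj : c j.succ = C κ) :
    LeadsAt j.castSucc (abAct T c - T j.succ j.succ • c) := by
  refine ⟨fun i hi => abAct_sub_smul_apply_eq_zero hT hc.1 hcj (Fin.castSucc_lt_iff_succ_le.1 hi),
    ?_⟩
  rw [isUnit_iff_constantCoeff] at hTj ⊢
  have hsum : constantCoeff (abAct T c j.castSucc) =
      constantCoeff (T j.castSucc j.succ) * constantCoeff (c j.succ) := by
    rw [constantCoeff_abAct]
    refine Finset.sum_eq_single j.succ (fun q _ hq => ?_) fun h => absurd (Finset.mem_univ _) h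
    change constantCoeff (T _ q) * constantCoeff (c q) = 0
    obtain hq | hq := hq.lt_or_gt
    · obtain rfl | hq := (Fin.le_castSucc_iff.2 hq).eq_or_lt
      · rw [hdiag, zero_mul]
      · rw [show T j.castSucc q = 0 from hT hq, map_zero, zero_mul]
    · rw [hc.1 q hq, map_zero, mul_zero]
  rw [Pi.sub_apply, map_sub, hsum, Pi.smul_apply, smul_eq_mul, map_mul, hdiag, zero_mul, sub_zero]
  exact hTj.mul (isUnit_iff_constantCoeff.1 hc.2)

end Leading

section TriangularBasis

theorem Intertwines.eq_zero_and_eq_C_mul_X_pow {R : Type*} [CommRing R] [IsAddTorsionFree R]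
    {μ : R} {N : ℕ} {n : Fin (N + 1) → ℕ} {P T : Matrix (Fin (N + 1)) (Fin (N + 1)) R⟦X⟧}
    (h : Intertwines (xiMatrix μ N) T P) (hT : T.IsUpperTriangular)
    (hdiag : ∀ j, T j j = C (μ + n j) * X) (j : Fin (N + 1)) :
    (∀ i, j < i → P i j = 0) ∧ P j j = C (coeff (n j) (P j j)) * X ^ n j := by
  induction j using WellFoundedLT.induction with
  | ind j ih =>
    obtain ⟨v, hv⟩ : ∃ v : ℕ → R⟦X⟧, v = fun i => if hi : i < N + 1 then P ⟨i, hi⟩ j else 0 :=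
      ⟨_, rfl⟩
    have hvP (i : Fin (N + 1)) : v i = P i j := hv ▸ dif_pos i.2
    have hv_vanish (i : ℕ) (hi : N < i) : v i = 0 := hv ▸ dif_neg (by omega)
    have hsol (i : ℕ) (hi : j ≤ i) : X * v (i + 1) + eulerOp (n j) (v i) = 0 := by
      obtain hiN | hiN := lt_or_ge N i
      · simp [hv_vanish i hiN, hv_vanish (i + 1) (by omega), eulerOp]
      obtain ⟨i, rfl⟩ : ∃ i' : Fin (N + 1), (i' : ℕ) = i := ⟨⟨i, by omega⟩, rfl⟩
      have hPT : (P * T) i j = T j j * P i j := by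
        rw [Matrix.mul_apply, Finset.sum_eq_single j _ (by simp), mul_comm]
        intro q _ hq
        obtain hq | hq := hq.lt_or_gt
        · rw [(ih q hq).1 i (hq.trans_le hi), zero_mul]
        · rw [hT hq, mul_zero]
      have hcol : abAct (xiMatrix μ N) (fun i => v i) i = (P * T) i j := by
        simp only [hvP]
        exact congrFun (congrFun h i) j
      rw [abAct_xiMatrix μ N (n j) (hv_vanish _ N.lt_succ_self), hPT, hdiag, hvP] at hcol
      rw [hvP]
      exact left_eq_add.1 hcol.symm
    have hvj := eq_zero_of_mul_add_eulerOp_eq hsol hv_vanish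
    refine ⟨fun i hi => hvP i ▸ hvj i hi, ?_⟩
    have hker := hsol j le_rfl
    rw [hvj _ (Nat.lt_succ_self _), mul_zero, zero_add, hvP] at hker
    exact eq_C_mul_X_pow_of_eulerOp_eq_zero hker

variable {N : ℕ}

/-- The columns of `P` are a basis of a submodule of `Ξ_μ^{(N)}` of maximal rank, on which `a` acts
by the triangular matrix `T`, and which is generated by a single vector over `ℂ[[b]]` and `a`. -/
structure IsTriangularBasis (μ : ℂ) (n : Fin (N + 1) → ℕ)
    (P T : Matrix (Fin (N + 1)) (Fin (N + 1)) ℂ⟦X⟧) : Prop where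
  intertwines : Intertwines (xiMatrix μ N) T P
  det_ne_zero : P.det ≠ 0
  isUpperTriangular : T.IsUpperTriangular
  apply_self : ∀ j, T j j = C (μ + n j) * X
  isUnit_apply_succ : ∀ j : Fin N, IsUnit (T j.castSucc j.succ)

variable {μ : ℂ} {n : Fin (N + 1) → ℕ} {P T : Matrix (Fin (N + 1)) (Fin (N + 1)) ℂ⟦X⟧}

theorem IsTriangularBasis.isUpperTriangular_left (h : IsTriangularBasis μ n P T) :
    P.IsUpperTriangular := fun i j hij =>
  (h.intertwines.eq_zero_and_eq_C_mul_X_pow h.isUpperTriangular h.apply_self j).1 i hij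

theorem IsTriangularBasis.exists_apply_self_eq (h : IsTriangularBasis μ n P T)
    (j : Fin (N + 1)) : ∃ κ, κ ≠ 0 ∧ P j j = C κ * X ^ n j := by
  have hPj :=
    (h.intertwines.eq_zero_and_eq_C_mul_X_pow h.isUpperTriangular h.apply_self j).2
  refine ⟨_, fun hκ => h.det_ne_zero ?_, hPj⟩
  rw [hκ, map_zero, zero_mul] at hPj
  rw [Matrix.det_of_isUpperTriangular h.isUpperTriangular_left]
  exact Finset.prod_eq_zero (Finset.mem_univ j) hPj

theorem IsTriangularBasis.constantCoeff_apply_self (h : IsTriangularBasis μ n P T)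
    (j : Fin (N + 1)) : constantCoeff (T j j) = 0 := by
  rw [h.apply_self, map_mul, constantCoeff_X, mul_zero]

theorem HasInvariants.exists_hasMatrix {lam1 : ℚ} {r : ℕ} {p : Fin r → ℕ} {E : ABModule}
    (h : HasInvariants lam1 p E) :
    ∃ (e : Module.Basis (Fin (r + 1)) ℂ⟦X⟧ E) (T : Matrix (Fin (r + 1)) (Fin (r + 1)) ℂ⟦X⟧),
      HasMatrix E e T ∧ T.IsUpperTriangular ∧ ∀ j, T j j = C (exponent lam1 p j : ℂ) * X := by
  obtain ⟨e, he⟩ := h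
  have hrepr (i j : Fin (r + 1)) (hij : j ≤ i) : e.repr (E.a (e j)) i =
      if i = j then C (exponent lam1 p j : ℂ) * X else 0 := by
    have hmem := e.mem_span_image.1 (he j)
    have hzero : e.repr (E.a (e j) - (C (exponent lam1 p j : ℂ) * X) • e j) i = 0 := by
      by_contra hne
      exact (not_lt.2 hij) (hmem (Finsupp.mem_support_iff.2 hne))
    rw [map_sub, map_smul, e.repr_self, Finsupp.sub_apply, sub_eq_zero] at hzero
    rw [hzero]
    obtain rfl | hne := eq_or_ne i j <;> simp [*]
  refine ⟨e, Matrix.of fun i j => e.repr (E.a (e j)) i, fun j => (e.sum_repr _).symm,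
    fun i j hij => ?_, fun j => ?_⟩
  · exact (hrepr i j (le_of_lt hij)).trans (if_neg (ne_of_gt hij))
  · exact (hrepr j j le_rfl).trans (if_pos rfl)

end TriangularBasis

section Normalization

open holRing

variable {Y : ReducedComplexSpace} {U : Set Y} {N : ℕ} {μ : ℂ} {n : Fin (N + 1) → ℕ}

theorem IsTriangularBasis.evalSeries_abAct_sub_smul {P T : Matrix (Fin (N + 1)) (Fin (N + 1)) ℂ⟦X⟧}
    (h : IsTriangularBasis μ n P T) {u : U} {w : Fin (N + 1) → (holRing Y U)⟦X⟧}
    {c : Fin (N + 1) → ℂ⟦X⟧} (hw : (fun i => evalSeries u (w i)) = P.mulVec c)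
    (j : Fin (N + 1)) :
    (fun i => evalSeries u ((abAct (xiMatrix (algebraMap ℂ (holRing Y U) μ) N) w -
      (C (algebraMap ℂ (holRing Y U) μ + n j) * X) • w) i)) =
      P.mulVec (abAct T c - T j j • c) := by
  have hT : evalSeries u (C (algebraMap ℂ (holRing Y U) μ + n j) * X) = T j j := by
    rw [h.apply_self, evalSeries, map_mul, map_C, map_X, map_add, map_natCast, RingHom.coe_coe,
      AlgHom.commutes, Algebra.algebraMap_self_apply]
  have hxi : (xiMatrix (algebraMap ℂ (holRing Y U) μ) N).map (evalSeries u) = xiMatrix μ N := by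
    rw [evalSeries, xiMatrix_map, RingHom.coe_coe, AlgHom.commutes, Algebra.algebraMap_self_apply]
  rw [Matrix.mulVec_sub, Matrix.mulVec_smul, ← h.intertwines.abAct_mulVec, ← hw]
  ext1 i
  rw [Pi.sub_apply, Pi.smul_apply, smul_eq_mul, map_sub, map_mul, hT, evalSeries_abAct, hxi]
  rfl

variable {P T : U → Matrix (Fin (N + 1)) (Fin (N + 1)) ℂ⟦X⟧}

theorem exists_normalized (hP : ∀ u, IsTriangularBasis μ n (P u) (T u)) {j : Fin (N + 1)}
    {x : Fin (N + 1) → (holRing Y U)⟦X⟧}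
    (hx : ∀ u, ∃ c, LeadsAt j c ∧ (fun i => evalSeries u (x i)) = (P u).mulVec c) :
    ∃ (S : (holRing Y U)⟦X⟧) (w : Fin (N + 1) → (holRing Y U)⟦X⟧), constantCoeff S = 1 ∧
      x = S • w ∧ ∀ u, ∃ c κ, LeadsAt j c ∧ c j = C κ ∧
        (fun i => evalSeries u (w i)) = (P u).mulVec c := by
  choose c hc hxc using hx
  choose κ hκ hPj using fun u => (hP u).exists_apply_self_eq j
  have hxj (u : U) : evalSeries u (x j) = X ^ n j * (C (κ u) * c u j) := by
    rw [congrFun (hxc u) j, mulVec_apply_of_isUpperTriangular (hP u).isUpperTriangular_left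
      (hc u).1, hPj]
    ring
  obtain ⟨s, hs⟩ : X ^ n j ∣ x j := X_pow_dvd_iff.2 fun m hm => ext_eval fun u => by
    rw [← coeff_evalSeries, hxj, map_zero, X_pow_dvd_iff.1 (dvd_mul_right _ _) m hm]
  have hsc (u : U) : evalSeries u s = C (κ u) * c u j := by
    refine mul_left_cancel₀ (pow_ne_zero (n j) (X_ne_zero (R := ℂ))) ?_
    rw [← hxj, hs, map_mul, map_pow, evalSeries, map_X]
  have hsu : IsUnit s := isUnit_iff_evalSeries.2 fun u =>
    hsc u ▸ ((hκ u).isUnit.map C).mul (hc u).2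
  obtain ⟨k, hk⟩ := isUnit_iff_constantCoeff.1 hsu
  obtain ⟨S, hS⟩ := ((k⁻¹).isUnit.map C).mul hsu
  have hSs : s = C (k : holRing Y U) * S := by
    rw [hS, ← mul_assoc, ← map_mul, Units.mul_inv, map_one, one_mul]
  refine ⟨S, (↑S⁻¹ : (holRing Y U)⟦X⟧) • x, ?_, ?_, fun u => ⟨evalSeries u ↑S⁻¹ • c u,
    (κ u)⁻¹ * eval u k, (hc u).smul (S⁻¹.isUnit.map _), ?_, ?_⟩⟩
  · rw [hS, map_mul, constantCoeff_C, ← hk, Units.inv_mul]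
  · rw [smul_smul, Units.mul_inv, one_smul]
  · have hcj : c u j = C (κ u)⁻¹ * evalSeries u s := by
      rw [hsc, ← mul_assoc, ← map_mul, inv_mul_cancel₀ (hκ u), map_one, one_mul]
    rw [Pi.smul_apply, smul_eq_mul, hcj, hSs, map_mul, mul_left_comm,
      mul_left_comm _ _ (evalSeries u S), ← map_mul, Units.inv_mul, map_one, mul_one,
      evalSeries, map_C, ← map_mul]
    rfl
  · rw [Matrix.mulVec_smul, ← hxc]
    exact funext fun i => map_mul _ _ _

theorem exists_normalized_castSucc (hP : ∀ u, IsTriangularBasis μ n (P u) (T u)) (j : Fin N)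
    {w : Fin (N + 1) → (holRing Y U)⟦X⟧}
    (hw : ∀ u, ∃ c κ, LeadsAt j.succ c ∧ c j.succ = C κ ∧
      (fun i => evalSeries u (w i)) = (P u).mulVec c) :
    ∃ (S : (holRing Y U)⟦X⟧) (w' : Fin (N + 1) → (holRing Y U)⟦X⟧), constantCoeff S = 1 ∧
      abAct (xiMatrix (algebraMap ℂ (holRing Y U) μ) N) w =
        (C (algebraMap ℂ (holRing Y U) μ + n j.succ) * X) • w + S • w' ∧
      ∀ u, ∃ c κ, LeadsAt j.castSucc c ∧ c j.castSucc = C κ ∧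
        (fun i => evalSeries u (w' i)) = (P u).mulVec c := by
  obtain ⟨S, w', hS, hw', hnorm⟩ := exists_normalized hP (j := j.castSucc)
    (x := abAct (xiMatrix (algebraMap ℂ (holRing Y U) μ) N) w -
      (C (algebraMap ℂ (holRing Y U) μ + n j.succ) * X) • w) fun u => by
      obtain ⟨c, κ, hc, hcj, hwc⟩ := hw u
      exact ⟨_, hc.abAct_sub_smul (hP u).isUpperTriangular (hP u).constantCoeff_apply_self
        ((hP u).isUnit_apply_succ j) hcj, (hP u).evalSeries_abAct_sub_smul hwc j.succ⟩
  exact ⟨S, w', hS, sub_eq_iff_eq_add'.1 hw', hnorm⟩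

theorem abAct_xiMatrix_eq_smul_of_normalized (hP : ∀ u, IsTriangularBasis μ n (P u) (T u))
    {w : Fin (N + 1) → (holRing Y U)⟦X⟧}
    (hw : ∀ u, ∃ c κ, LeadsAt 0 c ∧ c 0 = C κ ∧ (fun i => evalSeries u (w i)) = (P u).mulVec c) :
    abAct (xiMatrix (algebraMap ℂ (holRing Y U) μ) N) w =
      (C (algebraMap ℂ (holRing Y U) μ + n 0) * X) • w := by
  rw [← sub_eq_zero]
  ext1 i
  refine PowerSeries.ext fun m => ext_eval fun u => ?_
  obtain ⟨c, κ, hc, hc₀, hwc⟩ := hw u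
  have hzero : abAct (T u) c - T u 0 0 • c = 0 := funext fun i =>
    abAct_sub_smul_apply_eq_zero (hP u).isUpperTriangular hc.1 hc₀ (Fin.zero_le i)
  have heval := congrFun ((hP u).evalSeries_abAct_sub_smul hwc 0) i
  rw [hzero, Matrix.mulVec_zero] at heval
  rw [← coeff_evalSeries, heval]
  simp

end Normalization

section NormalForm

open holRing

theorem HasMatrix.linearIndependent_of_iterates {k : ℕ} {E : ABModule} {w : Fin k → E}
    {M : Matrix (Fin k) (Fin k) ℂ⟦X⟧} (h : HasMatrix E w M) {x : E}
    (hx : x ∈ Submodule.span ℂ⟦X⟧ (Set.range w))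
    (hli : LinearIndependent ℂ⟦X⟧ fun i : Fin k => E.a^[i] x) : LinearIndependent ℂ⟦X⟧ w := by
  obtain ⟨c, rfl⟩ := (Submodule.mem_span_range_iff_exists_fun _).1 hx
  rw [linearIndependent_iff_card_le_finrank_span, Set.finrank, ← finrank_span_eq_card hli]
  refine Submodule.finrank_mono (Submodule.span_le.2 ?_)
  rintro - ⟨i, rfl⟩
  change E.a^[i] (∑ j, c j • w j) ∈ _
  rw [h.iterate_a_sum_smul]
  exact Submodule.sum_mem _ fun j _ =>
    Submodule.smul_mem _ _ (Submodule.subset_span (Set.mem_range_self j))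

variable {lam1 : ℚ} {N : ℕ}

theorem HasInvariants.exists_isTriangularBasis (hN : lam1 = residue lam1 + N) {E : ABModule}
    (hE : HasInvariants (r := 3) lam1 ![3, 2, 2] E) {θ : E →ₗ[ℂ⟦X⟧] Xi (residue lam1) 3}
    (hθ : Function.Injective θ) (hθa : ∀ v, θ (E.a v) = (Xi (residue lam1) 3).a (θ v))
    {φ : Xi (residue lam1) 3} (hφ : LinearMap.range θ =
      Submodule.span ℂ⟦X⟧ (Set.range fun i : Fin 4 => (Xi (residue lam1) 3).a^[i] φ)) :
    ∃ P T c, IsTriangularBasis (residue lam1 : ℂ) (fun j => N + ![0, 2, 3, 4] j) P T ∧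
      IsUnit (c 3) ∧ φ = P.mulVec c := by
  obtain ⟨e, T, heT, hT, hTjj⟩ := hE.exists_hasMatrix
  obtain ⟨w, hw⟩ : ∃ w : Fin 4 → Xi (residue lam1) 3, w = fun j => θ (e j) := ⟨_, rfl⟩
  have hli : LinearIndependent ℂ⟦X⟧ w :=
    hw ▸ e.linearIndependent.map' θ (LinearMap.ker_eq_bot.2 hθ)
  have hrange : LinearMap.range θ = Submodule.span ℂ⟦X⟧ (Set.range w) := by
    rw [LinearMap.range_eq_map, ← e.span_eq, Submodule.map_span, ← Set.range_comp, hw]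
    rfl
  have hwT : HasMatrix _ w T := fun j => by
    simp only [hw, ← hθa, heT j, map_sum, map_smul]
  have hTdiag (j : Fin 4) : T j j = C ((residue lam1 : ℂ) + (N + ![0, 2, 3, 4] j : ℕ)) * X := by
    have hN' : (lam1 : ℂ) = (residue lam1 : ℂ) + N := by
      exact_mod_cast congrArg (Rat.cast : ℚ → ℂ) hN
    rw [hTjj, exponent_eq, Rat.cast_add, hN', add_assoc]
    fin_cases j <;> simp
  obtain ⟨c, rfl⟩ : ∃ c : Fin 4 → ℂ⟦X⟧, ∑ j, c j • w j = φ := by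
    rw [← Submodule.mem_span_range_iff_exists_fun, ← hrange, hφ]
    exact Submodule.subset_span ⟨0, rfl⟩
  obtain ⟨h₀₁, h₁₂, h₂₃, hc⟩ := (hwT.span_iterates_eq_iff hli hT
    (fun j => by rw [hTdiag, map_mul, constantCoeff_X, mul_zero]) c).1 (hφ.symm.trans hrange)
  have hmulVec (v : Fin 4 → ℂ⟦X⟧) : (Matrix.of fun i j => w j i).mulVec v = ∑ j, v j • w j :=
    (Matrix.mulVec_eq_sum _ _).trans (by simp only [op_smul_eq_smul]; rfl)
  refine ⟨Matrix.of fun i j => w j i, T, c, ⟨hasMatrix_col_iff.1 hwT, fun hdet => ?_, hT, hTdiag,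
    fun j => ?_⟩, hc, ?_⟩
  · obtain ⟨v, hv, hv₀⟩ := Matrix.exists_mulVec_eq_zero_iff.2 hdet
    rw [hmulVec] at hv₀
    exact hv (funext (Fintype.linearIndependent_iff.1 hli v hv₀))
  · fin_cases j
    exacts [h₀₁, h₁₂, h₂₃]
  · exact (hmulVec c).symm

variable {Y : ReducedComplexSpace} {U : Set Y}

theorem exists_intertwines_of_isTriangularBasis {μ : ℂ} {φ : Fin 4 → (holRing Y U)⟦X⟧}
    (hφ : ∀ u, ∃ P T c, IsTriangularBasis μ (fun j => N + ![0, 2, 3, 4] j) P T ∧ IsUnit (c 3) ∧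
      (fun i => evalSeries u (φ i)) = P.mulVec c) :
    ∃ (S : Fin 3 → (holRing Y U)⟦X⟧) (Q : Matrix (Fin 4) (Fin 4) (holRing Y U)⟦X⟧)
      (s : (holRing Y U)⟦X⟧),
      Intertwines (xiMatrix (algebraMap ℂ (holRing Y U) μ) 3)
        (themeMatrix (algebraMap ℂ (holRing Y U) μ + N) S) Q ∧
      (∀ i, constantCoeff (S i) = 1) ∧ constantCoeff s = 1 ∧ φ = s • Q.col 3 := by
  choose P T c hP hc hφc using hφ
  obtain ⟨s, w₃, hs, hφs, hw₃⟩ := exists_normalized hP (j := 3) (x := φ) fun u =>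
    ⟨c u, ⟨fun i hi => absurd hi (not_lt.2 (Fin.le_last i)), hc u⟩, hφc u⟩
  obtain ⟨S₂, w₂, hS₂, ha₃, hw₂⟩ := exists_normalized_castSucc hP 2 hw₃
  obtain ⟨S₁, w₁, hS₁, ha₂, hw₁⟩ := exists_normalized_castSucc hP 1 hw₂
  obtain ⟨S₀, w₀, hS₀, ha₁, hw₀⟩ := exists_normalized_castSucc hP 0 hw₁
  have ha₀ := abAct_xiMatrix_eq_smul_of_normalized hP hw₀
  refine ⟨![S₀, S₁, S₂], Matrix.of fun i j => ![w₀, w₁, w₂, w₃] j i, s,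
    intertwines_themeMatrix_of (w := ![w₀, w₁, w₂, w₃]) (ha₀.trans ?_) (ha₁.trans ?_)
      (ha₂.trans ?_) (ha₃.trans ?_), fun i => ?_, hs, hφs⟩
  · simp
  · simp [add_assoc]
  · simp [add_assoc]
  · simp [add_assoc]
  · fin_cases i
    exacts [hS₀, hS₁, hS₂]

theorem seriesHolOn_themeMatrix (l : ℂ) {S : Fin 3 → Y → ℂ⟦X⟧} (hS : ∀ i, SeriesHolOn (S i) U)
    (i j : Fin 4) : SeriesHolOn (fun y => themeMatrix l (S · y) i j) U := by
  fin_cases i <;> fin_cases j <;>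
    first | exact fun _ y _ => holAt_const _ y | exact hS _

variable {φ : Y → Xi (residue lam1) 3}

theorem exists_holomorphic_frame_smul_eq (hN : lam1 = residue lam1 + N)
    (hφhol : ∀ i, SeriesHolOn (fun y => Xi.coord _ _ (φ y) i) U)
    (hbasis : ∀ y ∈ U, ∃ P T c, IsTriangularBasis (residue lam1 : ℂ)
      (fun j => N + ![0, 2, 3, 4] j) P T ∧ IsUnit (c 3) ∧ φ y = P.mulVec c) :
    ∃ (S : Fin 3 → Y → ℂ⟦X⟧) (s : Y → ℂ⟦X⟧) (v : Y → Fin 4 → Xi (residue lam1) 3),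
      (∀ i, SeriesHolOn (S i) U) ∧ SeriesHolOn s U ∧
      ∀ y ∈ U, (∀ i, constantCoeff (S i y) = 1) ∧ constantCoeff (s y) = 1 ∧
        HasMatrix _ (v y) (themeMatrix (lam1 : ℂ) (S · y)) ∧ φ y = s y • v y 3 := by
  obtain ⟨T, Q, t, hTQ, hT, ht, hφQ⟩ := exists_intertwines_of_isTriangularBasis
    (φ := fun i => seriesOfHolOn _ (hφhol i)) fun u => by
      simp only [evalSeries_seriesOfHolOn]
      exact hbasis u u.2
  choose S hS hTS using fun i => exists_seriesHolOn_evalSeries_eq (T i)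
  obtain ⟨s, hs, hts⟩ := exists_seriesHolOn_evalSeries_eq t
  choose q _ hQq using fun j i => exists_seriesHolOn_evalSeries_eq (Q i j)
  obtain ⟨v, hv⟩ : ∃ v : Y → Fin 4 → Xi (residue lam1) 3, v = fun y j i => q j i y := ⟨_, rfl⟩
  refine ⟨S, s, v, hS, hs, fun y hy => ?_⟩
  obtain ⟨u, rfl⟩ : ∃ u : U, (u : Y) = y := ⟨⟨y, hy⟩, rfl⟩
  have hvQ : v u = (Q.map (evalSeries u)).col :=
    hv ▸ funext fun j => funext fun i => (hQq j i u).symm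
  have constantCoeff_eq {x : (holRing Y U)⟦X⟧} (hx : constantCoeff x = 1) :
      constantCoeff (evalSeries u x) = 1 := by
    rw [← coeff_zero_eq_constantCoeff_apply, coeff_evalSeries, coeff_zero_eq_constantCoeff_apply,
      hx, map_one]
  refine ⟨fun i => hTS i u ▸ constantCoeff_eq (hT i), hts u ▸ constantCoeff_eq ht, ?_, ?_⟩
  · have hN' : (lam1 : ℂ) = (residue lam1 : ℂ) + N := by
      exact_mod_cast congrArg (Rat.cast : ℚ → ℂ) hN
    have hxi := xiMatrix_map (eval u : holRing Y U →+* ℂ) (algebraMap ℂ _ (residue lam1)) 3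
    have htheme := themeMatrix_map (eval u : holRing Y U →+* ℂ)
      (algebraMap ℂ _ (residue lam1) + N) T
    simp only [map_add, map_natCast, RingHom.coe_coe, AlgHom.commutes] at hxi htheme
    rw [hvQ]
    refine hasMatrix_col_iff.2 (Eq.mp ?_ (hTQ.map (eval u : holRing Y U →+* ℂ)))
    refine congrArg₂ (Intertwines · · _) hxi (htheme.trans ?_)
    rw [hN', ← funext fun i => hTS i u]
    rfl
  · refine hv ▸ funext fun i => (evalSeries_seriesOfHolOn _ (hφhol i) u).symm.trans ?_
    refine (congrArg (evalSeries u) (congrFun hφQ i)).trans ((map_mul _ _ _).trans ?_)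
    exact congrArg₂ (· * ·) (hts u) (hQq 3 i u)

theorem IsThematicOn.exists_holomorphic_frame (hφ : IsThematicOn 4 U φ)
    (hN : lam1 = residue lam1 + N)
    (hbasis : ∀ y ∈ U, ∃ P T c, IsTriangularBasis (residue lam1 : ℂ)
      (fun j => N + ![0, 2, 3, 4] j) P T ∧ IsUnit (c 3) ∧ φ y = P.mulVec c) :
    ∃ (S : Fin 3 → Y → ℂ⟦X⟧) (v : Y → Fin 4 → Xi (residue lam1) 3),
      (∀ i, SeriesHolOn (S i) U) ∧ (∀ y ∈ U, ∀ i, constantCoeff (S i y) = 1) ∧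
      (∀ y ∈ U, HasMatrix _ (v y) (themeMatrix (lam1 : ℂ) (S · y)) ∧
        LinearIndependent ℂ⟦X⟧ (v y) ∧ Submodule.span ℂ⟦X⟧ (Set.range (v y)) =
          Submodule.span ℂ⟦X⟧ (Set.range (iterates 4 φ y))) ∧
      ∀ j, HolCombOn (M := fun _ => Xi (residue lam1) 3) U (iterates 4 φ) fun y => v y j := by
  obtain ⟨hφhol, hφli, -⟩ := hφ
  obtain ⟨S, s, v, hS, hs, hv⟩ := exists_holomorphic_frame_smul_eq hN hφhol hbasis
  choose! hS₁ hs₁ hvS hφv using hv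
  have hli (y : Y) (hy : y ∈ U) : LinearIndependent ℂ⟦X⟧ (v y) :=
    (hvS y hy).linearIndependent_of_iterates (hφv y hy ▸ Submodule.smul_mem _ _
      (Submodule.subset_span (Set.mem_range_self 3))) (hφli y hy)
  have hspan (y : Y) (hy : y ∈ U) : Submodule.span ℂ⟦X⟧ (Set.range (iterates 4 φ y)) =
      Submodule.span ℂ⟦X⟧ (Set.range (v y)) := by
    have hspan_smul := (hvS y hy).span_iterates_smul_eq (hli y hy)
      (fun i => isUnit_iff_constantCoeff.2 (hS₁ y hy i ▸ isUnit_one))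
      (isUnit_iff_constantCoeff.2 (hs₁ y hy ▸ isUnit_one))
    rwa [← hφv y hy] at hspan_smul
  refine ⟨S, v, hS, hS₁, fun y hy => ⟨hvS y hy, hli y hy, (hspan y hy).symm⟩,
    HolCombOn.iterates_of_span_eq hli
      (fun j => ⟨_, fun i => seriesHolOn_themeMatrix _ hS i j, fun y hy => hvS y hy j⟩)
      ⟨Pi.single 3 s, fun i => ?_, fun y hy => ?_⟩ hspan⟩
  · rcases eq_or_ne i 3 with rfl | hi
    · rwa [Pi.single_eq_same]
    · rw [Pi.single_eq_of_ne hi]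
      exact fun _ y _ => holAt_const _ y
  · rw [Finset.sum_eq_single 3
      (fun i _ hi => by rw [Pi.single_eq_of_ne hi, Pi.zero_apply, zero_smul]) (by simp),
      Pi.single_eq_same, hφv y hy]

/-- The `E y` form a holomorphic frame of the family `H` on `U`, in which the matrix of `a` is
`M y`. -/
structure IsFrameOn {k : ℕ} (H : ABFamily Y) (U : Set Y) (E : ∀ y, Fin k → H.fiber y)
    (M : Y → Matrix (Fin k) (Fin k) ℂ⟦X⟧) : Prop where
  linearIndependent : ∀ y ∈ U, LinearIndependent ℂ⟦X⟧ (E y)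
  span_eq_top : ∀ y ∈ U, Submodule.span ℂ⟦X⟧ (Set.range (E y)) = ⊤
  hasMatrix : ∀ y ∈ U, HasMatrix (H.fiber y) (E y) (M y)
  holCombOn : ∀ h ∈ H.atlas, ∀ j,
    HolCombOn (M := fun y => H.fiber y) (U ∩ h.dom) h.vec fun y => E y j

theorem IsThemeFamily.exists_normal_form (hlam1 : 3 < lam1) {H : ABFamily Y}
    (hH : IsThemeFamily (r := 3) lam1 ![3, 2, 2] H) (y₀ : Y) :
    ∃ U : Set Y, IsOpen U ∧ y₀ ∈ U ∧ ∃ (S : Fin 3 → Y → ℂ⟦X⟧) (E : ∀ y, Fin 4 → H.fiber y),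
      (∀ i, SeriesHolOn (S i) U) ∧ (∀ y ∈ U, ∀ i, constantCoeff (S i y) = 1) ∧
      IsFrameOn H U E fun y => themeMatrix (lam1 : ℂ) (S · y) := by
  obtain ⟨N, hN⟩ := exists_residue_add hlam1
  obtain ⟨hinv, hloc⟩ := hH
  obtain ⟨U, hU, hy₀, φ, hφ, θ, hθ, hθh⟩ := hloc y₀
  choose hθinj hθa hθrange using hθ
  obtain ⟨S, v, hS, hS₁, hv, hvφ⟩ := hφ.exists_holomorphic_frame hN fun y hy =>
    (hinv y).exists_isTriangularBasis hN (hθinj y hy) (hθa y hy) (hθrange y hy)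
  have hvθ (y : Y) (j : Fin 4) : ∃ x : H.fiber y, y ∈ U → θ y x = v y j := by
    by_cases hy : y ∈ U
    · obtain ⟨x, hx⟩ := LinearMap.mem_range.1 <|
        ((hv y hy).2.2.trans (hθrange y hy).symm).le (Submodule.subset_span ⟨j, rfl⟩)
      exact ⟨x, fun _ => hx⟩
    · exact ⟨0, fun h => absurd h hy⟩
  choose E hE using hvθ
  have hEv {y : Y} (hy : y ∈ U) : θ y ∘ E y = v y := funext fun j => hE y j hy
  refine ⟨U, hU, hy₀, S, E, hS, hS₁, fun y hy => ?_, fun y hy => ?_, fun y hy j => ?_,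
    fun h hh j => ?_⟩
  · exact LinearIndependent.of_comp (θ y) (hEv hy ▸ (hv y hy).2.1)
  · refine Submodule.map_injective_of_injective (hθinj y hy) ?_
    rw [Submodule.map_span, ← Set.range_comp, Submodule.map_top, hθrange y hy, hEv hy]
    exact (hv y hy).2.2
  · refine hθinj y hy ((hθa y hy _).trans ?_)
    simp only [map_sum, map_smul, hE y _ hy]
    exact (hv y hy).1 j
  · have hφh (i : Fin 4) : HolCombOn (M := fun _ => Xi (residue lam1) 3) (U ∩ h.dom)
        (fun y i => θ y (h.vec y i)) fun y => iterates 4 φ y i :=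
      HolCombOn.symm (fun y hy => hφ.2.1 y hy.1)
        (fun y hy => (h.linearIndependent y hy.2).map' (θ y)
          (LinearMap.ker_eq_bot.2 (hθinj y hy.1)))
        (fun y hy => by
          rw [← hθrange y hy.1, LinearMap.range_eq_map, ← h.span_eq_top y hy.2,
            Submodule.map_span, ← Set.range_comp])
        (hθh h hh) i
    obtain ⟨c, hc, hcv⟩ := ((hvφ j).mono Set.inter_subset_left).trans hφh
    refine ⟨c, hc, fun y hy => hθinj y hy.1 ?_⟩
    simp only [map_sum, map_smul]
    exact (hE y j hy.1).trans (hcv y hy)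

end NormalForm

/-! ### Universality off the hyperplane -/

section HolomorphicMaps

variable {Y Z X : ReducedComplexSpace}

theorem HolAt.comp_map {f : Z → ℂ} {g : Y → Z} {V : Set Y} (hg : HolMapOn g V) {y : Y}
    (hy : y ∈ V) (hf : HolAt f (g y)) : HolAt (fun y' => f (g y')) y := by
  obtain ⟨c, hc, hx, F, hF, hfF⟩ := hf
  obtain ⟨hcont, hcoord⟩ := hg y hy
  exact (HolAt.comp_analyticAt (f := fun i y' => c.toFun (g y') i) (hcoord c hc hx) hF).congr
    (hcont.eventually hfF)

theorem HolMapOn.comp {f : Z → X} {g : Y → Z} {U : Set Z} {V : Set Y} (hf : HolMapOn f U)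
    (hg : HolMapOn g V) : HolMapOn (fun y => f (g y)) (V ∩ g ⁻¹' U) := fun y hy =>
  ⟨(hf (g y) hy.2).1.comp (hg y hy.1).1, fun c hc hx i =>
    HolAt.comp_map (f := fun z => c.toFun (f z) i) hg hy.1 ((hf (g y) hy.2).2 c hc hx i)⟩

variable {n : ℕ} {A : Set (Fin n → ℂ)}

theorem holMapOn_ofSet (hA : IsLocallyAnalytic A) {f : Y → A} {U : Set Y}
    (hf : ∀ i, HolOn (fun y => (f y).1 i) U) :
    HolMapOn (X := ReducedComplexSpace.ofSet A hA) f U := by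
  intro y hy
  refine ⟨Topology.IsInducing.subtypeVal.continuousAt_iff.2
    (continuousAt_pi.2 fun i => (hf i y hy).continuousAt), ?_⟩
  rintro c rfl - i
  exact hf i y hy

theorem holOn_ofSet (hA : IsLocallyAnalytic A) {F : (Fin n → ℂ) → ℂ}
    (hF : ∀ z, AnalyticAt ℂ F z) (U : Set (ReducedComplexSpace.ofSet A hA)) :
    HolOn (X := ReducedComplexSpace.ofSet A hA) (fun z : A => F z) U :=
  fun z _ => holAt_ofSet hA hF z

theorem analyticAt_coord (i : Fin n) (z : Fin n → ℂ) :
    AnalyticAt ℂ (fun z : Fin n → ℂ => z i) z :=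
  (ContinuousLinearMap.proj (R := ℂ) (φ := fun _ : Fin n => ℂ) i).analyticAt z

end HolomorphicMaps

section Pullback

open holRing

variable {X Y : ReducedComplexSpace} {H : ABFamily Y} {U V : Set Y} {k : ℕ}

theorem bijective_linearCombination {E : ABModule} {w : Fin k → E}
    (hli : LinearIndependent ℂ⟦X⟧ w) (hspan : Submodule.span ℂ⟦X⟧ (Set.range w) = ⊤) :
    Function.Bijective (Fintype.linearCombination ℂ⟦X⟧ w) :=
  ⟨hli.fintypeLinearCombination_injective,
    LinearMap.range_eq_top.1 ((Fintype.range_linearCombination ℂ⟦X⟧ w).trans hspan)⟩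

theorem HasMatrix.isomorphic_ofMatrix {E : ABModule} {w : Fin k → E}
    {M : Matrix (Fin k) (Fin k) ℂ⟦X⟧} (h : HasMatrix E w M) (hli : LinearIndependent ℂ⟦X⟧ w)
    (hspan : Submodule.span ℂ⟦X⟧ (Set.range w) = ⊤) : Isomorphic (ABModule.ofMatrix M) E :=
  ⟨LinearEquiv.ofBijective _ (bijective_linearCombination hli hspan),
    fun v => (h.a_sum_smul v).symm⟩

theorem PullbackIsoOn.isomorphic {f : Y → X} {E : ABFamily X} (h : PullbackIsoOn f U E H) {y : Y}
    (hy : y ∈ U) : Isomorphic (E.fiber (f y)) (H.fiber y) := by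
  obtain ⟨θ, hθ, -⟩ := h
  exact ⟨LinearEquiv.ofBijective (θ y) (hθ y hy).1, (hθ y hy).2⟩

theorem isFrameOn_ofMatrix {M : Y → Matrix (Fin k) (Fin k) ℂ⟦X⟧}
    (hM : ∀ i j, SeriesHolOn (fun y => M y i j) Set.univ) :
    IsFrameOn (ABFamily.ofMatrix Y M hM) Set.univ (fun _ => Pi.basisFun ℂ⟦X⟧ (Fin k)) M where
  linearIndependent := fun _ _ => (Pi.basisFun ℂ⟦X⟧ (Fin k)).linearIndependent
  span_eq_top := fun _ _ => (Pi.basisFun ℂ⟦X⟧ (Fin k)).span_eq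
  hasMatrix := fun y _ => ABModule.ofMatrix_a_basisFun (M y)
  holCombOn := by
    rintro _ rfl j
    exact holCombOn_self _ _ j

variable {M : Y → Matrix (Fin k) (Fin k) ℂ⟦X⟧} {E : ∀ y, Fin k → H.fiber y}

theorem IsFrameOn.mono (h : IsFrameOn H U E M) (hV : V ⊆ U) : IsFrameOn H V E M where
  linearIndependent := fun y hy => h.linearIndependent y (hV hy)
  span_eq_top := fun y hy => h.span_eq_top y (hV hy)
  hasMatrix := fun y hy => h.hasMatrix y (hV hy)
  holCombOn := fun e he j => (h.holCombOn e he j).mono (Set.inter_subset_inter_left _ hV)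

theorem IsFrameOn.pullbackIsoOn_ofMatrix (hE : IsFrameOn H U E M) (f : Y → X)
    {N : X → Matrix (Fin k) (Fin k) ℂ⟦X⟧} (hN : ∀ i j, SeriesHolOn (fun x => N x i j) Set.univ)
    {G : Matrix (Fin k) (Fin k) (holRing Y U)⟦X⟧} (hG : IsUnit G)
    (h : ∀ u : U, Intertwines (M u) (N (f u)) (G.map (evalSeries u))) :
    PullbackIsoOn f U (ABFamily.ofMatrix X N hN) H := by
  choose G' hG'hol hGG' using fun i j => exists_seriesHolOn_evalSeries_eq (G i j)
  have hG' (u : U) : G.map (evalSeries u) = Matrix.of fun i j => G' i j u :=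
    Matrix.ext fun i j => hGG' i j u
  refine ⟨fun y => Fintype.linearCombination ℂ⟦X⟧ (E y) ∘ₗ
    (Matrix.of fun i j => G' i j y).mulVecLin, fun y hy => ?_, ?_⟩
  · obtain ⟨u, rfl⟩ : ∃ u : U, (u : Y) = y := ⟨⟨y, hy⟩, rfl⟩
    have hunit : IsUnit (G.map (evalSeries u)) := hG.map (evalSeries u).mapMatrix
    rw [hG' u] at hunit
    refine ⟨(bijective_linearCombination (hE.linearIndependent u hy) (hE.span_eq_top u hy)).comp
      ⟨Matrix.mulVec_injective_of_isUnit hunit, Matrix.mulVec_surjective_iff_isUnit.2 hunit⟩,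
      fun v => ?_⟩
    have hact := (hG' u ▸ h u).abAct_mulVec v
    exact (congrArg (Fintype.linearCombination ℂ⟦X⟧ (E u)) hact).symm.trans
      ((hE.hasMatrix u hy).a_sum_smul _).symm
  · rintro _ rfl e he (j : Fin k)
    refine HolCombOn.mono (V := U ∩ e.dom) (HolCombOn.trans (w := E)
      ⟨fun i => G' i j, fun i m y hy => hG'hol i j m y hy.1, fun y _ => ?_⟩
      (hE.holCombOn e he)) fun y hy => ⟨hy.1.1, hy.2⟩
    change Fintype.linearCombination ℂ⟦X⟧ (E y) ((Matrix.of fun i j => G' i j y).mulVec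
      (Pi.basisFun ℂ⟦X⟧ (Fin k) j)) = _
    rw [Pi.basisFun_apply, Matrix.mulVec_single_one]
    rfl

end Pullback

section Universal

open holRing

variable {Y : ReducedComplexSpace} {H : ABFamily Y} {U : Set Y} {lam1 : ℚ} {ε₀ : ℂ}
  {S : Fin 3 → Y → ℂ⟦X⟧}

theorem canonicalParams_eq_eval (hS : ∀ i, SeriesHolOn (S i) U) (ε₀ : ℂ) (u : U) (i : Fin 6) :
    canonicalParams (S · u) ε₀ i = eval u
      (canonicalParams (fun j => seriesOfHolOn (S j) (hS j))
        (algebraMap ℂ (holRing Y U) ε₀) i) := by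
  have hmap := canonicalParams_map (eval u : holRing Y U →+* ℂ)
    (fun j => seriesOfHolOn (S j) (hS j)) (algebraMap ℂ (holRing Y U) ε₀) i
  simp only [RingHom.coe_coe, AlgHom.commutes] at hmap
  refine Eq.trans ?_ hmap
  exact congrArg (canonicalParams · ε₀ i)
    (funext fun j => (evalSeries_seriesOfHolOn (S j) (hS j) u).symm)

theorem holOn_canonicalParams (hU : IsOpen U) (hS : ∀ i, SeriesHolOn (S i) U) (ε₀ : ℂ)
    (i : Fin 6) : HolOn (fun y => canonicalParams (S · y) ε₀ i) U :=
  holOn_of_eval_eq hU _ fun u => (canonicalParams_eq_eval hS ε₀ u i).symm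

/-- The parameters `σ` for which the theme `E(σ)` is not invariant. -/
def stableParams : Set (Fin 6 → ℂ) := {σ | σ ∈ paramSpace ∧ 3 * σ 0 ≠ 5 * σ 2}

theorem isOpen_stableParams : IsOpen stableParams :=
  isOpen_paramSpace.inter (isOpen_ne_fun (by fun_prop) (by fun_prop))

theorem eq_of_isomorphic_of_mem_slice {W : Set (Fin 6 → ℂ)} {σ τ : Fin 6 → ℂ}
    (hσ : σ ∈ slice W ε₀) (hτ : τ ∈ slice W ε₀)
    (h : Isomorphic (canonicalTheme lam1 σ) (canonicalTheme lam1 τ)) : σ = τ := by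
  have hupdate := update_eq_of_isomorphic_canonicalTheme h ε₀
  rwa [← hσ.2, Function.update_eq_self, hσ.2, ← hτ.2, Function.update_eq_self] at hupdate

theorem isThemeFamily_canonicalFamily (hlam1 : 3 < lam1) {A : Set (Fin 6 → ℂ)}
    (hA : IsLocallyAnalytic A) (hp : A ⊆ paramSpace) :
    IsThemeFamily (r := 3) lam1 ![3, 2, 2] (canonicalFamily lam1 A hA) :=
  isThemeFamily_ofMatrix (Y := ReducedComplexSpace.ofSet A hA) hlam1 (g := fun σ : A => σ.1)
    (fun i => holOn_ofSet hA (analyticAt_coord i) _) (fun σ => hp σ.2)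
    (seriesHolOn_canonicalMatrix lam1 A hA)

theorem IsFrameOn.pullbackIsoOn_canonicalFamily {E : ∀ y, Fin 4 → H.fiber y}
    (hE : IsFrameOn H U E fun y => themeMatrix (lam1 : ℂ) (S · y))
    (hS : ∀ i, SeriesHolOn (S i) U) (hS₁ : ∀ y ∈ U, ∀ i, constantCoeff (S i y) = 1)
    {A : Set (Fin 6 → ℂ)} (hA : IsLocallyAnalytic A) {f : Y → A}
    (hf : ∀ y ∈ U, (f y).1 = canonicalParams (S · y) ε₀ ∧ (f y).1 ∈ stableParams) :
    PullbackIsoOn (X := ReducedComplexSpace.ofSet A hA) f U (canonicalFamily lam1 A hA) H := by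
  obtain ⟨T, hT⟩ : ∃ T : Fin 3 → (holRing Y U)⟦X⟧, T = fun i => seriesOfHolOn (S i) (hS i) :=
    ⟨_, rfl⟩
  obtain ⟨e, he⟩ : ∃ e, e = algebraMap ℂ (holRing Y U) ε₀ := ⟨_, rfl⟩
  have hTS (u : U) (i : Fin 3) : evalSeries u (T i) = S i u :=
    hT ▸ evalSeries_seriesOfHolOn _ (hS i) u
  have heval (u : U) (i : Fin 6) : eval u (canonicalParams T e i) = (f u).1 i := by
    rw [(hf u u.2).1, canonicalParams_eq_eval hS, hT, he]
  have hstable (u : U) :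
      ((f u).1 0 ≠ 0 ∧ (f u).1 2 ≠ 0) ∧ 3 * (f u).1 0 - 5 * (f u).1 2 ≠ 0 := by
    have hfu := (hf u u.2).2
    simp only [stableParams, paramSpace, Set.mem_ofPred_eq, mul_ne_zero_iff] at hfu
    exact ⟨hfu.1.1, sub_ne_zero.2 hfu.2⟩
  have hconst (i : Fin 3) : constantCoeff (T i) = 1 := ext_eval fun u => by
    rw [← coeff_zero_eq_constantCoeff_apply, ← coeff_evalSeries, hTS,
      coeff_zero_eq_constantCoeff_apply, hS₁ u u.2, map_one]
  obtain ⟨G, hG, h⟩ := exists_intertwines_canonicalParams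
    (algebraMap ℂ (holRing Y U) lam1) e hconst
    (isUnit_iff.2 fun u => (heval u 2).trans_ne (hstable u).1.2)
    (isUnit_iff.2 fun u => (heval u 0).trans_ne (hstable u).1.1)
    (isUnit_iff.2 fun u => by
      rw [map_sub, map_mul, map_mul, map_ofNat, map_ofNat]
      exact (congrArg₂ (3 * · - 5 * ·) (heval u 0) (heval u 2)).trans_ne (hstable u).2)
  refine hE.pullbackIsoOn_ofMatrix (X := ReducedComplexSpace.ofSet A hA) f _ hG fun u => ?_
  have hmap := themeMatrix_map (eval u : holRing Y U →+* ℂ) (algebraMap ℂ (holRing Y U) lam1)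
  simp only [RingHom.coe_coe, AlgHom.commutes, Algebra.algebraMap_self_apply] at hmap
  refine Eq.mp (congrArg₂ (Intertwines · · _) ?_ ?_) (h.map (eval u : holRing Y U →+* ℂ))
  · exact (hmap T).trans (congrArg _ (funext (hTS u)))
  · rw [canonicalMatrix_eq, ← funext (heval u)]
    exact (hmap _).trans (congrArg _ (funext fun i => canonicalEntries_map _ _ i))

theorem exists_classifies (hlam1 : 3 < lam1) {y₀ : Y}
    (hH : IsThemeFamily (r := 3) lam1 ![3, 2, 2] H) (τ : slice stableParams ε₀)
    (hτ : Isomorphic (H.fiber y₀) (canonicalTheme lam1 τ)) :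
    ∃ f : Y → slice stableParams ε₀,
      Classifies (X := ReducedComplexSpace.ofSet _ (isLocallyAnalytic_slice isOpen_stableParams ε₀))
        (canonicalFamily lam1 _ (isLocallyAnalytic_slice isOpen_stableParams ε₀)) τ H y₀ f := by
  obtain ⟨U, hU, hy₀, S, E, hS, hS₁, hE⟩ := hH.exists_normal_form hlam1 y₀
  obtain ⟨σ, hσ⟩ : ∃ σ, σ = fun y => canonicalParams (S · y) ε₀ := ⟨_, rfl⟩
  have hσhol (i : Fin 6) : HolOn (fun y => σ y i) U := hσ ▸ holOn_canonicalParams hU hS ε₀ i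
  have hσ₀ : σ y₀ = τ.1 := by
    have hiso := ((hE.hasMatrix y₀ hy₀).isomorphic_ofMatrix (hE.linearIndependent y₀ hy₀)
      (hE.span_eq_top y₀ hy₀)).trans hτ
    rw [canonicalTheme_eq] at hiso
    have hparams := canonicalParams_eq_of_isomorphic (hS₁ y₀ hy₀)
      (constantCoeff_canonicalEntries τ.1) hiso (τ.1 4)
    rw [canonicalParams_canonicalEntries, Function.update_eq_self, τ.2.2] at hparams
    exact hσ ▸ hparams
  have hσcont : ContinuousOn σ U := continuousOn_pi.2 fun i y hy =>
    (hσhol i y hy).continuousAt.continuousWithinAt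
  obtain ⟨V, hV, hy₀V, hVU, hVσ⟩ :
      ∃ V, IsOpen V ∧ y₀ ∈ V ∧ V ⊆ U ∧ ∀ y ∈ V, σ y ∈ stableParams :=
    ⟨_, hσcont.isOpen_inter_preimage hU isOpen_stableParams,
      ⟨hy₀, show σ y₀ ∈ stableParams from hσ₀ ▸ τ.2.1⟩, Set.inter_subset_left, fun _ hy => hy.2⟩
  have hf (y : Y) : ∃ x : slice stableParams ε₀, y ∈ V → x.1 = σ y := by
    by_cases hy : y ∈ V
    · exact ⟨⟨σ y, hVσ y hy, hσ ▸ rfl⟩, fun _ => rfl⟩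
    · exact ⟨τ, fun h => absurd h hy⟩
  choose f hf using hf
  refine ⟨f, Subtype.ext ((hf y₀ hy₀V).trans hσ₀), V, hV, hy₀V,
    holMapOn_ofSet _ fun i y hy => (hσhol i y (hVU hy)).congr ?_,
    (hE.mono hVU).pullbackIsoOn_canonicalFamily (fun i m y hy => hS i m y (hVU hy))
      (fun y hy => hS₁ y (hVU hy)) _ fun y hy => ⟨(hf y hy).trans (by rw [hσ]), (f y).2.1⟩⟩
  filter_upwards [hV.mem_nhds hy] with y' hy'
  rw [hf y' hy']

theorem isUniversalNear_slice (hlam1 : 3 < lam1) (ε₀ : ℂ) (τ : slice stableParams ε₀) :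
    IsUniversalNear (r := 3) (X := ReducedComplexSpace.ofSet _
      (isLocallyAnalytic_slice isOpen_stableParams ε₀)) lam1 ![3, 2, 2]
      (canonicalFamily lam1 _ (isLocallyAnalytic_slice isOpen_stableParams ε₀)) τ := by
  refine ⟨isThemeFamily_canonicalFamily hlam1 _ fun σ hσ => hσ.1.1, fun Y H y₀ hH hiso =>
    ⟨exists_classifies hlam1 hH τ hiso, ?_⟩⟩
  rintro f f' ⟨-, U, hU, hy₀, -, h⟩ ⟨-, U', hU', hy₀', -, h'⟩
  filter_upwards [hU.mem_nhds hy₀, hU'.mem_nhds hy₀'] with y hy hy'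
  exact Subtype.ext (eq_of_isomorphic_of_mem_slice (f y).2 (f' y).2
    ((h.isomorphic hy).trans (h'.isomorphic hy').symm))

end Universal

/-! ### The hyperplane `3 α = 5 γ` -/

section Composition

variable {X Y Z : ReducedComplexSpace} {E : ABFamily X} {F : ABFamily Z} {H : ABFamily Y}
  {f : Z → X} {g : Y → Z} {U : Set Z} {V : Set Y}

theorem PullbackIsoOn.comp (hg : HolMapOn g V) {e' : LocalFrame F.fiber} (he' : e' ∈ F.atlas)
    (hdom : e'.dom = Set.univ) (hE : PullbackIsoOn f U E F) (hF : PullbackIsoOn g V F H) :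
    PullbackIsoOn (fun y => f (g y)) (V ∩ g ⁻¹' U) E H := by
  obtain ⟨θ, hθ, hθhol⟩ := hE
  obtain ⟨η, hη, hηhol⟩ := hF
  refine ⟨fun y => (η y).comp (θ (g y)), fun y hy => ⟨(hη y hy.1).1.comp (hθ (g y) hy.2).1,
    fun v => (congrArg (η y) ((hθ (g y) hy.2).2 v)).trans ((hη y hy.1).2 _)⟩,
    fun e he h hh j => ?_⟩
  have hmem (z : Z) : z ∈ e'.dom := hdom ▸ trivial
  obtain ⟨S, hS, hSθ⟩ := hθhol e he e' he' j
  refine HolCombOn.trans (w := fun y i => η y (e'.vec (g y) i))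
    ⟨fun i y => S i (g y), fun i n y hy =>
      HolAt.comp_map hg hy.1.1.1 (hS i n (g y) ⟨⟨hy.1.1.2, hy.1.2⟩, hmem _⟩), fun y hy => ?_⟩
    fun i => (hηhol e' he' h hh i).mono fun y hy => ⟨⟨hy.1.1.1, hmem _⟩, hy.2⟩
  refine (congrArg (η y) (hSθ (g y) ⟨⟨hy.1.1.2, hy.1.2⟩, hmem _⟩)).trans ?_
  rw [map_sum]
  simp only [map_smul]

theorem Classifies.comp {x₀ : X} {y₀ : Y} {z₀ : Z} {e' : LocalFrame F.fiber} (he' : e' ∈ F.atlas)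
    (hdom : e'.dom = Set.univ) (hE : Classifies E x₀ F z₀ f) (hF : Classifies F z₀ H y₀ g) :
    Classifies E x₀ H y₀ fun y => f (g y) := by
  obtain ⟨hf₀, U, hU, hz₀, hf, hEf⟩ := hE
  obtain ⟨rfl, V, hV, hy₀, hg, hFg⟩ := hF
  have hgcont : ContinuousOn g V := fun y hy => (hg y hy).1.continuousWithinAt
  exact ⟨hf₀, V ∩ g ⁻¹' U, hgcont.isOpen_inter_preimage hV hU, ⟨hy₀, hz₀⟩, hf.comp hg,
    hEf.comp hg he' hdom hFg⟩

end Composition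

section Shift

open holRing

theorem pullbackIsoOn_canonicalFamily_of_update {Y : ReducedComplexSpace} {lam1 : ℚ}
    {g : Y → Fin 6 → ℂ} {s : Y → ℂ} (hg : ∀ i, HolOn (fun y => g y i) Set.univ)
    (hp : ∀ y, g y ∈ paramSpace) (hs : HolOn s Set.univ)
    (hM : ∀ i j, SeriesHolOn (fun y => canonicalMatrix lam1 (g y) i j) Set.univ)
    {A : Set (Fin 6 → ℂ)} (hA : IsLocallyAnalytic A) {f : Y → A}
    (hf : ∀ y, (f y).1 = Function.update (g y) 4 (g y 4 + s y * (3 * g y 0 - 5 * g y 2))) :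
    PullbackIsoOn (X := ReducedComplexSpace.ofSet A hA) f Set.univ (canonicalFamily lam1 A hA)
      (ABFamily.ofMatrix Y (fun y => canonicalMatrix lam1 (g y)) hM) := by
  obtain ⟨σ, hσ⟩ : ∃ σ : Fin 6 → holRing Y Set.univ, σ = fun i => ofHolOn _ (hg i) := ⟨_, rfl⟩
  obtain ⟨t, ht⟩ : ∃ t : holRing Y Set.univ, t = ofHolOn s hs := ⟨_, rfl⟩
  have hσg (u : (Set.univ : Set Y)) (i : Fin 6) : eval u (σ i) = g u i := hσ ▸ rfl
  have hne (y : Y) : g y 0 ≠ 0 ∧ g y 2 ≠ 0 := by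
    have hy := hp y
    simp only [paramSpace, Set.mem_ofPred_eq, mul_ne_zero_iff] at hy
    exact hy.1
  obtain ⟨G, hG, h⟩ := exists_intertwines_canonicalEntries_update
    (algebraMap ℂ (holRing Y Set.univ) lam1) t
    (isUnit_iff.2 fun u => (hσg u 0).trans_ne (hne u).1)
    (isUnit_iff.2 fun u => (hσg u 2).trans_ne (hne u).2)
  refine (isFrameOn_ofMatrix hM).pullbackIsoOn_ofMatrix (X := ReducedComplexSpace.ofSet A hA) f _
    hG fun u => ?_
  have hmap := themeMatrix_map (eval u : holRing Y Set.univ →+* ℂ)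
    (algebraMap ℂ (holRing Y Set.univ) lam1)
  simp only [RingHom.coe_coe, AlgHom.commutes, Algebra.algebraMap_self_apply] at hmap
  have hentries (τ : Fin 6 → holRing Y Set.univ) {τ' : Fin 6 → ℂ} (hτ : ∀ i, eval u (τ i) = τ' i) :
      (themeMatrix (algebraMap ℂ (holRing Y Set.univ) lam1) (canonicalEntries τ)).map
        (evalSeries u) = canonicalMatrix lam1 τ' := by
    rw [canonicalMatrix_eq, ← funext hτ]
    exact (hmap _).trans (congrArg _ (funext fun i => canonicalEntries_map _ _ i))
  refine Eq.mp (congrArg₂ (Intertwines · · _) (hentries _ (hσg u)) (hentries _ fun i => ?_))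
    (h.map (eval u : holRing Y Set.univ →+* ℂ))
  rw [hf u]
  obtain rfl | hi := eq_or_ne i 4
  · simp only [Function.update_self, map_add, map_mul, map_sub, map_ofNat, hσg, ht, eval_ofHolOn]
  · simp only [Function.update_of_ne hi, hσg]

end Shift

section ShiftFamily

theorem eq_of_eventually_eq_add_mul {X : Type*} {F : ℂ → X} {c : ℂ} (hc : c ≠ 0) {B : Set ℂ}
    (hB : IsPreconnected B) (h : ∀ ε ∈ B, ∀ᶠ s in 𝓝 (0 : ℂ), F ε = F (ε + s * c)) {ε ε' : ℂ}
    (hε : ε ∈ B) (hε' : ε' ∈ B) : F ε = F ε' := by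
  refine hB.induction₂ (fun ε ε' => F ε = F ε') (fun ε hε => ?_)
    (fun _ _ _ _ _ _ => Eq.trans) (fun _ _ _ _ => Eq.symm) hε hε'
  have htendsto : Filter.Tendsto (fun ε' => (ε' - ε) / c) (𝓝 ε) (𝓝 0) :=
    Continuous.tendsto' (by fun_prop) _ _ (by rw [sub_self, zero_div])
  filter_upwards [nhdsWithin_le_nhds (htendsto.eventually (h ε hε))] with ε' hε'
  rwa [div_mul_cancel₀ _ hc, add_sub_cancel] at hε'

theorem eventually_eq_of_eventually_eq_add_mul {X : Type*} [TopologicalSpace X] [T2Space X]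
    {F : ℂ → ℂ → X} {c : ℂ → ℂ} {α₀ ε₀ : ℂ} (hc : ∀ α ≠ α₀, c α ≠ 0)
    (h : ∀ᶠ p : ℂ × ℂ × ℂ in 𝓝 (α₀, ε₀, 0), F p.1 p.2.1 = F p.1 (p.2.1 + p.2.2 * c p.1))
    (hF : ∀ᶠ ε in 𝓝 ε₀, ContinuousAt (F · ε) α₀) : ∀ᶠ ε in 𝓝 ε₀, F α₀ ε = F α₀ ε₀ := by
  rw [nhds_prod_eq, Filter.eventually_prod_iff] at h
  obtain ⟨P, hP, Q, hQ, hPQ⟩ := h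
  obtain ⟨r, hr, hball⟩ := Metric.eventually_nhds_iff_ball.1 hQ.curry_nhds
  filter_upwards [hF, Metric.ball_mem_nhds ε₀ hr] with ε hε hεr
  refine tendsto_nhds_unique_of_eventuallyEq (hε.tendsto.mono_left nhdsWithin_le_nhds)
    (hF.self_of_nhds.tendsto.mono_left nhdsWithin_le_nhds) (l := 𝓝[≠] α₀) ?_
  filter_upwards [nhdsWithin_le_nhds hP, self_mem_nhdsWithin] with α hα hne
  exact eq_of_eventually_eq_add_mul (hc α hne) (convex_ball ε₀ r).isPreconnected
    (fun ε' hε' => (hball ε' hε').mono fun s hs => hPQ hα hs) hεr (Metric.mem_ball_self hr)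

/-- The parameters `σ` with the coordinates `α` and `ε` replaced. -/
def withAlphaEps (σ : Fin 6 → ℂ) (α ε : ℂ) : Fin 6 → ℂ := ![α, σ 1, σ 2, σ 3, ε, σ 5]

variable {lam1 : ℚ} {σ : Fin 6 → ℂ}

theorem withAlphaEps_eq_update (σ : Fin 6 → ℂ) (ε : ℂ) :
    withAlphaEps σ (σ 0) ε = Function.update σ 4 ε := by
  ext i; fin_cases i <;> rfl

theorem update_withAlphaEps (σ : Fin 6 → ℂ) (α ε ε' : ℂ) :
    Function.update (withAlphaEps σ α ε) 4 ε' = withAlphaEps σ α ε' := by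
  ext i; fin_cases i <;> rfl

theorem withAlphaEps_mem_paramSpace (hσ : σ ∈ paramSpace) {α : ℂ} (hα : α ≠ 0) (ε : ℂ) :
    withAlphaEps σ α ε ∈ paramSpace := by
  simp only [paramSpace, Set.mem_ofPred_eq, mul_ne_zero_iff] at hσ
  exact mul_ne_zero (mul_ne_zero hα hσ.1.2) hσ.2

theorem continuous_withAlphaEps (σ : Fin 6 → ℂ) :
    Continuous fun p : ℂ × ℂ => withAlphaEps σ p.1 p.2 := by
  unfold withAlphaEps
  fun_prop

theorem analyticAt_withAlphaEps {n : ℕ} (σ : Fin 6 → ℂ) {F G : (Fin n → ℂ) → ℂ}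
    {z : Fin n → ℂ} (hF : AnalyticAt ℂ F z) (hG : AnalyticAt ℂ G z) (i : Fin 6) :
    AnalyticAt ℂ (fun z => withAlphaEps σ (F z) (G z) i) z := by
  fin_cases i
  exacts [hF, analyticAt_const, analyticAt_const, analyticAt_const, hG, analyticAt_const]

/-- The base, with coordinates `(α, ε, s)`, of a family which the canonical family induces in two
ways: `(α, ε, s)` goes to `(α, ε)` or to `(α, ε + s (3 α - 5 γ))`. -/
def shiftSpace : Set (Fin 3 → ℂ) := {z | z 0 ≠ 0}

theorem isOpen_shiftSpace : IsOpen shiftSpace := isOpen_ne_fun (by fun_prop) continuous_const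

variable {X : ReducedComplexSpace} {E : ABFamily X} {x₀ : X} {z₀ : shiftSpace}

/-- The map `(α, ε, s) ↦ (α, ε + t (3 α - 5 γ))` to the parameter space, where `t` is a function of
`(α, ε, s)` and the other parameters are those of `σ`. -/
def shiftMap (hσ : σ ∈ paramSpace) (t : (Fin 3 → ℂ) → ℂ) (z : shiftSpace) : paramSpace :=
  ⟨withAlphaEps σ (z.1 0) (z.1 1 + t z * (3 * z.1 0 - 5 * σ 2)),
    withAlphaEps_mem_paramSpace hσ z.2 _⟩

theorem holOn_shiftMap (hσ : σ ∈ paramSpace) {t : (Fin 3 → ℂ) → ℂ} (ht : ∀ z, AnalyticAt ℂ t z)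
    (i : Fin 6) : HolOn (X := .ofSet shiftSpace (isLocallyAnalytic_of_isOpen isOpen_shiftSpace))
      (fun z => (shiftMap hσ t z).1 i) Set.univ :=
  holOn_ofSet _ (F := fun z => withAlphaEps σ (z 0) (z 1 + t z * (3 * z 0 - 5 * σ 2)) i)
    (fun z => analyticAt_withAlphaEps σ (analyticAt_coord 0 z) ((analyticAt_coord 1 z).add
      ((ht z).mul ((analyticAt_const.mul (analyticAt_coord 0 z)).sub analyticAt_const))) i) _

theorem seriesHolOn_canonicalMatrix_comp (lam1 : ℚ) {Y : ReducedComplexSpace} {V : Set Y}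
    {A : Set (Fin 6 → ℂ)} (hA : IsLocallyAnalytic A) {g : Y → A}
    (hg : ∀ i, HolOn (fun y => (g y).1 i) V) (i j : Fin 4) :
    SeriesHolOn (fun y => canonicalMatrix lam1 (g y).1 i j) V := fun n y hy =>
  HolAt.comp_map (Z := .ofSet A hA) (holMapOn_ofSet hA hg) hy
    (seriesHolOn_canonicalMatrix lam1 A hA i j n (g y) trivial)

/-- The family induced by the canonical family along `shiftMap hσ 0`. -/
def shiftFamily (lam1 : ℚ) (hσ : σ ∈ paramSpace) :
    ABFamily (.ofSet shiftSpace (isLocallyAnalytic_of_isOpen isOpen_shiftSpace)) :=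
  ABFamily.ofMatrix _ (fun z : shiftSpace => canonicalMatrix lam1 (shiftMap hσ 0 z).1)
    (seriesHolOn_canonicalMatrix_comp lam1 (isLocallyAnalytic_of_isOpen isOpen_paramSpace)
      (holOn_shiftMap hσ fun _ => analyticAt_const))

theorem isThemeFamily_shiftFamily (hlam1 : 3 < lam1) (hσ : σ ∈ paramSpace) :
    IsThemeFamily (r := 3) lam1 ![3, 2, 2] (shiftFamily lam1 hσ) :=
  isThemeFamily_ofMatrix hlam1 (holOn_shiftMap hσ fun _ => analyticAt_const)
    (fun z => (shiftMap hσ 0 z).2) _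

theorem classifies_shiftMap (hσ : σ ∈ paramSpace) (hz₀ : z₀.1 = ![σ 0, σ 4, 0])
    {t : (Fin 3 → ℂ) → ℂ} (ht : ∀ z, AnalyticAt ℂ t z) (ht₀ : t z₀ = 0) :
    Classifies (canonicalFamily lam1 paramSpace (isLocallyAnalytic_of_isOpen isOpen_paramSpace))
      ⟨σ, hσ⟩ (shiftFamily lam1 hσ) z₀ (shiftMap hσ t) := by
  refine ⟨Subtype.ext ?_, Set.univ, isOpen_univ, trivial, holMapOn_ofSet _ (holOn_shiftMap hσ ht),
    pullbackIsoOn_canonicalFamily_of_update (s := fun z : shiftSpace => t z)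
      (holOn_shiftMap hσ fun _ => analyticAt_const)
      (fun z => (shiftMap hσ 0 z).2) (holOn_ofSet _ ht _) _ _ fun z => ?_⟩
  · change withAlphaEps σ (z₀.1 0) (z₀.1 1 + t z₀ * (3 * z₀.1 0 - 5 * σ 2)) = σ
    rw [ht₀, hz₀, zero_mul, add_zero]
    exact (withAlphaEps_eq_update σ _).trans (Function.update_eq_self 4 σ)
  · refine .trans ?_ (update_withAlphaEps σ _ _ _).symm
    change withAlphaEps σ _ _ = withAlphaEps σ _
      (z.1 1 + 0 * (3 * z.1 0 - 5 * σ 2) + t z.1 * (3 * z.1 0 - 5 * σ 2))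
    rw [zero_mul, add_zero]

theorem IsUniversalNear.eventually_shiftMap_eq (hlam1 : 3 < lam1)
    (hE : IsUniversalNear (r := 3) lam1 ![3, 2, 2] E x₀) (hσ : σ ∈ paramSpace)
    (hz₀ : z₀.1 = ![σ 0, σ 4, 0])
    (hiso : Isomorphic (E.fiber x₀) (canonicalTheme lam1 σ)) {f : paramSpace → X}
    (hf : Classifies E x₀ (canonicalFamily lam1 paramSpace
      (isLocallyAnalytic_of_isOpen isOpen_paramSpace)) ⟨σ, hσ⟩ f) :
    ∀ᶠ z in 𝓝 z₀, f (shiftMap hσ 0 z) = f (shiftMap hσ (fun z => z 2) z) := by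
  have hclass₀ := classifies_shiftMap (lam1 := lam1) (t := 0) hσ hz₀
    (fun _ => analyticAt_const) rfl
  have hclass := classifies_shiftMap (lam1 := lam1) hσ hz₀ (analyticAt_coord 2) (by rw [hz₀]; rfl)
  have hmem : LocalFrame.standard _ ∈ (canonicalFamily lam1 paramSpace
    (isLocallyAnalytic_of_isOpen isOpen_paramSpace)).atlas := rfl
  refine (hE.2 _ _ z₀ (isThemeFamily_shiftFamily hlam1 hσ) ?_).2 _ _ (hf.comp hmem rfl hclass₀)
    (hf.comp hmem rfl hclass)
  change Isomorphic (canonicalTheme lam1 (shiftMap hσ 0 z₀).1) _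
  rw [hclass₀.1]
  exact hiso.symm

end ShiftFamily

section NotUniversal

variable {lam1 : ℚ} {σ : Fin 6 → ℂ} {X : ReducedComplexSpace} {E : ABFamily X} {x₀ : X}

theorem IsUniversalNear.eventually_eq_shift (hlam1 : 3 < lam1)
    (hE : IsUniversalNear (r := 3) lam1 ![3, 2, 2] E x₀) (hσ : σ ∈ paramSpace)
    (hiso : Isomorphic (E.fiber x₀) (canonicalTheme lam1 σ)) {f : paramSpace → X}
    (hf : Classifies E x₀ (canonicalFamily lam1 paramSpace
      (isLocallyAnalytic_of_isOpen isOpen_paramSpace)) ⟨σ, hσ⟩ f)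
    {F : (Fin 6 → ℂ) → X} (hF : ∀ τ : paramSpace, F τ = f τ) :
    ∀ᶠ p : ℂ × ℂ × ℂ in 𝓝 (σ 0, σ 4, 0), F (withAlphaEps σ p.1 p.2.1) =
      F (withAlphaEps σ p.1 (p.2.1 + p.2.2 * (3 * p.1 - 5 * σ 2))) := by
  have hz₀ : ![σ 0, σ 4, 0] ∈ shiftSpace := (mul_ne_zero_iff.1 (mul_ne_zero_iff.1 hσ).1).1
  have hshift := hE.eventually_shiftMap_eq (z₀ := ⟨_, hz₀⟩) hlam1 hσ rfl hiso hf
  have hnhds := isOpen_shiftSpace.isOpenEmbedding_subtypeVal.map_nhds_eq ⟨_, hz₀⟩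
  have htotal : ∀ᶠ z in 𝓝 ![σ 0, σ 4, 0], F (withAlphaEps σ (z 0) (z 1)) =
      F (withAlphaEps σ (z 0) (z 1 + z 2 * (3 * z 0 - 5 * σ 2))) := by
    rw [← hnhds, Filter.eventually_map]
    filter_upwards [hshift] with z hz
    rw [← hF, ← hF] at hz
    simpa only [shiftMap, Pi.zero_apply, zero_mul, add_zero] using hz
  have hcont : Continuous fun p : ℂ × ℂ × ℂ => ![p.1, p.2.1, p.2.2] := by fun_prop
  exact (hcont.tendsto' (σ 0, σ 4, 0) ![σ 0, σ 4, 0] rfl).eventually htotal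

theorem IsUniversalNear.exists_isomorphic_update (hlam1 : 3 < lam1)
    (hE : IsUniversalNear (r := 3) lam1 ![3, 2, 2] E x₀) (hσ : σ ∈ paramSpace)
    (hαγ : 3 * σ 0 = 5 * σ 2) (hiso : Isomorphic (E.fiber x₀) (canonicalTheme lam1 σ)) :
    ∃ ε ≠ σ 4,
      Isomorphic (canonicalTheme lam1 σ) (canonicalTheme lam1 (Function.update σ 4 ε)) := by
  obtain ⟨f, hf⟩ := (hE.2 _ (canonicalFamily lam1 paramSpace
    (isLocallyAnalytic_of_isOpen isOpen_paramSpace)) (⟨σ, hσ⟩ : paramSpace)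
    (isThemeFamily_canonicalFamily hlam1 _ fun _ h => h) hiso.symm).1
  obtain ⟨F, hF⟩ : ∃ F : (Fin 6 → ℂ) → X, ∀ τ : paramSpace, F τ = f τ :=
    ⟨Function.extend Subtype.val f fun _ => x₀, Subtype.val_injective.extend_apply f _⟩
  have hshift := hE.eventually_eq_shift hlam1 hσ hiso hf hF
  obtain ⟨-, U, hU, hσU, hfU, hfiso⟩ := hf
  have hFcont (τ : paramSpace) (hτ : τ ∈ U) : ContinuousAt F τ :=
    isOpen_paramSpace.isOpenEmbedding_subtypeVal.continuousAt_iff.1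
      ((funext hF : F ∘ Subtype.val = f) ▸ (hfU τ hτ).1)
  have hσ₀ : withAlphaEps σ (σ 0) (σ 4) = σ :=
    (withAlphaEps_eq_update σ _).trans (Function.update_eq_self 4 σ)
  have hmem : ∀ᶠ ε in 𝓝 (σ 4), withAlphaEps σ (σ 0) ε ∈ Subtype.val '' U :=
    ((continuous_withAlphaEps σ).comp (.prodMk_right (σ 0))).continuousAt.eventually_mem
      ((isOpen_paramSpace.isOpenMap_subtype_val _ hU).mem_nhds ⟨_, hσU, hσ₀.symm⟩)
  have hconst := eventually_eq_of_eventually_eq_add_mul (F := fun α ε => F (withAlphaEps σ α ε))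
    (fun α hα => sub_ne_zero.2 fun h => hα (mul_left_cancel₀ three_ne_zero (h.trans hαγ.symm)))
    hshift <| hmem.mono fun ε ⟨τ, hτ, hτε⟩ =>
      (hFcont τ hτ).comp_of_eq (f := fun α => withAlphaEps σ α ε)
        ((continuous_withAlphaEps σ).comp (.prodMk_left ε)).continuousAt hτε.symm
  obtain ⟨ε, ⟨⟨τ, hτ, hτε⟩, hFε⟩, hε⟩ := (((hmem.and hconst).filter_mono nhdsWithin_le_nhds).and
    (self_mem_nhdsWithin : {σ 4}ᶜ ∈ 𝓝[≠] (σ 4))).exists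
  have hfτ : f τ = f ⟨σ, hσ⟩ := by rw [← hF, ← hF, hτε, hFε, hσ₀]
  refine ⟨ε, hε, ?_⟩
  rw [← withAlphaEps_eq_update, ← hτε]
  exact (hfiso.isomorphic hσU).symm.trans (hfτ ▸ hfiso.isomorphic hτ)

theorem not_isUniversalNear (hlam1 : 3 < lam1) (hσ : σ ∈ paramSpace)
    (hαγ : 3 * σ 0 = 5 * σ 2) (hiso : Isomorphic (E.fiber x₀) (canonicalTheme lam1 σ)) :
    ¬ IsUniversalNear (r := 3) lam1 ![3, 2, 2] E x₀ := fun hE => by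
  obtain ⟨ε, hε, hσε⟩ := hE.exists_isomorphic_update hlam1 hσ hαγ hiso
  have hγ : σ 2 ≠ 0 := (mul_ne_zero_iff.1 (mul_ne_zero_iff.1 hσ).1).2
  have hupdate := congrFun (eq_of_isomorphic_canonicalTheme hγ hαγ hσε) 4
  rw [Function.update_self] at hupdate
  exact hε hupdate.symm

end NotUniversal

end Themes

end

theorem mainTheorem6 (lam1 : ℚ) (hlam1 : 3 < lam1) :
    -- the canonical family is a holomorphic family of themes with the given invariants
    Themes.IsThemeFamily lam1 ![3, 2, 2]
      (Themes.canonicalFamily lam1 Themes.paramSpace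
        (Themes.isLocallyAnalytic_of_isOpen Themes.isOpen_paramSpace)) ∧
    -- off the hyperplane `3α = 5γ`: not invariant, and `ε` does not matter
    (∀ σ ∈ Themes.paramSpace, 3 * σ 0 ≠ 5 * σ 2 →
      ¬ Themes.IsInvariant (Themes.canonicalTheme lam1 σ) ∧
      ∀ ε : ℂ, Themes.Isomorphic (Themes.canonicalTheme lam1 (Function.update σ 4 ε))
        (Themes.canonicalTheme lam1 σ)) ∧
    -- on the hyperplane: invariant, without local universal family
    (∀ σ ∈ Themes.paramSpace, 3 * σ 0 = 5 * σ 2 →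
      Themes.IsInvariant (Themes.canonicalTheme lam1 σ) ∧
      ¬ ∃ (X : Themes.ReducedComplexSpace) (E : Themes.ABFamily X) (x₀ : X),
        Themes.Isomorphic (E.fiber x₀) (Themes.canonicalTheme lam1 σ) ∧
        Themes.IsUniversalNear lam1 ![3, 2, 2] E x₀) ∧
    -- off the hyperplane: the restriction to a neighbourhood in the slice is universal
    (∀ σ ∈ Themes.paramSpace, 3 * σ 0 ≠ 5 * σ 2 →
      ∃ (W : Set (Fin 6 → ℂ)) (hW : IsOpen W), W ⊆ Themes.paramSpace ∧ σ ∈ W ∧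
        (∀ τ : Themes.slice W (σ 4),
          Themes.IsUniversalNear lam1 ![3, 2, 2]
            (Themes.canonicalFamily lam1 (Themes.slice W (σ 4))
              (Themes.isLocallyAnalytic_slice hW (σ 4))) τ) ∧
        ∀ τ ∈ Themes.slice W (σ 4), ∀ τ' ∈ Themes.slice W (σ 4),
          Themes.Isomorphic (Themes.canonicalTheme lam1 τ) (Themes.canonicalTheme lam1 τ') →
            τ = τ') := by
  refine ⟨Themes.isThemeFamily_canonicalFamily hlam1 _ fun _ h => h,
    fun σ hσ h => ⟨Themes.not_isInvariant_canonicalTheme h, fun ε =>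
      (Themes.isomorphic_canonicalTheme_update lam1 hσ h ε).symm⟩,
    fun σ hσ h => ⟨Themes.isInvariant_canonicalTheme hσ h, ?_⟩,
    fun σ hσ h => ⟨Themes.stableParams, Themes.isOpen_stableParams, fun _ hτ => hτ.1, ⟨hσ, h⟩,
      Themes.isUniversalNear_slice hlam1 (σ 4),
      fun τ hτ τ' hτ' => Themes.eq_of_isomorphic_of_mem_slice hτ hτ'⟩⟩
  rintro ⟨X, E, x₀, hiso, hE⟩
  exact Themes.not_isUniversalNear hlam1 hσ h hiso hE
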